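/- Let $F$ be a probability distribution on $(0,\infty)$ and suppose that, for some $\lambda,a>0$, its distribution function satisfies $$F(x)\sim \frac{\lambda^a x^a}{\Gamma(a+1)}\qquad\text{as }x\downarrow 0 .$$ For each $n$ let $X_1,\dots,X_n$ be i.i.d. with distribution $F$, with increasing order statistics $X_n^{\uparrow}(1)\le\dots\le X_n^{\uparrow}(n)$, and let $X_n[k]=X_{\sigma_k}$, $1\le k\le n$, be their size-biased permutation: given $X_1,\dots,X_n$, the random permutation $\sigma$ of $\{1,\dots,n\}$ satisfies, for all distinct $i_1,\dots,i_k$, $$\mathbb P(\sigma_k=i_k\mid \sigma_1=i_1,\dots,\sigma_{k-1}=i_{k-1})=\frac{X_{i_k}}{\sum_{i=1}^n X_i-(X_{i_1}+\dots+X_{i_{k-1}})} .$$ Write $X_n^{rev}[k]=X_n[n-k+1]$ for the $k$-th last pick, and $\xrightarrow{f.d.d.}$ for convergence in distribution of all finite-dimensional distributions as $n\to\infty$. Let $T_{(k)}=\epsilon'_1+\dots+\epsilon'_k$ where the $\epsilon'_i$ are i.i.d. standard exponential, let $\gamma_1,\gamma_2,\dots$ be i.i.d. $gamma(a+1,1)$,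 the sequences $(\epsilon'_k)$ and $(\gamma_k)$ being independent, and put $$\xi^{rev}[k]=T_{(k)}^{1/a}\,\gamma_k/\lambda,\qquad k\ge 1 .$$ (a) $\big(n^{1/a}X_n^{rev}[k],\,1\le k\le n\big)\xrightarrow{f.d.d.}\big(\xi^{rev}[k],\,k\ge1\big)$. (b) Almost surely the increasing order statistics $\xi^{rev}(1)<\xi^{rev}(2)<\cdots$ of the $\xi^{rev}[k]$'s are well defined and strictly increasing, and there are i.i.d. standard exponential variables $\epsilon_1,\epsilon_2,\dots$ on the same probability space such that almost surely, for all $k\ge1$, $$\xi^{rev}(k)=(\epsilon_1+\dots+\epsilon_k)^{1/a}\,\Gamma(a+1)^{1/a}/\lambda .$$ Moreover $\big(n^{1/a}X_n^{\uparrow}(k),\,1\le k\le n\big)\xrightarrow{f.d.d.}\big(\xi^{rev}(k),\,k\ge1\big)$, jointly with the convergence in (a). (c) Almost surely there is a permutation $(J_k)_{k\ge1}$ of $\{1,2,\dots\}$ with $\xi^{rev}[k]=\xi^{rev}(J_k)$ for all $k$. For each $n$ let $(J_{nk})_{1\le k\le n}$ be a random permutation of $\{1,\dots,n\}$ with $X_n^{rev}[k]=X_n^{\uparrow}(J_{nk})$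 for all $k$ (ties among the $X_i$ may be broken in any measurable way). Then $(J_{nk},\,1\le k\le n)\xrightarrow{f.d.d.}(J_k,\,k\ge1)$, and this convergence and those in (a) and (b) all hold jointly. -/

import Mathlib

open MeasureTheory ProbabilityTheory Filter Topology
open scoped Asymptotics

noncomputable section

/-- The random permutation `σ` of `Fin n` (`σ ω j` is the index picked at position `j`) arranges
the random variables `X i` in size-biased order. Conditionally on the values of `X`, for all
distinct indices `i_1, …, i_k`,
`ℙ(σ_1 = i_1, …, σ_k = i_k) = ℙ(σ_1 = i_1, …, σ_{k-1} = i_{k-1}) * x_{i_k} / (t - (x_{i_1} + … + x_{i_{k-1}}))`,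
where `t` is the sum of all the `x_i`. The distinct indices are given as the first values of a
permutation `π`, and positions are counted from `0`. -/
structure IsSizeBiasedPermutation {n : ℕ} {Ω : Type*} [MeasurableSpace Ω] (P : Measure Ω)
    (X : Fin n → Ω → ℝ) (σ : Ω → Equiv.Perm (Fin n)) : Prop where
  measurable : ∀ j, Measurable (fun ω => σ ω j)
  condProb : ∀ (π : Equiv.Perm (Fin n)) (k : Fin n),
    P⟦{ω | ∀ j ≤ k, σ ω j = π j} | MeasurableSpace.comap (fun ω i => X i ω) MeasurableSpace.pi⟧
      =ᵐ[P] fun ω =>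
        (P⟦{ω' | ∀ j < k, σ ω' j = π j} |
            MeasurableSpace.comap (fun ω' i => X i ω') MeasurableSpace.pi⟧) ω
          * (X (π k) ω / (∑ i, X i ω - ∑ j ∈ Finset.Iio k, X (π j) ω))

/-- The finite sequence `x` read backwards, as a function on `ℕ` counted from `0`
(with the value `0` beyond the length of `x`). -/
def revSeq {n : ℕ} (x : Fin n → ℝ) (k : ℕ) : ℝ :=
  if h : k < n then x (Fin.rev ⟨k, h⟩) else 0

/-- The increasing order statistics of the finite sequence `x`, counted from `0`
(with the value `0` beyond the length of `x`). -/
def finOrderStat {n : ℕ} (x : Fin n → ℝ) (k : ℕ) : ℝ :=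
  if h : k < n then x (Tuple.sort x ⟨k, h⟩) else 0

/-- A permutation of `Fin n` as a function on `ℕ` (with the value `0` beyond `n`). -/
def permSeq {n : ℕ} (J : Equiv.Perm (Fin n)) (k : ℕ) : ℕ :=
  if h : k < n then (J ⟨k, h⟩ : ℕ) else 0

/-- The increasing order statistics of an infinite sequence: the `k`-th smallest term (counted
from `0`) is the least `t` such that at least `k + 1` terms are at most `t`. -/
def seqOrderStat (x : ℕ → ℝ) (k : ℕ) : ℝ :=
  sInf {t : ℝ | (k + 1 : ℕ∞) ≤ {i : ℕ | x i ≤ t}.encard}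

/-- Convergence in distribution of all finite-dimensional distributions, as `n → ∞`, of a sequence
of processes indexed by `ℕ` with values in `E` (each defined on its own probability space). -/
def TendstoFDD {E : Type*} [TopologicalSpace E] [SecondCountableTopology E] [MeasurableSpace E]
    [OpensMeasurableSpace E] {Ω : ℕ → Type*} [∀ n, MeasurableSpace (Ω n)]
    {Ω' : Type*} [MeasurableSpace Ω']
    (Y : (n : ℕ) → ℕ → Ω n → E) (Z : ℕ → Ω' → E)
    (P : (n : ℕ) → Measure (Ω n)) [∀ n, IsProbabilityMeasure (P n)]
    (P' : Measure Ω') [IsProbabilityMeasure P'] : Prop :=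
  ∀ I : Finset ℕ, TendstoInDistribution (fun n ω (k : I) => Y n k ω) atTop
    (fun ω (k : I) => Z k ω) P P'

/-- The limit `T_{(k)}^{1/a} γ_k / r`, where `T_{(k)}` is the sum of the terms `0, …, k` of `e`. -/
def limitPick (a r : ℝ) (e g : ℕ → ℝ) (k : ℕ) : ℝ :=
  (∑ i ∈ Finset.range (k + 1), e i) ^ (1 / a) * g k / r

end

open scoped ENNReal

/-! ### Iterated integrals over finite products of one measure -/

section PiIntegrals

variable {α : Type*} [MeasurableSpace α]

theorem measurable_finCons {n : ℕ} :
    Measurable fun p : α × (Fin n → α) => (Fin.cons p.1 p.2 : Fin (n + 1) → α) := by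
  refine measurable_pi_iff.2 fun i => ?_
  refine Fin.cases ?_ (fun j => ?_) i
  · simpa using measurable_fst
  · simpa using measurable_pi_iff.1 measurable_snd j

theorem measurable_finSnoc {n : ℕ} :
    Measurable fun p : (Fin n → α) × α => (Fin.snoc p.1 p.2 : Fin (n + 1) → α) := by
  refine measurable_pi_iff.2 fun i => ?_
  refine Fin.lastCases ?_ (fun j => ?_) i
  · simpa using measurable_snd
  · simpa using measurable_pi_iff.1 measurable_fst j

theorem measurable_finAppend {k m : ℕ} :
    Measurable fun p : (Fin k → α) × (Fin m → α) => Fin.append p.1 p.2 := by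
  refine measurable_pi_iff.2 fun i => ?_
  refine Fin.addCases (fun j => ?_) (fun j => ?_) i
  · simpa using measurable_pi_iff.1 measurable_fst j
  · simpa using measurable_pi_iff.1 measurable_snd j

variable (μ : Measure α) [SigmaFinite μ]

theorem measurePreserving_finCons (n : ℕ) :
    MeasurePreserving (fun p : α × (Fin n → α) => (Fin.cons p.1 p.2 : Fin (n + 1) → α))
      (μ.prod (Measure.pi fun _ => μ)) (Measure.pi fun _ => μ) := by
  refine ⟨measurable_finCons, (Measure.pi_eq fun s hs => ?_).symm⟩
  rw [Measure.map_apply measurable_finCons (MeasurableSet.univ_pi hs)]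
  have : (fun p : α × (Fin n → α) => (Fin.cons p.1 p.2 : Fin (n + 1) → α)) ⁻¹'
      Set.pi Set.univ s = s 0 ×ˢ Set.pi Set.univ fun i => s i.succ := by
    ext p
    simp [Set.mem_pi, Fin.forall_fin_succ]
  rw [this, Measure.prod_prod, Measure.pi_pi, Fin.prod_univ_succ]

theorem measurePreserving_finSnoc (n : ℕ) :
    MeasurePreserving (fun p : (Fin n → α) × α => (Fin.snoc p.1 p.2 : Fin (n + 1) → α))
      ((Measure.pi fun _ => μ).prod μ) (Measure.pi fun _ => μ) := by
  refine ⟨measurable_finSnoc, (Measure.pi_eq fun s hs => ?_).symm⟩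
  rw [Measure.map_apply measurable_finSnoc (MeasurableSet.univ_pi hs)]
  have : (fun p : (Fin n → α) × α => (Fin.snoc p.1 p.2 : Fin (n + 1) → α)) ⁻¹'
      Set.pi Set.univ s = (Set.pi Set.univ fun i => s i.castSucc) ×ˢ s (Fin.last n) := by
    ext p
    simp [Set.mem_pi, Fin.forall_fin_succ']
  rw [this, Measure.prod_prod, Measure.pi_pi, Fin.prod_univ_castSucc]

theorem measurePreserving_finAppend (k m : ℕ) :
    MeasurePreserving (fun p : (Fin k → α) × (Fin m → α) => Fin.append p.1 p.2)
      ((Measure.pi fun _ => μ).prod (Measure.pi fun _ => μ)) (Measure.pi fun _ => μ) := by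
  refine ⟨measurable_finAppend, (Measure.pi_eq fun s hs => ?_).symm⟩
  rw [Measure.map_apply measurable_finAppend (MeasurableSet.univ_pi hs)]
  have : (fun p : (Fin k → α) × (Fin m → α) => Fin.append p.1 p.2) ⁻¹' Set.pi Set.univ s =
      (Set.pi Set.univ fun i => s (Fin.castAdd m i)) ×ˢ
        (Set.pi Set.univ fun i => s (Fin.natAdd k i)) := by
    ext p
    constructor
    · intro h
      refine ⟨fun i _ => ?_, fun i _ => ?_⟩
      · simpa using h (Fin.castAdd m i) trivial
      · simpa using h (Fin.natAdd k i) trivial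
    · rintro ⟨h1, h2⟩ i -
      refine Fin.addCases (fun j => ?_) (fun j => ?_) i
      · simpa using h1 j trivial
      · simpa using h2 j trivial
  rw [this, Measure.prod_prod, Measure.pi_pi, Measure.pi_pi, Fin.prod_univ_add]

theorem lintegral_pi_cons {n : ℕ} {f : (Fin (n + 1) → α) → ℝ≥0∞} (hf : Measurable f) :
    ∫⁻ x, f x ∂(Measure.pi fun _ => μ) =
      ∫⁻ a, ∫⁻ x, f (Fin.cons a x) ∂(Measure.pi fun _ => μ) ∂μ := by
  rw [← (measurePreserving_finCons μ n).lintegral_comp hf,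
    lintegral_prod (fun p => f (Fin.cons p.1 p.2)) (hf.comp measurable_finCons).aemeasurable]

theorem lintegral_pi_snoc {n : ℕ} {f : (Fin (n + 1) → α) → ℝ≥0∞} (hf : Measurable f) :
    ∫⁻ x, f x ∂(Measure.pi fun _ => μ) =
      ∫⁻ x, ∫⁻ a, f (Fin.snoc x a) ∂μ ∂(Measure.pi fun _ => μ) := by
  rw [← (measurePreserving_finSnoc μ n).lintegral_comp hf,
    lintegral_prod (fun p => f (Fin.snoc p.1 p.2)) (hf.comp measurable_finSnoc).aemeasurable]

theorem lintegral_pi_append {k m : ℕ} {f : (Fin (k + m) → α) → ℝ≥0∞} (hf : Measurable f) :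
    ∫⁻ x, f x ∂(Measure.pi fun _ => μ) =
      ∫⁻ y, ∫⁻ z, f (Fin.append y z) ∂(Measure.pi fun _ => μ) ∂(Measure.pi fun _ => μ) := by
  rw [← (measurePreserving_finAppend μ k m).lintegral_comp hf,
    lintegral_prod (fun p => f (Fin.append p.1 p.2)) (hf.comp measurable_finAppend).aemeasurable]

theorem lintegral_pi_perm {ι : Type*} [Fintype ι] (π : Equiv.Perm ι) {f : (ι → α) → ℝ≥0∞}
    (hf : Measurable f) :
    ∫⁻ x, f (x ∘ π) ∂(Measure.pi fun _ => μ) = ∫⁻ x, f x ∂(Measure.pi fun _ => μ) := by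
  have h : MeasurePreserving (fun x : ι → α => x ∘ π) (Measure.pi fun _ => μ)
      (Measure.pi fun _ => μ) := by
    have hm : Measurable (fun x : ι → α => x ∘ π) :=
      measurable_pi_iff.2 fun i => measurable_pi_apply (π i)
    refine ⟨hm, (Measure.pi_eq fun s hs => ?_).symm⟩
    rw [Measure.map_apply hm (MeasurableSet.univ_pi hs)]
    have : (fun x : ι → α => x ∘ π) ⁻¹' Set.pi Set.univ s =
        Set.pi Set.univ fun i => s (π.symm i) := by
      ext x
      simp only [Set.mem_preimage, Set.mem_pi, Set.mem_univ, true_imp_iff, Function.comp]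
      exact ⟨fun h i => by simpa using h (π.symm i), fun h i => by simpa using h (π i)⟩
    rw [this, Measure.pi_pi, Equiv.prod_comp π.symm fun i => μ (s i)]
  exact h.lintegral_comp hf

end PiIntegrals

/-! ### The weight of an order of size-biased picks -/

/-- The probability that the positive sizes `x`, together with a block of total size `s`, are
picked in size-biased order, last index first, and the block at the end. -/
noncomputable def biasWeight {n : ℕ} (s : ℝ) (x : Fin n → ℝ) : ℝ≥0∞ :=
  ∏ k, ENNReal.ofReal (x k / (s + ∑ j ∈ Finset.Iic k, x j))

theorem measurable_biasWeight_uncurry {n : ℕ} :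
    Measurable fun p : ℝ × (Fin n → ℝ) => biasWeight p.1 p.2 := by
  unfold biasWeight
  fun_prop

@[fun_prop]
theorem Measurable.biasWeight {β : Type*} [MeasurableSpace β] {n : ℕ} {f : β → ℝ}
    {g : β → Fin n → ℝ} (hf : Measurable f) (hg : Measurable g) :
    Measurable fun b => biasWeight (f b) (g b) :=
  measurable_biasWeight_uncurry.comp (hf.prodMk hg)

theorem biasWeight_zero (s : ℝ) (x : Fin 0 → ℝ) : biasWeight s x = 1 := by
  simp [biasWeight]

theorem sum_Iic_succ_cons {n : ℕ} (a : ℝ) (x : Fin n → ℝ) (k : Fin n) :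
    ∑ j ∈ Finset.Iic k.succ, (Fin.cons a x : Fin (n + 1) → ℝ) j =
      a + ∑ j ∈ Finset.Iic k, x j := by
  have h : ∀ {m : ℕ} (k : Fin m) (y : Fin m → ℝ), ∑ j ∈ Finset.Iic k, y j =
      ∑ j, if j ≤ k then y j else 0 := by
    intro m k y
    rw [← Finset.sum_filter]
    congr 1
    ext j
    simp
  rw [h, h, Fin.sum_univ_succ]
  simp

theorem biasWeight_cons {n : ℕ} (s a : ℝ) (x : Fin n → ℝ) :
    biasWeight s (Fin.cons a x : Fin (n + 1) → ℝ) =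
      ENNReal.ofReal (a / (s + a)) * biasWeight (s + a) x := by
  unfold biasWeight
  rw [Fin.prod_univ_succ]
  congr 1
  · have : Finset.Iic (0 : Fin (n + 1)) = {0} := by
      ext j
      simp
    simp [this]
  · refine Finset.prod_congr rfl fun k _ => ?_
    rw [sum_Iic_succ_cons, Fin.cons_succ, add_assoc]

theorem sum_Iic_append {k m : ℕ} (y : Fin k → ℝ) (z : Fin m → ℝ) :
    (∀ i, ∑ j ∈ Finset.Iic (Fin.castAdd m i), Fin.append y z j = ∑ j ∈ Finset.Iic i, y j) ∧
    ∀ i, ∑ j ∈ Finset.Iic (Fin.natAdd k i), Fin.append y z j =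
      ∑ j, y j + ∑ j ∈ Finset.Iic i, z j := by
  have h : ∀ {m : ℕ} (k : Fin m) (y : Fin m → ℝ), ∑ j ∈ Finset.Iic k, y j =
      ∑ j, if j ≤ k then y j else 0 := by
    intro m k y
    rw [← Finset.sum_filter]
    congr 1
    ext j
    simp
  constructor
  · intro i
    rw [h, h, Fin.sum_univ_add]
    have h1 : ∀ j : Fin m, ¬ Fin.natAdd k j ≤ Fin.castAdd m i := by
      intro j hj
      rw [Fin.le_def] at hj
      simp at hj
      omega
    have h2 : ∀ j : Fin k, Fin.castAdd m j ≤ Fin.castAdd m i ↔ j ≤ i := fun j => Iff.rfl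
    simp [h1, h2]
  · intro i
    rw [h, h, Fin.sum_univ_add]
    have h1 : ∀ j : Fin k, Fin.castAdd m j ≤ Fin.natAdd k i := by
      intro j
      rw [Fin.le_def]
      simp
      omega
    simp [h1]

theorem biasWeight_append {k m : ℕ} (s : ℝ) (y : Fin k → ℝ) (z : Fin m → ℝ) :
    biasWeight s (Fin.append y z) = biasWeight s y * biasWeight (s + ∑ j, y j) z := by
  unfold biasWeight
  rw [Fin.prod_univ_add]
  congr 1
  · refine Finset.prod_congr rfl fun i _ => ?_
    rw [(sum_Iic_append y z).1, Fin.append_left]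
  · refine Finset.prod_congr rfl fun i _ => ?_
    rw [(sum_Iic_append y z).2, Fin.append_right, add_assoc]

theorem biasWeight_snoc {n : ℕ} (s a : ℝ) (x : Fin n → ℝ) :
    biasWeight s (Fin.snoc x a : Fin (n + 1) → ℝ) =
      biasWeight s x * ENNReal.ofReal (a / (s + ∑ j, x j + a)) := by
  rw [Fin.snoc_eq_append, biasWeight_append]
  congr 1
  rw [biasWeight_cons, biasWeight_zero, mul_one]

theorem biasWeight_smul {n : ℕ} {c : ℝ} (hc : c ≠ 0) (x : Fin n → ℝ) :
    biasWeight 0 (fun i => c * x i) = biasWeight 0 x := by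
  unfold biasWeight
  refine Finset.prod_congr rfl fun k _ => ?_
  rw [← Finset.mul_sum, zero_add, zero_add, mul_div_mul_left _ _ hc]

/-! ### The tail of a sequence of size-biased picks -/

theorem lintegral_mul_lintegral_Iio (μ : Measure ℝ) [SFinite μ] {f g : ℝ → ℝ≥0∞}
    (hf : Measurable f) (hg : Measurable g) :
    ∫⁻ r, f r * ∫⁻ q in Set.Iio r, g q ∂μ ∂μ = ∫⁻ q, g q * ∫⁻ r in Set.Ioi q, f r ∂μ ∂μ := by
  have h1 : ∀ r, f r * ∫⁻ q in Set.Iio r, g q ∂μ =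
      ∫⁻ q, {p : ℝ × ℝ | p.2 < p.1}.indicator (fun p => f p.1 * g p.2) (r, q) ∂μ := by
    intro r
    rw [← lintegral_const_mul _ hg, ← lintegral_indicator measurableSet_Iio]
    rfl
  have h2 : ∀ q, g q * ∫⁻ r in Set.Ioi q, f r ∂μ =
      ∫⁻ r, {p : ℝ × ℝ | p.2 < p.1}.indicator (fun p => f p.1 * g p.2) (r, q) ∂μ := by
    intro q
    rw [← lintegral_const_mul _ hf, ← lintegral_indicator measurableSet_Ioi]
    refine lintegral_congr fun r => ?_
    by_cases h : q < r <;> simp [Set.indicator, h, mul_comm]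
  simp_rw [h1, h2]
  refine lintegral_lintegral_swap (Measurable.aemeasurable ?_)
  exact Measurable.indicator (by fun_prop) (measurableSet_lt measurable_snd measurable_fst)

theorem measurable_lintegral_Iio (μ : Measure ℝ) [SFinite μ] {f : ℝ → ℝ≥0∞}
    (hf : Measurable f) : Measurable fun t => ∫⁻ q in Set.Iio t, f q ∂μ := by
  have h1 : ∀ t, ∫⁻ q in Set.Iio t, f q ∂μ =
      ∫⁻ q, {p : ℝ × ℝ | p.2 < p.1}.indicator (fun p => f p.2) (t, q) ∂μ := by
    intro t
    rw [← lintegral_indicator measurableSet_Iio]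
    rfl
  simp_rw [h1]
  refine Measurable.lintegral_prod_right' (f := fun p : ℝ × ℝ =>
    {p : ℝ × ℝ | p.2 < p.1}.indicator (fun p => f p.2) p) ?_
  exact Measurable.indicator (by fun_prop) (measurableSet_lt measurable_snd measurable_fst)

/-- The power rule for a primitive, in integrated form. -/
theorem lintegral_Iio_pow_succ (μ : Measure ℝ) [SFinite μ] [NullSingletonClass μ] {f : ℝ → ℝ≥0∞}
    (hf : Measurable f) (m : ℕ) (t : ℝ) :
    (∫⁻ q in Set.Iio t, f q ∂μ) ^ (m + 1) =
      (m + 1) * ∫⁻ r in Set.Iio t, f r * (∫⁻ q in Set.Iio r, f q ∂μ) ^ m ∂μ := by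
  induction m generalizing t with
  | zero => simp
  | succ k ih =>
    set Φ : ℝ → ℝ≥0∞ := fun t => ∫⁻ q in Set.Iio t, f q ∂μ with hΦ
    have hΦm : Measurable Φ := measurable_lintegral_Iio μ hf
    set μt := μ.restrict (Set.Iio t)
    have hfΦ : Measurable fun r => f r * Φ r ^ k := hf.mul (hΦm.pow_const k)
    have hrest : ∀ r ∈ Set.Iio t, μt.restrict (Set.Iio r) = μ.restrict (Set.Iio r) := by
      intro r hr
      rw [Measure.restrict_restrict measurableSet_Iio, Set.Iio_inter_Iio, min_eq_left hr.le]
    have hI : ∫⁻ r in Set.Iio t, f r * Φ r ^ (k + 1) ∂μ =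
        (k + 1) * ∫⁻ q, f q * Φ q ^ k * (∫⁻ r in Set.Ioi q, f r ∂μt) ∂μt := by
      rw [← lintegral_mul_lintegral_Iio μt hf hfΦ,
        ← lintegral_const_mul]
      · refine setLIntegral_congr_fun measurableSet_Iio fun r hr => ?_
        rw [hrest r hr, ← mul_assoc, mul_comm ((k : ℝ≥0∞) + 1), mul_assoc]
        congr 1
        exact ih r
      · exact hf.mul (measurable_lintegral_Iio μt hfΦ)
    have hsplit : ∀ q ∈ Set.Iio t, (∫⁻ r in Set.Ioi q, f r ∂μt) + Φ q = Φ t := by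
      intro q hq
      rw [setLIntegral_congr (Ioi_ae_eq_Ici (μ := μt) (a := q))]
      simp only [hΦ]
      rw [← hrest q hq, add_comm, ← lintegral_add_compl (μ := μt) f measurableSet_Iio (A := Set.Iio q),
        Set.compl_Iio]
    have hkey : (∫⁻ r in Set.Iio t, f r * Φ r ^ (k + 1) ∂μ) +
        (k + 1) * ∫⁻ r in Set.Iio t, f r * Φ r ^ (k + 1) ∂μ = Φ t ^ (k + 2) := by
      nth_rewrite 1 [hI]
      rw [← mul_add, ← lintegral_add_left']
      · have : ∫⁻ q in Set.Iio t, f q * Φ q ^ k * (∫⁻ r in Set.Ioi q, f r ∂μt) +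
            f q * Φ q ^ (k + 1) ∂μ = ∫⁻ q in Set.Iio t, Φ t * (f q * Φ q ^ k) ∂μ := by
          refine setLIntegral_congr_fun measurableSet_Iio fun q hq => ?_
          rw [← hsplit q hq]
          ring
        rw [this, lintegral_const_mul _ hfΦ, mul_left_comm]
        rw [show ((k : ℝ≥0∞) + 1) * ∫⁻ q in Set.Iio t, f q * Φ q ^ k ∂μ = Φ t ^ (k + 1) from
          (ih t).symm]
        ring
      · have : Measurable fun q => ∫⁻ r in Set.Ioi q, f r ∂μt := by
          refine Antitone.measurable fun a b hab => ?_
          exact lintegral_mono_set (Set.Ioi_subset_Ioi hab)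
        exact (hfΦ.mul this).aemeasurable
    change Φ t ^ (k + 2) = _
    rw [← hkey]
    push_cast
    ring

/-- Lebesgue measure on the half-line `(0, ∞)`. -/
noncomputable abbrev posVolume : Measure ℝ := volume.restrict (Set.Ioi 0)

theorem ae_posVolume : ∀ᵐ x ∂posVolume, 0 < x := ae_restrict_mem measurableSet_Ioi

theorem lintegral_Ioi_exp_neg_mul {s : ℝ} (hs : 0 < s) {t : ℝ} (ht : 0 ≤ t) :
    ∫⁻ r in Set.Ioi t, ENNReal.ofReal (s * Real.exp (-(s * r))) ∂posVolume =
      ENNReal.ofReal (Real.exp (-(s * t))) := by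
  rw [Measure.restrict_restrict measurableSet_Ioi,
    Set.inter_eq_left.2 (Set.Ioi_subset_Ioi ht)]
  have h : ∀ r : ℝ, s * Real.exp (-(s * r)) = s * Real.exp ((-s) * r) := fun r => by ring_nf
  simp_rw [h]
  rw [← ofReal_integral_eq_lintegral_ofReal]
  · rw [integral_const_mul, integral_exp_mul_Ioi (by linarith)]
    congr 1
    field_simp
  · exact (integrableOn_exp_mul_Ioi (by linarith) t).const_mul s
  · exact ae_of_all _ fun r => by positivity

theorem lintegral_Iio_exp_neg_mul {s : ℝ} (hs : 0 < s) {t : ℝ} (ht : 0 < t) :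
    ∫⁻ r in Set.Iio t, ENNReal.ofReal (s * Real.exp (-(s * r))) ∂posVolume =
      ENNReal.ofReal (1 - Real.exp (-(s * t))) := by
  have hd : ∀ r ∈ Set.uIcc 0 t, HasDerivAt (fun r => -Real.exp (-(s * r)))
      (s * Real.exp (-(s * r))) r := by
    intro r _
    have := ((hasDerivAt_id r).const_mul s).neg.exp.neg
    convert! this using 1
    simp [mul_comm]
  have hint : IntervalIntegrable (fun r => s * Real.exp (-(s * r))) volume 0 t :=
    Continuous.intervalIntegrable (by fun_prop) _ _
  have h := intervalIntegral.integral_eq_sub_of_hasDerivAt hd hint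
  rw [Measure.restrict_restrict measurableSet_Iio, Set.inter_comm, Set.Ioi_inter_Iio,
    restrict_Ioo_eq_restrict_Ioc, ← ofReal_integral_eq_lintegral_ofReal,
    ← intervalIntegral.integral_of_le ht.le, h]
  · congr 1
    simp
    ring
  · exact hint.1
  · exact ae_of_all _ fun r => by positivity

/-- The mass of `μ` that is hit by time `t`, an atom of size `x` being hit at rate `x`. -/
noncomputable def hitMass (μ : Measure ℝ) (t : ℝ) : ℝ≥0∞ :=
  ∫⁻ x, ENNReal.ofReal (1 - Real.exp (-(x * t))) ∂μ

/-- The rate at which the mass of `μ` is hit at time `t`. -/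
noncomputable def hitRate (μ : Measure ℝ) (t : ℝ) : ℝ≥0∞ :=
  ∫⁻ x, ENNReal.ofReal (x * Real.exp (-(x * t))) ∂μ

theorem measurable_hitMass (μ : Measure ℝ) [SFinite μ] : Measurable (hitMass μ) := by
  unfold hitMass
  exact Measurable.lintegral_prod_right' (f := fun p : ℝ × ℝ =>
    ENNReal.ofReal (1 - Real.exp (-(p.2 * p.1)))) (by fun_prop)

theorem measurable_hitRate (μ : Measure ℝ) [SFinite μ] : Measurable (hitRate μ) := by
  unfold hitRate
  exact Measurable.lintegral_prod_right' (f := fun p : ℝ × ℝ =>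
    ENNReal.ofReal (p.2 * Real.exp (-(p.2 * p.1)))) (by fun_prop)

theorem lintegral_hitRate (μ : Measure ℝ) [SFinite μ] (hμ : ∀ᵐ x ∂μ, 0 < x) {t : ℝ}
    (ht : 0 < t) : ∫⁻ r in Set.Iio t, hitRate μ r ∂posVolume = hitMass μ t := by
  unfold hitRate hitMass
  rw [lintegral_lintegral_swap]
  · refine lintegral_congr_ae ?_
    filter_upwards [hμ] with x hx
    exact lintegral_Iio_exp_neg_mul hx ht
  · exact Measurable.aemeasurable (by unfold Function.uncurry; fun_prop)

theorem factorial_mul_lintegral_biasWeight (μ : Measure ℝ) [SigmaFinite μ]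
    (hμ : ∀ᵐ x ∂μ, 0 < x) (m : ℕ) {s : ℝ} (hs : 0 < s) :
    (m.factorial : ℝ≥0∞) * ∫⁻ z : Fin m → ℝ, biasWeight s z ∂(Measure.pi fun _ => μ) =
      ∫⁻ t, ENNReal.ofReal (s * Real.exp (-(s * t))) * hitMass μ t ^ m ∂posVolume := by
  induction m generalizing s with
  | zero =>
    simp only [biasWeight_zero, pow_zero, mul_one]
    have h := lintegral_Ioi_exp_neg_mul hs le_rfl
    rw [Measure.restrict_restrict measurableSet_Ioi, Set.inter_self] at h
    rw [h]
    simp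
  | succ m ih =>
    have hR := measurable_hitRate μ
    have hM := measurable_hitMass μ
    have hRM : Measurable fun r => hitRate μ r * hitMass μ r ^ m := hR.mul (hM.pow_const m)
    have hpow : ∀ t ∈ Set.Ioi (0 : ℝ), hitMass μ t ^ (m + 1) =
        (m + 1) * ∫⁻ r in Set.Iio t, hitRate μ r * hitMass μ r ^ m ∂posVolume := by
      intro t ht
      rw [← lintegral_hitRate μ hμ ht, lintegral_Iio_pow_succ _ hR]
      congr 1
      rw [Measure.restrict_restrict measurableSet_Iio]
      refine setLIntegral_congr_fun (measurableSet_Iio.inter measurableSet_Ioi) fun r hr => ?_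
      rw [lintegral_hitRate μ hμ hr.2]
    have hrhs : ∫⁻ t, ENNReal.ofReal (s * Real.exp (-(s * t))) * hitMass μ t ^ (m + 1)
        ∂posVolume = (m + 1) * ∫⁻ t, ENNReal.ofReal (Real.exp (-(s * t))) *
          (hitRate μ t * hitMass μ t ^ m) ∂posVolume := by
      have h1 : ∫⁻ t, ENNReal.ofReal (s * Real.exp (-(s * t))) * hitMass μ t ^ (m + 1)
        ∂posVolume = ∫⁻ t, (m + 1) * (ENNReal.ofReal (s * Real.exp (-(s * t))) *
          ∫⁻ r in Set.Iio t, hitRate μ r * hitMass μ r ^ m ∂posVolume) ∂posVolume := by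
        refine setLIntegral_congr_fun measurableSet_Ioi fun t ht => ?_
        rw [hpow t ht]
        ring
      rw [h1, lintegral_const_mul, lintegral_mul_lintegral_Iio
        (f := fun t => ENNReal.ofReal (s * Real.exp (-(s * t)))) _ (by fun_prop) hRM]
      · congr 1
        refine setLIntegral_congr_fun measurableSet_Ioi fun t ht => ?_
        rw [lintegral_Ioi_exp_neg_mul hs (le_of_lt ht), mul_comm]
      · exact Measurable.mul (by fun_prop)
          (measurable_lintegral_Iio _ hRM)
    rw [hrhs, lintegral_pi_cons μ (by fun_prop), Nat.factorial_succ]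
    push_cast
    rw [mul_assoc]
    congr 1
    rw [← lintegral_const_mul _ (by
      simp_rw [biasWeight_cons]
      exact Measurable.lintegral_prod_right' (f := fun p : ℝ × (Fin m → ℝ) =>
        ENNReal.ofReal (p.1 / (s + p.1)) * biasWeight (s + p.1) p.2) (by fun_prop))]
    have h2 : ∀ᵐ x ∂μ, (m.factorial : ℝ≥0∞) *
        ∫⁻ z : Fin m → ℝ, biasWeight s (Fin.cons x z : Fin (m + 1) → ℝ)
          ∂(Measure.pi fun _ => μ) =
        ∫⁻ t, ENNReal.ofReal (Real.exp (-(s * t))) *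
          (ENNReal.ofReal (x * Real.exp (-(x * t))) * hitMass μ t ^ m) ∂posVolume := by
      filter_upwards [hμ] with x hx
      simp_rw [biasWeight_cons]
      rw [lintegral_const_mul _ (by fun_prop), mul_left_comm, ih (by positivity),
        ← lintegral_const_mul _ (by fun_prop)]
      refine lintegral_congr fun t => ?_
      rw [← mul_assoc, ← mul_assoc, ← ENNReal.ofReal_mul (by positivity),
        ← ENNReal.ofReal_mul (by positivity)]
      congr 2
      rw [mul_left_comm (Real.exp _), ← Real.exp_add,
        show -(s * t) + -(x * t) = -((s + x) * t) by ring]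
      field_simp
    rw [lintegral_congr_ae h2, lintegral_lintegral_swap (Measurable.aemeasurable (by
      unfold Function.uncurry; fun_prop))]
    refine lintegral_congr fun t => ?_
    rw [lintegral_const_mul _ (by fun_prop), lintegral_mul_const _ (by fun_prop)]
    rfl

/-! ### Quantile functions -/

/-- `Q` is a quantile function of the probability measure `F`. -/
structure IsQuantile (F : Measure ℝ) (Q : ℝ → ℝ) : Prop where
  measurable : Measurable Q
  le_iff : ∀ u ∈ Set.Ioo (0 : ℝ) 1, ∀ x, Q u ≤ x ↔ u ≤ cdf F x

theorem exists_isQuantile (F : Measure ℝ) [IsProbabilityMeasure F] : ∃ Q, IsQuantile F Q := by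
  classical
  let Q : ℝ → ℝ := fun u => if u ∈ Set.Ioo (0 : ℝ) 1 then sInf {x | u ≤ cdf F x} else 0
  have hle : ∀ u ∈ Set.Ioo (0 : ℝ) 1, ∀ x, Q u ≤ x ↔ u ≤ cdf F x := by
    intro u hu x
    simp only [Q, if_pos hu]
    have hne : {x | u ≤ cdf F x}.Nonempty := by
      obtain ⟨y, hy⟩ := ((tendsto_cdf_atTop F).eventually (lt_mem_nhds hu.2)).exists
      exact ⟨y, hy.le⟩
    have hbdd : BddBelow {x | u ≤ cdf F x} := by
      obtain ⟨y, hy⟩ := ((tendsto_cdf_atBot F).eventually (gt_mem_nhds hu.1)).exists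
      refine ⟨y, fun z hz => ?_⟩
      by_contra hzy
      exact absurd (hz.trans (monotone_cdf F (not_le.1 hzy).le)) (not_le.2 hy)
    constructor
    · intro h
      have hgt : ∀ y, x < y → u ≤ cdf F y := by
        intro y hy
        obtain ⟨z, hz, hzy⟩ := exists_lt_of_csInf_lt hne (h.trans_lt hy)
        exact le_trans hz (monotone_cdf F hzy.le)
      have hc : Tendsto (cdf F) (𝓝[>] x) (𝓝 (cdf F x)) :=
        ((cdf F).right_continuous x).mono_left (nhdsWithin_mono _ Set.Ioi_subset_Ici_self)
      refine ge_of_tendsto hc ?_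
      filter_upwards [self_mem_nhdsWithin] with y hy using hgt y hy
    · intro h
      exact csInf_le hbdd h
  refine ⟨Q, measurable_of_Iic fun x => ?_, hle⟩
  have : Q ⁻¹' Set.Iic x = (Set.Ioo (0 : ℝ) 1 ∩ Set.Iic (cdf F x)) ∪
      ((Set.Ioo (0 : ℝ) 1)ᶜ ∩ {_u | 0 ≤ x}) := by
    ext u
    by_cases hu : u ∈ Set.Ioo (0 : ℝ) 1
    · have := hle u hu x
      simp only [Set.mem_preimage, Set.mem_Iic, this, Set.mem_union, Set.mem_inter_iff, hu,
        Set.mem_compl_iff, true_and, not_true, false_and, or_false]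
    · simp only [Set.mem_preimage, Set.mem_Iic, Set.mem_union, Set.mem_inter_iff, hu,
        Set.mem_compl_iff, not_false_iff, true_and, false_and, false_or]
      have hQu : Q u = 0 := if_neg hu
      rw [hQu]
      rfl
  rw [this]
  exact (measurableSet_Ioo.inter measurableSet_Iic).union
    (measurableSet_Ioo.compl.inter (MeasurableSet.const _))

theorem IsQuantile.map_eq {F : Measure ℝ} [IsProbabilityMeasure F] {Q : ℝ → ℝ}
    (hQ : IsQuantile F Q) : (volume.restrict (Set.Ioo 0 1)).map Q = F := by
  refine Measure.ext_of_Iic _ _ fun x => ?_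
  rw [Measure.map_apply hQ.measurable measurableSet_Iic,
    Measure.restrict_apply (hQ.measurable measurableSet_Iic)]
  have h1 : Q ⁻¹' Set.Iic x ∩ Set.Ioo 0 1 = Set.Ioo 0 1 ∩ Set.Iic (cdf F x) := by
    ext u
    constructor
    · rintro ⟨h, hu⟩
      exact ⟨hu, (hQ.le_iff u hu x).1 h⟩
    · rintro ⟨hu, h⟩
      exact ⟨(hQ.le_iff u hu x).2 h, hu⟩
  have h2 : (Set.Ioo 0 1 ∩ Set.Iic (cdf F x) : Set ℝ) =ᵐ[volume]
      (Set.Ioc 0 1 ∩ Set.Iic (cdf F x) : Set ℝ) :=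
    Ioo_ae_eq_Ioc.inter (ae_eq_refl _)
  rw [h1, measure_congr h2, Set.Ioc_inter_Iic, min_eq_right (cdf_le_one F x), Real.volume_Ioc,
    sub_zero, ofReal_cdf]

theorem IsQuantile.scaled_map_eq {F : Measure ℝ} [IsProbabilityMeasure F] {Q : ℝ → ℝ}
    (hQ : IsQuantile F Q) (c : ℝ) {n : ℝ} (hn : 0 < n) :
    F.map (fun x => c * x) = ENNReal.ofReal n⁻¹ •
      (posVolume.restrict (Set.Iio n)).map fun v => c * Q (v / n) := by
  have hm : Measurable fun v => c * Q (v / n) :=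
    (hQ.measurable.comp (measurable_id.div_const n)).const_mul c
  have hdiv : Measurable fun v : ℝ => v / n := measurable_id.div_const n
  have hscale : (volume.restrict (Set.Ioo 0 1)) =
      ENNReal.ofReal n⁻¹ • (posVolume.restrict (Set.Iio n)).map fun v => v / n := by
    refine Measure.ext fun s hs => ?_
    rw [Measure.smul_apply, Measure.map_apply hdiv hs,
      Measure.restrict_apply hs, Measure.restrict_restrict measurableSet_Iio,
      Measure.restrict_apply (hdiv hs)]
    have h1 : (fun v => v / n) ⁻¹' s ∩ (Set.Iio n ∩ Set.Ioi 0) =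
        (fun v => n⁻¹ * v) ⁻¹' (s ∩ Set.Ioo 0 1) := by
      ext v
      simp only [Set.mem_inter_iff, Set.mem_preimage, Set.mem_Iio, Set.mem_Ioi, Set.mem_Ioo,
        div_eq_inv_mul]
      rw [inv_mul_lt_iff₀ hn, mul_one, mul_pos_iff_of_pos_left (inv_pos.2 hn)]
      tauto
    rw [h1, Real.volume_preimage_mul_left (inv_pos.2 hn).ne', inv_inv, abs_of_pos hn,
      smul_eq_mul, ← mul_assoc, ← ENNReal.ofReal_mul (inv_pos.2 hn).le, inv_mul_cancel₀ hn.ne',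
      ENNReal.ofReal_one, one_mul]
  calc F.map (fun x => c * x) =
        ((volume.restrict (Set.Ioo 0 1)).map Q).map (fun x => c * x) := by rw [hQ.map_eq]
    _ = _ := by
      rw [Measure.map_map (by fun_prop) hQ.measurable, hscale, Measure.map_smul,
        Measure.map_map ((measurable_const_mul c).comp hQ.measurable) hdiv]
      · rfl

/-- An integral with respect to a scaled sample, in terms of quantiles. -/
theorem IsQuantile.lintegral_pi {F : Measure ℝ} [IsProbabilityMeasure F] {Q : ℝ → ℝ}
    (hQ : IsQuantile F Q) (c : ℝ) {n : ℝ} (hn : 0 < n) (k : ℕ) {g : (Fin k → ℝ) → ℝ≥0∞}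
    (hg : Measurable g) :
    ∫⁻ x, g x ∂(Measure.pi fun _ : Fin k => F.map (fun x => c * x)) =
      ENNReal.ofReal n⁻¹ ^ k * ∫⁻ v in Set.pi Set.univ fun _ => Set.Iio n,
        g (fun i => c * Q (v i / n)) ∂(Measure.pi fun _ : Fin k => posVolume) := by
  have hm1 : Measurable fun v => c * Q (v / n) :=
    (hQ.measurable.comp (measurable_id.div_const n)).const_mul c
  have hm : Measurable fun (v : Fin k → ℝ) i => c * Q (v i / n) :=
    measurable_pi_iff.2 fun i => hm1.comp (measurable_pi_apply i)
  have := Measure.isProbabilityMeasure_map (μ := F) (f := fun x => c * x) (by fun_prop)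
  have h : (Measure.pi fun _ : Fin k => F.map (fun x => c * x)) = ENNReal.ofReal n⁻¹ ^ k •
      (Measure.pi fun _ : Fin k => posVolume.restrict (Set.Iio n)).map
        fun v i => c * Q (v i / n) := by
    refine Measure.pi_eq fun s hs => ?_
    rw [Measure.smul_apply, Measure.map_apply hm (MeasurableSet.univ_pi hs)]
    have : (fun (v : Fin k → ℝ) i => c * Q (v i / n)) ⁻¹' Set.pi Set.univ s =
        Set.pi Set.univ fun i => (fun v => c * Q (v / n)) ⁻¹' s i := by
      ext v
      simp [Set.mem_pi]
    rw [this, Measure.pi_pi, hQ.scaled_map_eq c hn, smul_eq_mul]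
    simp_rw [Measure.smul_apply, smul_eq_mul]
    rw [Finset.prod_mul_distrib]
    congr 1
    · simp
    · exact Finset.prod_congr rfl fun i _ => (Measure.map_apply hm1 (hs i)).symm
  rw [h, lintegral_smul_measure, lintegral_map hg hm, smul_eq_mul, Measure.restrict_pi_pi]

/-! ### The behaviour of the sample near zero -/

section Asymptotic

variable {F : Measure ℝ} [IsProbabilityMeasure F] {a r : ℝ}

/-- The distribution function of the limiting mean measure, in terms of
`A = r ^ a / Γ(a + 1)`, is `A * x ^ a`; its inverse is `limitQuantile`. -/
noncomputable def limitQuantile (a A v : ℝ) : ℝ := (v / A) ^ (1 / a)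

theorem cdf_zero_of_pos (hF : F (Set.Iic 0) = 0) : cdf F 0 = 0 := by
  rw [cdf_eq_real, measureReal_def, hF, ENNReal.toReal_zero]

theorem tendsto_natCast_rpow_inv (ha : 0 < a) :
    Tendsto (fun n : ℕ => ((n : ℝ) ^ (1 / a))) atTop atTop :=
  (tendsto_rpow_atTop (one_div_pos.2 ha)).comp tendsto_natCast_atTop_atTop

theorem tendsto_mul_cdf {F : Measure ℝ} {a A : ℝ} (ha : 0 < a) (hA : 0 < A)
    (hF0 : (fun x : ℝ => cdf F x) ~[𝓝[>] 0] fun x : ℝ => A * x ^ a) {y : ℝ} (hy : 0 < y) :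
    Tendsto (fun n : ℕ => n * cdf F (y / (n : ℝ) ^ (1 / a))) atTop (𝓝 (A * y ^ a)) := by
  have h1 : Tendsto (fun n : ℕ => y / (n : ℝ) ^ (1 / a)) atTop (𝓝[>] 0) := by
    refine tendsto_nhdsWithin_iff.2 ⟨(tendsto_natCast_rpow_inv ha).const_div_atTop y, ?_⟩
    filter_upwards [eventually_gt_atTop 0] with n hn
    have : (0 : ℝ) < n := Nat.cast_pos.2 hn
    exact Set.mem_Ioi.2 (by positivity)
  have h2 := (hF0.comp_tendsto h1)
  have h3 := (Asymptotics.IsEquivalent.refl (u := fun n : ℕ => (n : ℝ)) (l := atTop)).mul h2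
  refine h3.symm.tendsto_nhds ?_
  refine tendsto_const_nhds.congr' ?_
  filter_upwards [eventually_gt_atTop 0] with n hn
  have hn' : (0 : ℝ) < n := Nat.cast_pos.2 hn
  simp only [Pi.mul_apply, Function.comp]
  rw [Real.div_rpow hy.le (by positivity), ← Real.rpow_mul hn'.le, one_div_mul_cancel ha.ne',
    Real.rpow_one]
  field_simp

theorem exists_cdf_le {A : ℝ} (ha : 0 < a) (hA : 0 < A) (hF : F (Set.Iic 0) = 0)
    (hF0 : (fun x : ℝ => cdf F x) ~[𝓝[>] 0] fun x : ℝ => A * x ^ a) :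
    ∃ C > 0, ∀ x ≥ 0, cdf F x ≤ C * x ^ a := by
  obtain ⟨K, hK⟩ := hF0.isBigO.bound
  obtain ⟨δ, hδ, hb⟩ := mem_nhdsGT_iff_exists_Ioo_subset.1 hK
  have hδ : 0 < δ := hδ
  refine ⟨max (K * A) (2 / δ ^ a) + 2 ^ a / δ ^ a + 1, by positivity, fun x hx => ?_⟩
  rcases hx.eq_or_lt with rfl | hx
  · rw [cdf_zero_of_pos hF, Real.zero_rpow ha.ne', mul_zero]
  have hxa : 0 < x ^ a := Real.rpow_pos_of_pos hx a
  have hpos : 0 < 2 ^ a / δ ^ a := by positivity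
  by_cases hxd : x < δ
  · have h := hb ⟨hx, hxd⟩
    simp only [Set.mem_ofPred_eq, Real.norm_eq_abs] at h
    rw [abs_of_nonneg (cdf_nonneg F x), abs_of_pos (by positivity)] at h
    calc cdf F x ≤ K * A * x ^ a := by linarith
      _ ≤ _ := by
        gcongr
        have := le_max_left (K * A) (2 / δ ^ a)
        linarith
  · push Not at hxd
    have h1 : 1 ≤ x ^ a / δ ^ a := by
      rw [one_le_div (by positivity)]
      exact Real.rpow_le_rpow hδ.le hxd ha.le
    calc cdf F x ≤ 2 * (x ^ a / δ ^ a) := by linarith [cdf_le_one F x]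
      _ = 2 / δ ^ a * x ^ a := by ring
      _ ≤ _ := by
        gcongr
        have := le_max_right (K * A) (2 / δ ^ a)
        linarith

theorem limitQuantile_pos {A v : ℝ} (hA : 0 < A) (hv : 0 < v) : 0 < limitQuantile a A v := by
  unfold limitQuantile
  positivity

theorem limitQuantile_lt_iff {A v y : ℝ} (ha : 0 < a) (hA : 0 < A) (hv : 0 < v) (hy : 0 < y) :
    limitQuantile a A v < y ↔ v < A * y ^ a := by
  unfold limitQuantile
  rw [one_div, Real.rpow_inv_lt_iff_of_pos (by positivity) hy.le ha, div_lt_iff₀ hA, mul_comm]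

theorem lt_limitQuantile_iff {A v y : ℝ} (ha : 0 < a) (hA : 0 < A) (hv : 0 < v) (hy : 0 < y) :
    y < limitQuantile a A v ↔ A * y ^ a < v := by
  unfold limitQuantile
  rw [one_div, Real.lt_rpow_inv_iff_of_pos hy.le (by positivity) ha, lt_div_iff₀ hA, mul_comm]

theorem IsQuantile.tendsto {F : Measure ℝ} {a : ℝ} {Q : ℝ → ℝ} (hQ : IsQuantile F Q)
    {A : ℝ} (ha : 0 < a) (hA : 0 < A)
    (hF0 : (fun x : ℝ => cdf F x) ~[𝓝[>] 0] fun x : ℝ => A * x ^ a) {v : ℝ} (hv : 0 < v) :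
    Tendsto (fun n : ℕ => (n : ℝ) ^ (1 / a) * Q (v / n)) atTop (𝓝 (limitQuantile a A v)) := by
  have hq := limitQuantile_pos (a := a) hA hv
  have hgal : ∀ y, ∀ᶠ n : ℕ in atTop,
      ((n : ℝ) ^ (1 / a) * Q (v / n) ≤ y ↔ v ≤ n * cdf F (y / (n : ℝ) ^ (1 / a))) := by
    intro y
    obtain ⟨n0, hn0⟩ := exists_nat_gt v
    filter_upwards [eventually_gt_atTop 0, eventually_ge_atTop n0] with n hn hnv
    have hn' : (0 : ℝ) < n := Nat.cast_pos.2 hn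
    have hvn : v < n := hn0.trans_le (by exact_mod_cast hnv)
    have hc : 0 < (n : ℝ) ^ (1 / a) := by positivity
    rw [← le_div_iff₀' hc, hQ.le_iff _ ⟨by positivity, (div_lt_one hn').2 hvn⟩,
      div_le_iff₀' hn']
  refine tendsto_order.2 ⟨fun y hy => ?_, fun y hy => ?_⟩
  · obtain ⟨z, hz0, hz1⟩ : ∃ z, max y 0 < z ∧ z < limitQuantile a A v :=
      exists_between (max_lt hy hq)
    have hzpos : 0 < z := (le_max_right _ _).trans_lt hz0
    have h1 := (tendsto_mul_cdf ha hA hF0 hzpos).eventually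
      (gt_mem_nhds ((lt_limitQuantile_iff ha hA hv hzpos).1 hz1))
    filter_upwards [h1, hgal z] with n h1 h2
    have h3 := not_le.1 (mt h2.1 (not_le.2 h1))
    exact ((le_max_left _ _).trans_lt hz0).trans h3
  · obtain ⟨z, hz0, hz1⟩ := exists_between hy
    have hzpos : 0 < z := hq.trans hz0
    have h1 := (tendsto_mul_cdf ha hA hF0 hzpos).eventually
      (lt_mem_nhds ((limitQuantile_lt_iff ha hA hv hzpos).1 hz0))
    filter_upwards [h1, hgal z] with n h1 h2
    exact (h2.2 h1.le).trans_lt hz1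

theorem IsQuantile.pos {Q : ℝ → ℝ} (hQ : IsQuantile F Q) (hF : F (Set.Iic 0) = 0) {u : ℝ}
    (hu : u ∈ Set.Ioo (0 : ℝ) 1) : 0 < Q u := by
  by_contra h
  have := (hQ.le_iff u hu 0).1 (not_lt.1 h)
  rw [cdf_zero_of_pos hF] at this
  exact absurd hu.1 (not_lt.2 this)

theorem IsQuantile.le_mul {Q : ℝ → ℝ} (hQ : IsQuantile F Q) (hF : F (Set.Iic 0) = 0)
    (ha : 0 < a) {C : ℝ} (hC : 0 < C) (hCF : ∀ x ≥ 0, cdf F x ≤ C * x ^ a) {n v : ℝ}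
    (hv : 0 < v) (hvn : v < n) : C⁻¹ ^ (1 / a) * v ^ (1 / a) ≤ n ^ (1 / a) * Q (v / n) := by
  have hn : 0 < n := hv.trans hvn
  have hu : v / n ∈ Set.Ioo (0 : ℝ) 1 := ⟨by positivity, (div_lt_one hn).2 hvn⟩
  have hq := hQ.pos hF hu
  have h1 := ((hQ.le_iff _ hu _).1 le_rfl).trans (hCF _ hq.le)
  rw [← Real.mul_rpow (by positivity) hv.le]
  have h2 : C⁻¹ * v ≤ n * Q (v / n) ^ a := by
    rw [div_le_iff₀ hn] at h1
    rw [inv_mul_le_iff₀ hC]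
    linarith
  calc (C⁻¹ * v) ^ (1 / a) ≤ (n * Q (v / n) ^ a) ^ (1 / a) :=
        Real.rpow_le_rpow (by positivity) h2 (by positivity)
    _ = _ := by
      rw [Real.mul_rpow hn.le (by positivity), ← Real.rpow_mul hq.le, mul_one_div_cancel ha.ne',
        Real.rpow_one]

end Asymptotic

section Asymptotic

variable {F : Measure ℝ} [IsProbabilityMeasure F] {a A : ℝ}

theorem integral_exp_limitQuantile (ha : 0 < a) (hA : 0 < A) {t : ℝ} (ht : 0 < t) :
    ∫ v, Real.exp (-(limitQuantile a A v * t)) ∂posVolume = A * Real.Gamma (a + 1) * t ^ (-a) := by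
  have h := integral_exp_neg_mul_rpow (p := 1 / a) (b := t * A ^ (-(1 / a))) (by positivity)
    (by positivity)
  have h1 : ∀ v ∈ Set.Ioi (0 : ℝ), Real.exp (-(limitQuantile a A v * t)) =
      Real.exp (-(t * A ^ (-(1 / a))) * v ^ (1 / a)) := by
    intro v hv
    unfold limitQuantile
    rw [Real.div_rpow (le_of_lt hv) hA.le, Real.rpow_neg hA.le]
    congr 1
    field_simp
  rw [setIntegral_congr_fun measurableSet_Ioi h1, h]
  rw [Real.mul_rpow ht.le (by positivity), ← Real.rpow_mul hA.le]
  simp only [one_div, div_inv_eq_mul, neg_mul, one_mul, mul_neg, inv_mul_cancel₀ ha.ne', neg_neg,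
    Real.rpow_one]
  ring

theorem tendsto_mul_laplace (ha : 0 < a) (hA : 0 < A) (hF : F (Set.Iic 0) = 0)
    (hF0 : (fun x : ℝ => cdf F x) ~[𝓝[>] 0] fun x : ℝ => A * x ^ a) {t : ℝ} (ht : 0 < t) :
    Tendsto (fun n : ℕ => n * ∫ x, Real.exp (-(x * t)) ∂(F.map fun x => (n : ℝ) ^ (1 / a) * x))
      atTop (𝓝 (A * Real.Gamma (a + 1) * t ^ (-a))) := by
  obtain ⟨Q, hQ⟩ := exists_isQuantile F
  obtain ⟨C, hC, hCF⟩ := exists_cdf_le ha hA hF hF0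
  rw [← integral_exp_limitQuantile ha hA ht]
  have hqm : ∀ n : ℕ, Measurable fun v => (n : ℝ) ^ (1 / a) * Q (v / n) := fun n =>
    (hQ.measurable.comp (measurable_id.div_const _)).const_mul _
  have h1 : Tendsto (fun n : ℕ => ∫ v, (Set.Iio (n : ℝ)).indicator
      (fun v => Real.exp (-((n : ℝ) ^ (1 / a) * Q (v / n) * t))) v ∂posVolume) atTop
      (𝓝 (∫ v, Real.exp (-(limitQuantile a A v * t)) ∂posVolume)) := by
    refine tendsto_integral_of_dominated_convergence
      (fun v => Real.exp (-(t * C⁻¹ ^ (1 / a)) * v ^ (1 / a))) (fun n => ?_) ?_ (fun n => ?_) ?_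
    · refine Measurable.aestronglyMeasurable (Measurable.indicator ?_ measurableSet_Iio)
      exact (((hqm n).mul_const t).neg).exp
    · have h := integrableOn_rpow_mul_exp_neg_mul_rpow (s := 0) (p := 1 / a)
        (b := t * C⁻¹ ^ (1 / a)) (by norm_num) (by positivity) (by positivity)
      simpa [IntegrableOn] using h
    · filter_upwards [ae_posVolume] with v hv
      by_cases hvn : v < n
      · rw [Set.indicator_of_mem (Set.mem_Iio.2 hvn), Real.norm_eq_abs, Real.abs_exp]
        refine Real.exp_le_exp.2 ?_
        have := mul_le_mul_of_nonneg_right (hQ.le_mul hF ha hC hCF hv hvn) ht.le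
        linarith
      · rw [Set.indicator_of_notMem (by simpa using hvn), norm_zero]
        positivity
    · filter_upwards [ae_posVolume] with v hv
      have h := ((hQ.tendsto ha hA hF0 hv).mul_const t).neg.rexp
      refine h.congr' ?_
      obtain ⟨n0, hn0⟩ := exists_nat_gt v
      filter_upwards [eventually_ge_atTop n0] with n hn
      rw [Set.indicator_of_mem]
      exact Set.mem_Iio.2 (hn0.trans_le (by exact_mod_cast hn))
  refine h1.congr' ?_
  filter_upwards [eventually_gt_atTop 0] with n hn
  have hn' : (0 : ℝ) < n := Nat.cast_pos.2 hn
  rw [hQ.scaled_map_eq _ hn', integral_smul_measure, integral_map (hqm n).aemeasurable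
    (by fun_prop), integral_indicator measurableSet_Iio, ENNReal.toReal_ofReal (by positivity),
    smul_eq_mul, mul_inv_cancel_left₀ hn'.ne']

/-- A lower bound for the mass above `M` that is hit by time `t`. -/
theorem le_hitMass_restrict {μ : Measure ℝ} [IsProbabilityMeasure μ] (hμ : ∀ᵐ x ∂μ, 0 < x)
    (M : ℝ) {t : ℝ} (ht : 0 < t) :
    ENNReal.ofReal (1 - (∫ x, Real.exp (-(x * t)) ∂μ + t * M * μ.real (Set.Iic M))) ≤
      hitMass (μ.restrict (Set.Ioi M)) t := by
  have hint : Integrable (fun x => Real.exp (-(x * t))) μ := by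
    refine Integrable.of_bound (by fun_prop) 1 ?_
    filter_upwards [hμ] with x hx
    rw [Real.norm_eq_abs, Real.abs_exp, Real.exp_le_one_iff]
    nlinarith
  have hint2 : Integrable ((Set.Iic M).indicator fun _ => t * M) μ :=
    (integrable_const _).indicator measurableSet_Iic
  have h : ∫ x, (1 - (Real.exp (-(x * t)) + (Set.Iic M).indicator (fun _ => t * M) x)) ∂μ =
      1 - (∫ x, Real.exp (-(x * t)) ∂μ + t * M * μ.real (Set.Iic M)) := by
    have h1 := integral_sub (integrable_const (1 : ℝ) (μ := μ)) (hint.add hint2)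
    have h2 := integral_add hint hint2
    rw [integral_indicator_const _ measurableSet_Iic] at h2
    simp only [Pi.add_apply, integral_const, probReal_univ, smul_eq_mul, one_mul] at h1 h2
    rw [h1, h2]
    ring
  rw [← h]
  have hint3 : Integrable (fun x => 1 - (Real.exp (-(x * t)) +
      (Set.Iic M).indicator (fun _ => t * M) x)) μ := (integrable_const _).sub (hint.add hint2)
  refine (ENNReal.ofReal_le_ofReal (integral_mono hint3 hint3.pos_part
    fun x => le_max_left _ 0)).trans ?_
  rw [ofReal_integral_eq_lintegral_ofReal hint3.pos_part (ae_of_all _ fun x => le_max_right _ _),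
    hitMass, ← lintegral_indicator measurableSet_Ioi]
  refine lintegral_mono_ae ?_
  filter_upwards [hμ] with x hx
  by_cases hxM : x ≤ M
  · rw [Set.indicator_of_mem (Set.mem_Iic.2 hxM), Set.indicator_of_notMem (by simpa using hxM)]
    refine (ENNReal.ofReal_eq_zero.2 (max_le ?_ le_rfl)).le
    have h1 := Real.add_one_le_exp (-(x * t))
    have h2 : x * t ≤ M * t := mul_le_mul_of_nonneg_right hxM ht.le
    linarith
  · rw [Set.indicator_of_notMem (by simpa using hxM), Set.indicator_of_mem (by simpa using hxM),
      add_zero]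
    refine ENNReal.ofReal_le_ofReal (max_le le_rfl ?_)
    rw [sub_nonneg, Real.exp_le_one_iff]
    nlinarith

theorem ae_pos_map_mul {F : Measure ℝ} (hF : F (Set.Iic 0) = 0) {c : ℝ} (hc : 0 < c) :
    ∀ᵐ x ∂(F.map fun x => c * x), 0 < x := by
  rw [ae_map_iff (by fun_prop) measurableSet_Ioi]
  rw [ae_iff]
  simpa [not_lt, mul_nonpos_iff_pos_imp_nonpos, hc, mul_pos_iff_of_pos_left,
    Set.Iic_def] using hF

theorem tendsto_zero_of_natCast_mul {g : ℕ → ℝ} {t : ℝ}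
    (hg : Tendsto (fun n => n * g n) atTop (𝓝 t)) : Tendsto g atTop (𝓝 0) := by
  have := hg.mul (tendsto_inv_atTop_zero.comp (tendsto_natCast_atTop_atTop (R := ℝ)))
  rw [mul_zero] at this
  refine this.congr' ?_
  filter_upwards [eventually_gt_atTop 0] with n hn
  have hn' : (0 : ℝ) < n := Nat.cast_pos.2 hn
  simp only [Function.comp]
  field_simp

theorem tendsto_one_sub_pow_sub {g : ℕ → ℝ} {t : ℝ} (hg : Tendsto (fun n => n * g n) atTop (𝓝 t))
    (k : ℕ) : Tendsto (fun n => (1 - g n) ^ (n - k)) atTop (𝓝 (Real.exp (-t))) := by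
  have h0 := tendsto_zero_of_natCast_mul hg
  have h1 : Tendsto (fun n => (1 + -g n) ^ n) atTop (𝓝 (Real.exp (-t))) := by
    refine Real.tendsto_one_add_pow_exp_of_tendsto ?_
    simpa using hg.neg
  have h2 : Tendsto (fun n => (1 - g n) ^ k) atTop (𝓝 1) := by
    simpa using (h0.const_sub 1).pow k
  have h3 := h1.div h2 one_ne_zero
  rw [div_one] at h3
  refine h3.congr' ?_
  filter_upwards [eventually_ge_atTop k, h0.eventually (gt_mem_nhds one_pos)] with n hn h
  simp only [Pi.div_apply, ← sub_eq_add_neg]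
  rw [div_eq_iff (pow_ne_zero _ (by linarith)), ← pow_add, Nat.sub_add_cancel hn]

/-- Asymptotically, the probability that all other sizes exceed `M` and are hit by time `t`. -/
theorem le_liminf_hitMass_pow (ha : 0 < a) (hA : 0 < A) (hF : F (Set.Iic 0) = 0)
    (hF0 : (fun x : ℝ => cdf F x) ~[𝓝[>] 0] fun x : ℝ => A * x ^ a) {M : ℝ} (hM : 0 < M) {t : ℝ}
    (ht : 0 < t) (k : ℕ) :
    ENNReal.ofReal (Real.exp (-(A * Real.Gamma (a + 1) * t ^ (-a) + t * M * (A * M ^ a)))) ≤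
      liminf (fun n : ℕ => hitMass ((F.map fun x => (n : ℝ) ^ (1 / a) * x).restrict (Set.Ioi M)) t
        ^ (n - k)) atTop := by
  set Fn : ℕ → Measure ℝ := fun n => F.map fun x => (n : ℝ) ^ (1 / a) * x with hFn
  have hprob : ∀ n, IsProbabilityMeasure (Fn n) := fun n =>
    Measure.isProbabilityMeasure_map (by fun_prop)
  set g : ℕ → ℝ := fun n => ∫ x, Real.exp (-(x * t)) ∂(Fn n) + t * M * (Fn n).real (Set.Iic M)
  have hg : Tendsto (fun n : ℕ => n * g n) atTop
      (𝓝 (A * Real.Gamma (a + 1) * t ^ (-a) + t * M * (A * M ^ a))) := by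
    have h1 := tendsto_mul_laplace ha hA hF hF0 ht
    have h2 := (tendsto_mul_cdf ha hA hF0 hM).const_mul (t * M)
    refine (h1.add h2).congr' ?_
    filter_upwards [eventually_gt_atTop 0] with n hn
    have hn' : (0 : ℝ) < n := Nat.cast_pos.2 hn
    have hc : 0 < (n : ℝ) ^ (1 / a) := by positivity
    have h3 : (Fn n).real (Set.Iic M) = cdf F (M / (n : ℝ) ^ (1 / a)) := by
      rw [cdf_eq_real, hFn, map_measureReal_apply (by fun_prop) measurableSet_Iic]
      congr 1
      ext x
      exact (le_div_iff₀' hc).symm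
    simp only [g, h3]
    ring
  have hlim := ENNReal.tendsto_ofReal (tendsto_one_sub_pow_sub hg k)
  rw [← hlim.liminf_eq]
  refine liminf_le_liminf ?_
  filter_upwards [eventually_gt_atTop 0, (tendsto_zero_of_natCast_mul hg).eventually
    (gt_mem_nhds one_pos)] with n hn h1
  have hn' : (0 : ℝ) < n := Nat.cast_pos.2 hn
  have hle := le_hitMass_restrict (μ := Fn n) (ae_pos_map_mul hF (by positivity)) M ht
  rw [ENNReal.ofReal_pow (by linarith)]
  exact pow_le_pow_left' hle _

end Asymptotic

/-! ### The law of the last size-biased picks -/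

theorem sum_sub_sum_Iio_perm {n : ℕ} (x : Fin n → ℝ) (π : Equiv.Perm (Fin n)) (i : Fin n) :
    ∑ j, x j - ∑ j ∈ Finset.Iio i, x (π j) =
      ∑ j ∈ Finset.Iic (Fin.rev i), x (π (Fin.rev j)) := by
  have h1 : ∑ j, x j = ∑ j, x (π j) := (Equiv.sum_comp π x).symm
  have h2 : ∑ j ∈ Finset.Iic (Fin.rev i), x (π (Fin.rev j)) = ∑ j ∈ Finset.Ici i, x (π j) := by
    refine Finset.sum_nbij' Fin.rev Fin.rev ?_ ?_ ?_ ?_ ?_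
    · intro j hj
      rw [Finset.mem_Iic] at hj
      rw [Finset.mem_Ici]
      exact Fin.le_rev_iff.1 hj
    · intro j hj
      rw [Finset.mem_Ici] at hj
      rw [Finset.mem_Iic]
      exact Fin.rev_le_rev.2 hj
    all_goals simp
  rw [h1, h2, sub_eq_iff_eq_add, ← Finset.sum_union]
  · congr 1
    ext j
    simp [le_or_gt]
  · rw [Finset.disjoint_left]
    intro j hj hj'
    simp only [Finset.mem_Ici, Finset.mem_Iio] at hj hj'
    exact absurd hj (not_le.2 hj')

theorem prod_pick_eq_biasWeight {n : ℕ} (x : Fin n → ℝ) (π : Equiv.Perm (Fin n)) :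
    ∏ i, ENNReal.ofReal (x (π i) / (∑ j, x j - ∑ j ∈ Finset.Iio i, x (π j))) =
      biasWeight 0 fun i => x (π (Fin.rev i)) := by
  unfold biasWeight
  rw [← Equiv.prod_comp Fin.revPerm]
  refine Finset.prod_congr rfl fun i _ => ?_
  rw [sum_sub_sum_Iio_perm, Fin.revPerm_apply, Fin.rev_rev, zero_add]

section SizeBiased

variable {n : ℕ} {Ω : Type*} [MeasurableSpace Ω] {P : Measure Ω} [IsProbabilityMeasure P]
  {X : Fin n → Ω → ℝ} {σ : Ω → Equiv.Perm (Fin n)}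

theorem IsSizeBiasedPermutation.measurableSet_eq {P : Measure Ω} (h : IsSizeBiasedPermutation P X σ)
    (π : Equiv.Perm (Fin n)) : MeasurableSet {ω | σ ω = π} := by
  have : {ω | σ ω = π} = ⋂ j, (fun ω => σ ω j) ⁻¹' {π j} := by
    ext ω
    simp [Equiv.ext_iff]
  rw [this]
  exact MeasurableSet.iInter fun j => h.measurable j (measurableSet_singleton _)

theorem IsSizeBiasedPermutation.condProb_eq_prod (h : IsSizeBiasedPermutation P X σ)
    (hX : ∀ i, Measurable (X i)) (π : Equiv.Perm (Fin n)) :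
    P⟦{ω | σ ω = π} | MeasurableSpace.comap (fun ω i => X i ω) MeasurableSpace.pi⟧ =ᵐ[P]
      fun ω => ∏ i, X (π i) ω / (∑ j, X j ω - ∑ j ∈ Finset.Iio i, X (π j) ω) := by
  have hm : MeasurableSpace.comap (fun ω i => X i ω) MeasurableSpace.pi ≤ ‹MeasurableSpace Ω› :=
    (measurable_pi_iff.2 hX).comap_le
  have key : ∀ k ≤ n, P⟦{ω | ∀ j : Fin n, j.val < k → σ ω j = π j} |
      MeasurableSpace.comap (fun ω i => X i ω) MeasurableSpace.pi⟧ =ᵐ[P]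
      fun ω => ∏ i with i.val < k, X (π i) ω / (∑ j, X j ω - ∑ j ∈ Finset.Iio i, X (π j) ω) := by
    intro k
    induction k with
    | zero =>
      intro _
      have : {ω | ∀ j : Fin n, j.val < 0 → σ ω j = π j} = Set.univ := by
        ext
        simp
      rw [this, Set.indicator_univ, condExp_const hm]
      simp
    | succ k ih =>
      intro hk
      have h1 := h.condProb π ⟨k, hk⟩
      have e1 : {ω | ∀ j ≤ (⟨k, hk⟩ : Fin n), σ ω j = π j} =
          {ω | ∀ j : Fin n, j.val < k + 1 → σ ω j = π j} := by
        ext ω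
        simp [Fin.le_def]
      have e2 : {ω | ∀ j < (⟨k, hk⟩ : Fin n), σ ω j = π j} =
          {ω | ∀ j : Fin n, j.val < k → σ ω j = π j} := by
        ext ω
        simp [Fin.lt_def]
      rw [e1, e2] at h1
      refine h1.trans ?_
      filter_upwards [ih (by omega)] with ω hω
      rw [hω]
      have : (Finset.univ.filter fun i : Fin n => i.val < k + 1) =
          insert ⟨k, hk⟩ (Finset.univ.filter fun i : Fin n => i.val < k) := by
        ext i
        simp only [Finset.mem_filter, Finset.mem_univ, true_and, Finset.mem_insert, Fin.ext_iff]
        omega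
      rw [this, Finset.prod_insert (by simp), mul_comm]
  have h1 := key n le_rfl
  have e1 : {ω | ∀ j : Fin n, j.val < n → σ ω j = π j} = {ω | σ ω = π} := by
    ext ω
    simp [Equiv.ext_iff]
  rw [e1] at h1
  simpa using h1

theorem IsSizeBiasedPermutation.measure_inter (h : IsSizeBiasedPermutation P X σ)
    (hX : ∀ i, Measurable (X i)) (hpos : ∀ᵐ ω ∂P, ∀ i, 0 < X i ω) (π : Equiv.Perm (Fin n))
    {A : Set (Fin n → ℝ)} (hA : MeasurableSet A) :
    P ({ω | σ ω = π} ∩ {ω | (fun i => X i ω) ∈ A}) =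
      ∫⁻ ω in {ω | (fun i => X i ω) ∈ A}, biasWeight 0 (fun i => X (π (Fin.rev i)) ω) ∂P := by
  have hXm : Measurable fun ω i => X i ω := measurable_pi_iff.2 hX
  have hm : MeasurableSpace.comap (fun ω i => X i ω) MeasurableSpace.pi ≤ ‹MeasurableSpace Ω› :=
    hXm.comap_le
  have hE := h.measurableSet_eq π
  have hint : Integrable ({ω | σ ω = π}.indicator fun _ => (1 : ℝ)) P :=
    (integrable_const _).indicator hE
  have h1 := setIntegral_condExp hm hint (s := {ω | (fun i => X i ω) ∈ A}) ⟨A, hA, rfl⟩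
  have hA' : MeasurableSet {ω | (fun i => X i ω) ∈ A} := hXm hA
  rw [setIntegral_congr_ae₀ hA'.nullMeasurableSet
    ((h.condProb_eq_prod hX π).mono fun ω hω _ => hω), integral_indicator_const _ hE] at h1
  rw [smul_eq_mul, mul_one, measureReal_def, Measure.restrict_apply hE] at h1
  have hw : Integrable (fun ω => ∏ i, X (π i) ω / (∑ j, X j ω - ∑ j ∈ Finset.Iio i, X (π j) ω))
      P := integrable_condExp.congr (h.condProb_eq_prod hX π)
  have hnn : ∀ᵐ ω ∂P, ∀ i, 0 ≤ X (π i) ω / (∑ j, X j ω - ∑ j ∈ Finset.Iio i, X (π j) ω) := by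
    filter_upwards [hpos] with ω hω i
    rw [sum_sub_sum_Iio_perm (fun j => X j ω)]
    exact div_nonneg (hω _).le (Finset.sum_nonneg fun j _ => (hω _).le)
  rw [← ENNReal.ofReal_toReal (measure_ne_top P _), ← h1, ofReal_integral_eq_lintegral_ofReal
    hw.integrableOn (ae_restrict_of_ae (hnn.mono fun ω hω => Finset.prod_nonneg fun i _ => hω i))]
  refine lintegral_congr_ae (ae_restrict_of_ae (hnn.mono fun ω hω => ?_))
  beta_reduce
  rw [ENNReal.ofReal_prod_of_nonneg fun i _ => hω i, prod_pick_eq_biasWeight fun i => X i ω]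

/-- The law of an i.i.d. sample in the reverse of size-biased order. -/
theorem IsSizeBiasedPermutation.measure_rev_mem (h : IsSizeBiasedPermutation P X σ)
    (hX : ∀ i, Measurable (X i)) {F : Measure ℝ} [IsProbabilityMeasure F]
    (hF : F (Set.Iic 0) = 0) (hXF : ∀ i, HasLaw (X i) F P) (hind : iIndepFun X P)
    {A : Set (Fin n → ℝ)} (hA : MeasurableSet A) :
    P {ω | (fun i => X (σ ω (Fin.rev i)) ω) ∈ A} =
      n.factorial * ∫⁻ x in A, biasWeight 0 x ∂(Measure.pi fun _ => F) := by
  have hlaw : P.map (fun ω i => X i ω) = Measure.pi fun _ => F := by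
    rw [(iIndepFun_iff_map_fun_eq_pi_map fun i => (hX i).aemeasurable).1 hind]
    congr 1
    funext i
    exact (hXF i).map_eq
  have hXm : Measurable fun ω i => X i ω := measurable_pi_iff.2 hX
  have hpos : ∀ᵐ ω ∂P, ∀ i, 0 < X i ω := by
    refine ae_all_iff.2 fun i => ?_
    have : ∀ᵐ x ∂(P.map (X i)), 0 < x := by
      rw [(hXF i).map_eq, ae_iff]
      simpa [Set.Iic_def] using hF
    exact ae_of_ae_map (hX i).aemeasurable this
  have hperm : ∀ π : Equiv.Perm (Fin n), Measurable fun (x : Fin n → ℝ) i => x (π (Fin.rev i)) :=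
    fun π => measurable_pi_iff.2 fun i => measurable_pi_apply _
  have hdisj : {ω | (fun i => X (σ ω (Fin.rev i)) ω) ∈ A} =
      ⋃ π ∈ (Finset.univ : Finset (Equiv.Perm (Fin n))), {ω | σ ω = π} ∩
        {ω | (fun i => X i ω) ∈ (fun (x : Fin n → ℝ) i => x (π (Fin.rev i))) ⁻¹' A} := by
    ext ω
    simp
  rw [hdisj, measure_biUnion_finset]
  · rw [Finset.sum_congr rfl fun π _ => h.measure_inter hX hpos π (hperm π hA)]
    have hterm : ∀ π : Equiv.Perm (Fin n),
        ∫⁻ ω in {ω | (fun i => X i ω) ∈ (fun (x : Fin n → ℝ) i => x (π (Fin.rev i))) ⁻¹' A},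
          biasWeight 0 (fun i => X (π (Fin.rev i)) ω) ∂P =
        ∫⁻ x in A, biasWeight 0 x ∂(Measure.pi fun _ => F) := by
      intro π
      have hw : Measurable (A.indicator fun x : Fin n → ℝ => biasWeight 0 x) :=
        Measurable.indicator (by fun_prop) hA
      have hw' : Measurable fun x : Fin n → ℝ => A.indicator (fun x => biasWeight 0 x)
          (x ∘ (Fin.revPerm.trans π)) := hw.comp (hperm π)
      rw [← lintegral_indicator hA, ← lintegral_pi_perm F (Fin.revPerm.trans π) hw, ← hlaw,
        lintegral_map hw' hXm]
      exact (lintegral_indicator (hXm (hperm π hA)) _).symm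
    rw [Finset.sum_congr rfl fun π _ => hterm π, Finset.sum_const, Finset.card_univ,
      Fintype.card_perm, Fintype.card_fin, nsmul_eq_mul]
  · intro π _ π' _ hne
    rw [Function.onFun, Set.disjoint_left]
    rintro ω ⟨h1, -⟩ ⟨h2, -⟩
    exact hne (h1.symm.trans h2)
  · exact fun π _ => (h.measurableSet_eq π).inter (hXm (hperm π hA))

/-- The joint law of the last `k` size-biased picks, on the event that all others exceed `M`. -/
theorem IsSizeBiasedPermutation.measure_last_picks {k m : ℕ} (hk : 0 < k) {Ω : Type*}
    [MeasurableSpace Ω] {P : Measure Ω} [IsProbabilityMeasure P] {X : Fin (k + m) → Ω → ℝ}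
    {σ : Ω → Equiv.Perm (Fin (k + m))} (h : IsSizeBiasedPermutation P X σ)
    (hX : ∀ i, Measurable (X i)) {F : Measure ℝ} [IsProbabilityMeasure F]
    (hF : F (Set.Iic 0) = 0) (hXF : ∀ i, HasLaw (X i) F P) (hind : iIndepFun X P)
    {c : ℝ} (hc : 0 < c) {O : Set (Fin k → ℝ)} (hO : MeasurableSet O) (M : ℝ) :
    P {ω | (fun i => c * X (σ ω (Fin.rev (Fin.castAdd m i))) ω) ∈ O ∧
        ∀ j, M < c * X (σ ω (Fin.rev (Fin.natAdd k j))) ω} =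
      (k + m).descFactorial k * ∫⁻ y in O, biasWeight 0 y *
        (∫⁻ t, ENNReal.ofReal ((∑ i, y i) * Real.exp (-((∑ i, y i) * t))) *
          hitMass ((F.map fun x => c * x).restrict (Set.Ioi M)) t ^ m ∂posVolume)
        ∂(Measure.pi fun _ => F.map fun x => c * x) := by
  set Fc := F.map fun x => c * x with hFc
  have : IsProbabilityMeasure Fc := Measure.isProbabilityMeasure_map (by fun_prop)
  set A : Set (Fin (k + m) → ℝ) := {x | (fun i => x (Fin.castAdd m i)) ∈ O ∧
    ∀ j, M < x (Fin.natAdd k j)} with hAdef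
  have hA : MeasurableSet A := by
    have hAeq : A = (fun (x : Fin (k + m) → ℝ) i => x (Fin.castAdd m i)) ⁻¹' O ∩
        ⋂ j, {x | M < x (Fin.natAdd k j)} := by
      ext x
      simp [hAdef]
    rw [hAeq]
    exact MeasurableSet.inter ((measurable_pi_iff.2 fun i => measurable_pi_apply _) hO)
      (MeasurableSet.iInter fun j => measurableSet_lt measurable_const (measurable_pi_apply _))
  have hsm : Measurable fun (x : Fin (k + m) → ℝ) i => c * x i :=
    measurable_pi_iff.2 fun i => by fun_prop
  have h1 := h.measure_rev_mem hX hF hXF hind (hsm hA)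
  have h2 : ∫⁻ x in (fun (x : Fin (k + m) → ℝ) i => c * x i) ⁻¹' A, biasWeight 0 x
      ∂(Measure.pi fun _ => F) = ∫⁻ x in A, biasWeight 0 x ∂(Measure.pi fun _ => Fc) := by
    have : (Measure.pi fun _ : Fin (k + m) => Fc) =
        (Measure.pi fun _ : Fin (k + m) => F).map fun x i => c * x i :=
      (Measure.pi_map_pi (μ := fun _ : Fin (k + m) => F) (f := fun _ x => c * x)
        (hμ := fun _ => by change SigmaFinite Fc; infer_instance) (fun _ => by fun_prop)).symm
    rw [this, setLIntegral_map hA (by fun_prop) hsm]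
    refine lintegral_congr fun x => ?_
    rw [biasWeight_smul hc.ne']
  have h3 : ∫⁻ x in A, biasWeight 0 x ∂(Measure.pi fun _ => Fc) =
      ∫⁻ y in O, biasWeight 0 y * ∫⁻ z, biasWeight (∑ i, y i) z
        ∂(Measure.pi fun _ : Fin m => Fc.restrict (Set.Ioi M)) ∂(Measure.pi fun _ => Fc) := by
    have hm : Measurable (A.indicator fun x => biasWeight 0 x) :=
      Measurable.indicator (by fun_prop) hA
    rw [← lintegral_indicator hA, lintegral_pi_append Fc hm, ← lintegral_indicator hO]
    refine lintegral_congr fun y => ?_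
    have hI : MeasurableSet (Set.pi Set.univ fun _ : Fin m => Set.Ioi M) :=
      MeasurableSet.univ_pi fun _ => measurableSet_Ioi
    rw [← Measure.restrict_pi_pi]
    by_cases hy : y ∈ O
    · rw [Set.indicator_of_mem hy, ← lintegral_indicator hI,
        ← lintegral_const_mul _ (Measurable.indicator (by fun_prop) hI)]
      refine lintegral_congr fun z => ?_
      by_cases hz : z ∈ Set.pi Set.univ fun _ : Fin m => Set.Ioi M
      · rw [Set.indicator_of_mem hz, Set.indicator_of_mem, biasWeight_append, zero_add]
        refine ⟨?_, fun j => ?_⟩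
        · simpa using hy
        · simpa using hz j trivial
      · rw [Set.indicator_of_notMem hz, Set.indicator_of_notMem, mul_zero]
        rintro ⟨-, hz'⟩
        exact hz fun j _ => by simpa using hz' j
    · rw [Set.indicator_of_notMem hy]
      rw [← lintegral_zero (μ := Measure.pi fun _ : Fin m => Fc)]
      refine lintegral_congr fun z => Set.indicator_of_notMem ?_ _
      rintro ⟨hy', -⟩
      exact hy (by simpa using hy')
  have hpos := ae_pos_map_mul hF hc
  have h4 : (m.factorial : ℝ≥0∞) * ∫⁻ x in A, biasWeight 0 x ∂(Measure.pi fun _ => Fc) =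
      ∫⁻ y in O, biasWeight 0 y *
        (∫⁻ t, ENNReal.ofReal ((∑ i, y i) * Real.exp (-((∑ i, y i) * t))) *
          hitMass (Fc.restrict (Set.Ioi M)) t ^ m ∂posVolume) ∂(Measure.pi fun _ => Fc) := by
    have hm : Measurable fun y : Fin k → ℝ => ∫⁻ z, biasWeight (∑ i, y i) z
        ∂(Measure.pi fun _ : Fin m => Fc.restrict (Set.Ioi M)) :=
      Measurable.lintegral_prod_right' (f := fun p : (Fin k → ℝ) × (Fin m → ℝ) =>
        biasWeight (∑ i, p.1 i) p.2) (by fun_prop)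
    have hm' : Measurable fun y : Fin k → ℝ => biasWeight 0 y * ∫⁻ z, biasWeight (∑ i, y i) z
        ∂(Measure.pi fun _ : Fin m => Fc.restrict (Set.Ioi M)) :=
      Measurable.mul (by fun_prop) hm
    rw [h3, ← lintegral_const_mul _ hm']
    have hae : ∀ᵐ y ∂(Measure.pi fun _ : Fin k => Fc), ∀ i, 0 < y i :=
      ae_all_iff.2 fun i => (Measure.quasiMeasurePreserving_eval (fun _ => Fc) i).ae hpos
    refine lintegral_congr_ae (ae_restrict_of_ae (hae.mono fun y hy => ?_))
    beta_reduce
    rw [mul_left_comm, factorial_mul_lintegral_biasWeight _ (ae_restrict_of_ae hpos)]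
    exact Finset.sum_pos (fun i _ => hy i) ⟨⟨0, hk⟩, Finset.mem_univ _⟩
  rw [← h4, ← mul_assoc, ← h2]
  rw [show ((k + m).descFactorial k : ℝ≥0∞) * m.factorial = (k + m).factorial by
    rw [← Nat.cast_mul, mul_comm]
    have := Nat.factorial_mul_descFactorial (Nat.le_add_right k m)
    rw [Nat.add_sub_cancel_left] at this
    rw [this]]
  exact h1

end SizeBiased

/-! ### The law of the limiting picks -/

theorem lintegral_comp_mul_rpow {C p : ℝ} (hC : 0 < C) (hp : p ≠ 0) (f : ℝ → ℝ≥0∞) :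
    ∫⁻ x, f x ∂posVolume =
      ∫⁻ v, ENNReal.ofReal (C * |p| * v ^ (p - 1)) * f (C * v ^ p) ∂posVolume := by
  have himg : (fun v : ℝ => C * v ^ p) '' Set.Ioi 0 = Set.Ioi 0 := by
    ext y
    constructor
    · rintro ⟨v, hv, rfl⟩
      exact mul_pos hC (Real.rpow_pos_of_pos hv p)
    · intro hy
      have hy : 0 < y := hy
      refine ⟨(y / C) ^ p⁻¹, Real.rpow_pos_of_pos (by positivity) _, ?_⟩
      beta_reduce
      rw [← Real.rpow_mul (by positivity), inv_mul_cancel₀ hp, Real.rpow_one,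
        mul_div_cancel₀ _ hC.ne']
  have hd : ∀ v ∈ Set.Ioi (0 : ℝ), HasDerivWithinAt (fun v : ℝ => C * v ^ p)
      (C * (p * v ^ (p - 1))) (Set.Ioi 0) v := fun v hv =>
    ((Real.hasDerivAt_rpow_const (Or.inl (ne_of_gt hv))).const_mul C).hasDerivWithinAt
  have hinj : Set.InjOn (fun v : ℝ => C * v ^ p) (Set.Ioi 0) := by
    intro v hv w hw h
    exact (Real.rpow_left_inj (le_of_lt hv) (le_of_lt hw) hp).1 (mul_left_cancel₀ hC.ne' h)
  have h := lintegral_image_eq_lintegral_abs_deriv_mul measurableSet_Ioi hd hinj f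
  rw [himg] at h
  rw [h]
  refine setLIntegral_congr_fun measurableSet_Ioi fun v hv => ?_
  have : 0 < v ^ (p - 1) := Real.rpow_pos_of_pos hv _
  rw [abs_mul, abs_mul, abs_of_pos hC, abs_of_pos this, mul_assoc C]

theorem lintegral_gammaMeasure (b : ℝ) {f : ℝ → ℝ≥0∞} (hf : Measurable f) :
    ∫⁻ x, f x ∂(gammaMeasure b 1) =
      ∫⁻ x, ENNReal.ofReal (x ^ (b - 1) * Real.exp (-x) / Real.Gamma b) * f x ∂posVolume := by
  have hm : Measurable (gammaPDF b 1) := (measurable_gammaPDFReal b 1).ennreal_ofReal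
  rw [gammaMeasure, lintegral_withDensity_eq_lintegral_mul _ hm hf,
    ← lintegral_indicator measurableSet_Ioi]
  refine lintegral_congr_ae ?_
  filter_upwards [compl_mem_ae_iff.2 (Real.volume_singleton (a := 0))] with x hx
  rcases lt_or_ge 0 x with h | h
  · rw [Set.indicator_of_mem (Set.mem_Ioi.2 h), Pi.mul_apply, gammaPDF_of_nonneg h.le]
    congr 2
    rw [Real.one_rpow, one_mul]
    ring
  · have hx' : x < 0 := lt_of_le_of_ne h hx
    rw [Set.indicator_of_notMem (by simpa using h), Pi.mul_apply, gammaPDF_of_neg hx', zero_mul]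

theorem lintegral_expMeasure_add {f : ℝ → ℝ≥0∞} (hf : Measurable f) (T : ℝ) :
    ∫⁻ x, f (T + x) ∂(expMeasure 1) = ENNReal.ofReal (Real.exp T) *
      ∫⁻ x in Set.Ioi T, ENNReal.ofReal (Real.exp (-x)) * f x := by
  have h1 : ∀ x : ℝ, x ^ ((1 : ℝ) - 1) * Real.exp (-x) / Real.Gamma 1 = Real.exp (-x) := by
    intro x
    simp
  rw [expMeasure, lintegral_gammaMeasure 1 (by fun_prop)]
  simp_rw [h1]
  rw [← lintegral_const_mul _ (by fun_prop), ← lintegral_indicator measurableSet_Ioi,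
    ← lintegral_indicator measurableSet_Ioi,
    ← lintegral_add_left_eq_self ((Set.Ioi T).indicator _) T]
  refine lintegral_congr fun x => ?_
  by_cases hx : 0 < x
  · rw [Set.indicator_of_mem (Set.mem_Ioi.2 hx), Set.indicator_of_mem (by simpa using hx),
      ← mul_assoc, ← ENNReal.ofReal_mul (Real.exp_pos _).le, ← Real.exp_add]
    congr 3
    ring
  · rw [Set.indicator_of_notMem (by simpa using hx), Set.indicator_of_notMem (by simpa using hx)]

@[fun_prop]
theorem measurable_limitQuantile (a A : ℝ) : Measurable (limitQuantile a A) := by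
  unfold limitQuantile
  fun_prop

section LimitLaw

variable {a r : ℝ}

/-- The law of one pair of an exponential and a gamma variable. -/
noncomputable abbrev expGamma (a : ℝ) : Measure (ℝ × ℝ) :=
  (expMeasure 1).prod (gammaMeasure (a + 1) 1)

/-- The constant in the mean measure `A * x ^ a` of the limit. -/
noncomputable abbrev limitConst (a r : ℝ) : ℝ := r ^ a / Real.Gamma (a + 1)

theorem lintegral_gamma_scaled (ha : 0 < a) (hr : 0 < r) {s : ℝ} (hs : 0 < s) {f : ℝ → ℝ≥0∞}
    (hf : Measurable f) :
    ENNReal.ofReal (r ^ a * a * s ^ (-a - 1)) * ∫⁻ g, f (g / s) ∂(gammaMeasure (a + 1) 1) =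
      ∫⁻ v, ENNReal.ofReal (limitQuantile a (limitConst a r) v *
        Real.exp (-(s * limitQuantile a (limitConst a r) v))) *
          f (limitQuantile a (limitConst a r) v) ∂posVolume := by
  have hG : 0 < Real.Gamma (a + 1) := Real.Gamma_pos_of_pos (by linarith)
  set A := limitConst a r with hA
  have hApos : 0 < A := by positivity
  rw [lintegral_gammaMeasure (a + 1) (by fun_prop),
    lintegral_comp_mul_rpow (C := s * A ^ (-(1 / a))) (p := 1 / a) (by positivity)
      (by positivity), ← lintegral_const_mul _ (by fun_prop)]
  refine setLIntegral_congr_fun measurableSet_Ioi fun v hv => ?_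
  have hv : 0 < v := hv
  have hq : s * A ^ (-(1 / a)) * v ^ (1 / a) = s * limitQuantile a A v := by
    unfold limitQuantile
    rw [Real.div_rpow hv.le hApos.le, Real.rpow_neg hApos.le]
    field_simp
  have hqpos := limitQuantile_pos (a := a) hApos hv
  rw [hq, mul_div_cancel_left₀ _ hs.ne', ← mul_assoc, ← mul_assoc]
  congr 1
  rw [← ENNReal.ofReal_mul (by positivity), ← ENNReal.ofReal_mul (by positivity)]
  congr 1
  have h1 : s * A ^ (-(1 / a)) * v ^ (1 / a - 1) = s * limitQuantile a A v / v := by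
    rw [← hq, Real.rpow_sub_one hv.ne']
    ring
  have h2 : (s * limitQuantile a A v) ^ a = s ^ a * (v / A) := by
    rw [Real.mul_rpow hs.le hqpos.le]
    unfold limitQuantile
    rw [← Real.rpow_mul (by positivity), one_div_mul_cancel ha.ne', Real.rpow_one]
  have h3 : s * A ^ (-(1 / a)) * |1 / a| * v ^ (1 / a - 1) = s * limitQuantile a A v / v / a := by
    rw [← h1, abs_of_pos (by positivity)]
    ring
  have h4 : s ^ (-a - 1) = (s ^ a)⁻¹ / s := by
    rw [Real.rpow_sub_one hs.ne', Real.rpow_neg hs.le]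
  rw [h3, add_sub_cancel_right, h2, h4, hA]
  field_simp

theorem rpow_limit_time (ha : 0 < a) (hr : 0 < r) {s : ℝ} (hs : 0 < s) :
    (r ^ a * s ^ (-a)) ^ (1 / a) = r / s := by
  rw [Real.mul_rpow (by positivity) (by positivity), ← Real.rpow_mul hr.le, ← Real.rpow_mul hs.le,
    mul_one_div_cancel ha.ne', Real.rpow_one, neg_mul, mul_one_div_cancel ha.ne',
    Real.rpow_neg_one, div_eq_mul_inv]

theorem limit_time_lt_iff (ha : 0 < a) (hr : 0 < r) {s t : ℝ} (hs : 0 < s) (ht : 0 < t) :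
    r ^ a * s ^ (-a) < r ^ a * t ^ (-a) ↔ t < s := by
  rw [mul_lt_mul_iff_right₀ (by positivity), Real.rpow_lt_rpow_iff_of_neg hs ht (by linarith)]

/-- One step of the limiting chain, started at time `r ^ a * t ^ (-a)`. -/
theorem lintegral_expGamma_step (ha : 0 < a) (hr : 0 < r) {G : ℝ → ℝ → ℝ≥0∞}
    (hG : Measurable (Function.uncurry G)) {T : ℝ} (hT : 0 ≤ T) :
    ∫⁻ p, G (T + p.1) ((T + p.1) ^ (1 / a) * p.2 / r) ∂(expGamma a) =
      ENNReal.ofReal (Real.exp T) * ∫⁻ s, {s | T < r ^ a * s ^ (-a)}.indicator (fun s =>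
        ENNReal.ofReal (Real.exp (-(r ^ a * s ^ (-a)))) *
        ∫⁻ v, ENNReal.ofReal (limitQuantile a (limitConst a r) v *
          Real.exp (-(s * limitQuantile a (limitConst a r) v))) *
            G (r ^ a * s ^ (-a)) (limitQuantile a (limitConst a r) v) ∂posVolume) s
        ∂posVolume := by
  have := isProbabilityMeasure_gammaMeasure (a := a + 1) (r := 1) (by linarith) one_pos
  have := isProbabilityMeasure_gammaMeasure (a := 1) (r := 1) one_pos one_pos
  have hG' : ∀ {f g : ℝ × ℝ → ℝ}, Measurable f → Measurable g →
    Measurable fun p => G (f p) (g p) := fun hf hg => hG.comp (hf.prodMk hg)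
  have hm : Measurable fun t => ∫⁻ g, G t (t ^ (1 / a) * g / r) ∂(gammaMeasure (a + 1) 1) :=
    Measurable.lintegral_prod_right' (f := fun p : ℝ × ℝ => G p.1 (p.1 ^ (1 / a) * p.2 / r))
      (hG' (by fun_prop) (by fun_prop))
  rw [lintegral_prod (μ := expMeasure 1) (fun p : ℝ × ℝ =>
    G (T + p.1) ((T + p.1) ^ (1 / a) * p.2 / r))
    (hG' (by fun_prop) (by fun_prop)).aemeasurable,
    lintegral_expMeasure_add (f := fun t => ∫⁻ g, G t (t ^ (1 / a) * g / r)
      ∂(gammaMeasure (a + 1) 1)) hm]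
  congr 1
  have h1 : Set.Ioi T = Set.Ioi T ∩ Set.Ioi 0 :=
    (Set.inter_eq_left.2 (Set.Ioi_subset_Ioi hT)).symm
  rw [h1, ← Measure.restrict_restrict measurableSet_Ioi, ← lintegral_indicator measurableSet_Ioi,
    lintegral_comp_mul_rpow (C := r ^ a) (p := -a) (by positivity) (by linarith)]
  refine setLIntegral_congr_fun measurableSet_Ioi fun s hs => ?_
  have hs : 0 < s := hs
  by_cases h : T < r ^ a * s ^ (-a)
  · rw [Set.indicator_of_mem (Set.mem_Ioi.2 h), Set.indicator_of_mem (by simpa using h),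
      mul_left_comm, rpow_limit_time ha hr hs, abs_neg, abs_of_pos ha]
    congr 1
    have h2 : ∀ g : ℝ, r / s * g / r = g / s := fun g => by field_simp
    simp_rw [h2]
    exact lintegral_gamma_scaled ha hr hs (hG.of_uncurry_left)
  · rw [Set.indicator_of_notMem (by simpa using h), Set.indicator_of_notMem (by simpa using h),
      mul_zero]

end LimitLaw

section LimitLaw

variable {a r : ℝ}

/-- The first picks of the limit, as a function of the exponential and gamma variables. -/
noncomputable def limitPicks (a r : ℝ) {k : ℕ} (z : Fin k → ℝ × ℝ) (i : Fin k) : ℝ :=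
  (∑ j ∈ Finset.Iic i, (z j).1) ^ (1 / a) * (z i).2 / r

theorem measurable_limitPicks (a r : ℝ) {k : ℕ} :
    Measurable fun z : Fin k → ℝ × ℝ => limitPicks a r z := by
  unfold limitPicks
  fun_prop

theorem limitPicks_snoc {k : ℕ} (z : Fin k → ℝ × ℝ) (p : ℝ × ℝ) :
    limitPicks a r (Fin.snoc z p : Fin (k + 1) → ℝ × ℝ) =
      Fin.snoc (limitPicks a r z) ((∑ i, (z i).1 + p.1) ^ (1 / a) * p.2 / r) := by
  have h := sum_Iic_append (fun i => (z i).1) (Fin.cons p.1 Fin.elim0 : Fin 1 → ℝ)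
  have hfst : ∀ j : Fin (k + 1), ((Fin.snoc z p : Fin (k + 1) → ℝ × ℝ) j).1 =
      Fin.append (fun i => (z i).1) (Fin.cons p.1 Fin.elim0 : Fin 1 → ℝ) j := by
    rw [← Fin.snoc_eq_append]
    intro j
    refine Fin.lastCases ?_ (fun i => ?_) j <;> simp
  funext i
  unfold limitPicks
  simp_rw [hfst]
  refine Fin.lastCases ?_ (fun i => ?_) i
  · have h2 := h.2 0
    rw [show Fin.natAdd k (0 : Fin 1) = Fin.last k from rfl] at h2
    rw [h2]
    have : Finset.Iic (0 : Fin 1) = {0} := rfl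
    simp [this]
  · rw [Fin.snoc_castSucc, Fin.snoc_castSucc]
    have := h.1 i
    rw [show Fin.castAdd 1 i = i.castSucc from rfl] at this
    rw [this]

/-- The weight of the values `x` for the limiting picks when the last clock rings at time
`r ^ a * s ^ (-a)`. -/
noncomputable def limitDensity (a r : ℝ) {k : ℕ} (x : Fin k → ℝ) (s : ℝ) : ℝ≥0∞ :=
  biasWeight 0 x * (ENNReal.ofReal ((∑ i, x i) * Real.exp (-((∑ i, x i) * s))) *
    ENNReal.ofReal (Real.exp (-(r ^ a * s ^ (-a)))))

theorem measurable_limitDensity {β : Type*} [MeasurableSpace β] {a r : ℝ} {k : ℕ}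
    {f : β → Fin k → ℝ} {g : β → ℝ} (hf : Measurable f) (hg : Measurable g) :
    Measurable fun b => limitDensity a r (f b) (g b) := by
  unfold limitDensity
  fun_prop

theorem ae_pi_posVolume (k : ℕ) :
    ∀ᵐ v ∂(Measure.pi fun _ : Fin k => posVolume), ∀ i, 0 < v i :=
  ae_all_iff.2 fun i =>
    (Measure.quasiMeasurePreserving_eval (fun _ : Fin k => posVolume) i).ae ae_posVolume

/-- Passing from the law of the limiting chain with an unfinished last step to its law. -/
theorem lintegral_limitDensity_snoc (ha : 0 < a) (hr : 0 < r) (k : ℕ)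
    {Ψ : ℝ → (Fin (k + 1) → ℝ) → ℝ≥0∞} (hΨ : Measurable (Function.uncurry Ψ)) :
    ∫⁻ v : Fin (k + 1) → ℝ, ∫⁻ s,
        limitDensity a r (fun i => limitQuantile a (limitConst a r) (v i)) s *
          Ψ (r ^ a * s ^ (-a)) (fun i => limitQuantile a (limitConst a r) (v i)) ∂posVolume
        ∂(Measure.pi fun _ => posVolume) =
      ∫⁻ v : Fin k → ℝ, biasWeight 0 (fun i => limitQuantile a (limitConst a r) (v i)) *
        ∫⁻ s, ENNReal.ofReal (Real.exp (-((∑ i, limitQuantile a (limitConst a r) (v i)) * s))) *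
          (ENNReal.ofReal (Real.exp (-(r ^ a * s ^ (-a)))) *
            ∫⁻ w, ENNReal.ofReal (limitQuantile a (limitConst a r) w *
              Real.exp (-(s * limitQuantile a (limitConst a r) w))) *
              Ψ (r ^ a * s ^ (-a)) (Fin.snoc (fun i => limitQuantile a (limitConst a r) (v i))
                (limitQuantile a (limitConst a r) w)) ∂posVolume)
          ∂posVolume ∂(Measure.pi fun _ => posVolume) := by
  set q := limitQuantile a (limitConst a r) with hq
  have hG : 0 < Real.Gamma (a + 1) := Real.Gamma_pos_of_pos (by linarith)
  have hqpos : ∀ v, 0 < v → 0 < q v := fun v hv => limitQuantile_pos (by positivity) hv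
  have hqm : Measurable q := measurable_limitQuantile _ _
  have hqk : ∀ k, Measurable fun (v : Fin k → ℝ) i => q (v i) := fun k => by fun_prop
  have hΨ' : ∀ {β : Type} [MeasurableSpace β] {f : β → ℝ} {g : β → Fin (k + 1) → ℝ},
      Measurable f → Measurable g → Measurable fun b => Ψ (f b) (g b) :=
    fun hf hg => hΨ.comp (hf.prodMk hg)
  have hm1 : Measurable fun p : (Fin (k + 1) → ℝ) × ℝ =>
      limitDensity a r (fun i => q (p.1 i)) p.2 *
        Ψ (r ^ a * p.2 ^ (-a)) (fun i => q (p.1 i)) :=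
    Measurable.mul (measurable_limitDensity (by fun_prop) measurable_snd)
      (hΨ' (by fun_prop) (by fun_prop))
  rw [lintegral_pi_snoc posVolume (Measurable.lintegral_prod_right' hm1)]
  refine lintegral_congr_ae ?_
  filter_upwards [ae_pi_posVolume k] with v hv
  have hsn : ∀ w, (fun i => q ((Fin.snoc v w : Fin (k + 1) → ℝ) i)) =
      (Fin.snoc (fun i => q (v i)) (q w) : Fin (k + 1) → ℝ) := by
    intro w
    funext i
    refine Fin.lastCases ?_ (fun i => ?_) i <;> simp
  simp_rw [hsn]
  have hsnm : Measurable fun w : ℝ => (Fin.snoc (fun i => q (v i)) (q w) : Fin (k + 1) → ℝ) :=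
    measurable_finSnoc.comp (g := fun p : (Fin k → ℝ) × ℝ => (Fin.snoc p.1 p.2 : Fin (k + 1) → ℝ))
      (f := fun w => ((fun i => q (v i)), q w)) (measurable_const.prodMk hqm)
  have hm2 : Measurable fun p : ℝ × ℝ => ENNReal.ofReal (q p.2 * Real.exp (-(p.1 * q p.2))) *
      Ψ (r ^ a * p.1 ^ (-a)) (Fin.snoc (fun i => q (v i)) (q p.2)) :=
    Measurable.mul (by fun_prop) (hΨ' (by fun_prop) (hsnm.comp measurable_snd))
  have hm3 : Measurable fun s => ENNReal.ofReal (Real.exp (-((∑ i, q (v i)) * s))) *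
      (ENNReal.ofReal (Real.exp (-(r ^ a * s ^ (-a)))) *
        ∫⁻ w, ENNReal.ofReal (q w * Real.exp (-(s * q w))) *
          Ψ (r ^ a * s ^ (-a)) (Fin.snoc (fun i => q (v i)) (q w)) ∂posVolume) :=
    Measurable.mul (by fun_prop) (Measurable.mul (by fun_prop) hm2.lintegral_prod_right')
  rw [← lintegral_const_mul _ hm3, lintegral_lintegral_swap]
  · refine lintegral_congr fun s => ?_
    obtain ⟨H, hH⟩ : ∃ H : ℝ → ℝ≥0∞, ∀ w, ENNReal.ofReal (q w * Real.exp (-(s * q w))) *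
        Ψ (r ^ a * s ^ (-a)) (Fin.snoc (fun i => q (v i)) (q w)) = H w := ⟨_, fun _ => rfl⟩
    have hHm : Measurable H := by
      have := hm2.comp (measurable_const.prodMk measurable_id : Measurable fun w : ℝ => (s, w))
      exact (funext hH : _ = H) ▸ this
    simp_rw [hH]
    rw [← lintegral_const_mul _ hHm, ← lintegral_const_mul _ (hHm.const_mul _),
      ← lintegral_const_mul _ ((hHm.const_mul _).const_mul _)]
    refine setLIntegral_congr_fun measurableSet_Ioi fun w hw => ?_
    rw [← hH]
    have hw := hqpos w hw
    have hS : 0 ≤ ∑ i, q (v i) := Finset.sum_nonneg fun i _ => (hqpos _ (hv i)).le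
    unfold limitDensity
    rw [biasWeight_snoc, zero_add, Fin.sum_univ_castSucc]
    simp only [Fin.snoc_castSucc, Fin.snoc_last]
    have hkey : ENNReal.ofReal (q w / (∑ i, q (v i) + q w)) *
        ENNReal.ofReal ((∑ i, q (v i) + q w) * Real.exp (-((∑ i, q (v i) + q w) * s))) =
        ENNReal.ofReal (Real.exp (-((∑ i, q (v i)) * s))) *
          ENNReal.ofReal (q w * Real.exp (-(s * q w))) := by
      rw [← ENNReal.ofReal_mul (by positivity), ← ENNReal.ofReal_mul (by positivity)]
      congr 1
      rw [mul_left_comm (Real.exp _), ← Real.exp_add,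
        show -((∑ i, q (v i)) * s) + -(s * q w) = -((∑ i, q (v i) + q w) * s) by ring]
      field_simp
    calc _ = biasWeight 0 (fun i => q (v i)) * (ENNReal.ofReal (q w / (∑ i, q (v i) + q w)) *
        ENNReal.ofReal ((∑ i, q (v i) + q w) * Real.exp (-((∑ i, q (v i) + q w) * s)))) *
        ENNReal.ofReal (Real.exp (-(r ^ a * s ^ (-a)))) *
          Ψ (r ^ a * s ^ (-a)) (Fin.snoc (fun i => q (v i)) (q w)) := by ring
      _ = _ := by
        rw [hkey]
        ring
  · refine Measurable.aemeasurable ?_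
    have : Measurable fun p : ℝ × ℝ => (Fin.snoc (fun i => q (v i)) (q p.1) : Fin (k + 1) → ℝ) :=
      hsnm.comp measurable_fst
    exact Measurable.mul (measurable_limitDensity this measurable_snd) (hΨ' (by fun_prop) this)

end LimitLaw

section LimitLaw

variable {a r : ℝ}

theorem lintegral_pi_fin_zero {α : Type*} [MeasurableSpace α] (μ : Measure α) [SigmaFinite μ]
    (f : (Fin 0 → α) → ℝ≥0∞) : ∫⁻ x, f x ∂(Measure.pi fun _ => μ) = f Fin.elim0 := by
  rw [Measure.pi_of_empty (x := Fin.elim0), lintegral_dirac]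

/-- The law of the limiting picks and of the clock of the last of them. -/
theorem lintegral_limitPicks (ha : 0 < a) (hr : 0 < r) (k : ℕ)
    {Ψ : ℝ → (Fin (k + 1) → ℝ) → ℝ≥0∞} (hΨ : Measurable (Function.uncurry Ψ)) :
    ∫⁻ z : Fin (k + 1) → ℝ × ℝ, Ψ (∑ i, (z i).1) (limitPicks a r z)
        ∂(Measure.pi fun _ => expGamma a) =
      ∫⁻ v : Fin (k + 1) → ℝ, ∫⁻ s,
        limitDensity a r (fun i => limitQuantile a (limitConst a r) (v i)) s *
          Ψ (r ^ a * s ^ (-a)) (fun i => limitQuantile a (limitConst a r) (v i)) ∂posVolume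
        ∂(Measure.pi fun _ => posVolume) := by
  have hp1 := isProbabilityMeasure_gammaMeasure (a := a + 1) (r := 1) (by linarith) one_pos
  have hp2 : IsProbabilityMeasure (expMeasure 1) :=
    isProbabilityMeasure_gammaMeasure (a := 1) (r := 1) one_pos one_pos
  set q := limitQuantile a (limitConst a r) with hq
  have hG : 0 < Real.Gamma (a + 1) := Real.Gamma_pos_of_pos (by linarith)
  have hqpos : ∀ v, 0 < v → 0 < q v := fun v hv => limitQuantile_pos (by positivity) hv
  have hqm : Measurable q := measurable_limitQuantile _ _
  have hsum : Measurable fun z : Fin (k + 1) → ℝ × ℝ => ∑ i, (z i).1 := by fun_prop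
  rw [lintegral_limitDensity_snoc ha hr k hΨ, lintegral_pi_snoc (expGamma a)
    (f := fun z : Fin (k + 1) → ℝ × ℝ => Ψ (∑ i, (z i).1) (limitPicks a r z))
    (hΨ.comp (Measurable.prodMk hsum (measurable_limitPicks a r)))]
  set W : ℝ → (Fin k → ℝ) → ℝ≥0∞ := fun T x => ∫⁻ p, Ψ (T + p.1)
    (Fin.snoc x ((T + p.1) ^ (1 / a) * p.2 / r) : Fin (k + 1) → ℝ) ∂(expGamma a) with hW
  have hsn : ∀ (z : Fin k → ℝ × ℝ) (p : ℝ × ℝ),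
      ∑ i, ((Fin.snoc z p : Fin (k + 1) → ℝ × ℝ) i).1 = ∑ i, (z i).1 + p.1 := by
    intro z p
    rw [Fin.sum_univ_castSucc]
    simp
  have hlhs : ∀ z : Fin k → ℝ × ℝ, ∫⁻ p, Ψ (∑ i, ((Fin.snoc z p : Fin (k + 1) → ℝ × ℝ) i).1)
      (limitPicks a r (Fin.snoc z p : Fin (k + 1) → ℝ × ℝ)) ∂(expGamma a) =
      W (∑ i, (z i).1) (limitPicks a r z) := by
    intro z
    simp_rw [hsn, limitPicks_snoc]
    rfl
  simp_rw [hlhs]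
  set H : (Fin k → ℝ) → ℝ → ℝ≥0∞ := fun x s => ENNReal.ofReal (Real.exp (-(r ^ a * s ^ (-a)))) *
    ∫⁻ w, ENNReal.ofReal (q w * Real.exp (-(s * q w))) *
      Ψ (r ^ a * s ^ (-a)) (Fin.snoc x (q w) : Fin (k + 1) → ℝ) ∂posVolume with hH
  have hsnm : ∀ x : Fin k → ℝ, Measurable fun y : ℝ => (Fin.snoc x y : Fin (k + 1) → ℝ) :=
    fun x => measurable_finSnoc.comp
      (g := fun p : (Fin k → ℝ) × ℝ => (Fin.snoc p.1 p.2 : Fin (k + 1) → ℝ))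
      (f := fun w => (x, w)) (by fun_prop)
  have hstep : ∀ (x : Fin k → ℝ) (T : ℝ), 0 ≤ T → W T x = ENNReal.ofReal (Real.exp T) *
      ∫⁻ s, {s | T < r ^ a * s ^ (-a)}.indicator (H x) s ∂posVolume := by
    intro x T hT
    exact lintegral_expGamma_step ha hr (G := fun t y => Ψ t (Fin.snoc x y : Fin (k + 1) → ℝ))
      (hΨ.comp (measurable_fst.prodMk ((hsnm x).comp measurable_snd))) hT
  have hHm : ∀ x, Measurable (H x) := by
    intro x
    refine Measurable.mul (by fun_prop) (Measurable.lintegral_prod_right'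
      (f := fun p : ℝ × ℝ => ENNReal.ofReal (q p.2 * Real.exp (-(p.1 * q p.2))) *
      Ψ (r ^ a * p.1 ^ (-a)) (Fin.snoc x (q p.2) : Fin (k + 1) → ℝ)) ?_)
    refine Measurable.mul (by fun_prop) (hΨ.comp (Measurable.prodMk (by fun_prop) ?_))
    exact (hsnm x).comp (hqm.comp measurable_snd)
  have hWm : Measurable (Function.uncurry W) := by
    refine Measurable.lintegral_prod_right' (f := fun p : (ℝ × (Fin k → ℝ)) × (ℝ × ℝ) =>
      Ψ (p.1.1 + p.2.1)
        (Fin.snoc p.1.2 ((p.1.1 + p.2.1) ^ (1 / a) * p.2.2 / r) : Fin (k + 1) → ℝ)) ?_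
    refine hΨ.comp (Measurable.prodMk (by fun_prop) ?_)
    exact measurable_finSnoc.comp
      (g := fun p : (Fin k → ℝ) × ℝ => (Fin.snoc p.1 p.2 : Fin (k + 1) → ℝ))
      (f := fun p : (ℝ × (Fin k → ℝ)) × (ℝ × ℝ) =>
        (p.1.2, (p.1.1 + p.2.1) ^ (1 / a) * p.2.2 / r)) (by fun_prop)
  cases k with
  | zero =>
    rw [lintegral_pi_fin_zero, lintegral_pi_fin_zero, biasWeight_zero, one_mul,
      Finset.univ_eq_empty, Finset.sum_empty, hstep _ 0 le_rfl, Real.exp_zero, ENNReal.ofReal_one,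
      one_mul]
    refine setLIntegral_congr_fun measurableSet_Ioi fun s hs => ?_
    have hs : 0 < s := hs
    have hmem : s ∈ {s : ℝ | 0 < r ^ a * s ^ (-a)} := show 0 < r ^ a * s ^ (-a) by positivity
    rw [Set.indicator_of_mem hmem]
    simp only [Finset.sum_empty, zero_mul, neg_zero, Real.exp_zero,
      ENNReal.ofReal_one, one_mul]
    have h1 : limitPicks a r (Fin.elim0 : Fin 0 → ℝ × ℝ) =
        fun i => q ((Fin.elim0 : Fin 0 → ℝ) i) := Subsingleton.elim _ _
    rw [h1]
  | succ k =>
    rw [lintegral_limitPicks ha hr k hWm]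
    refine lintegral_congr_ae ?_
    filter_upwards [ae_pi_posVolume (k + 1)] with v hv
    set x : Fin (k + 1) → ℝ := fun i => q (v i) with hx
    have hS : 0 < ∑ i, x i := Finset.sum_pos (fun i _ => hqpos _ (hv i)) ⟨0, Finset.mem_univ _⟩
    change ∫⁻ s, limitDensity a r x s * W (r ^ a * s ^ (-a)) x ∂posVolume =
      biasWeight 0 x * ∫⁻ s, ENNReal.ofReal (Real.exp (-((∑ i, x i) * s))) * H x s ∂posVolume
    have h1 : ∀ s ∈ Set.Ioi (0 : ℝ), limitDensity a r x s * W (r ^ a * s ^ (-a)) x =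
        biasWeight 0 x * (ENNReal.ofReal ((∑ i, x i) * Real.exp (-((∑ i, x i) * s))) *
          ∫⁻ t in Set.Iio s, H x t ∂posVolume) := by
      intro s hs
      have hs : 0 < s := hs
      rw [hstep x _ (by positivity)]
      have h2 : ∫⁻ t, {t | r ^ a * s ^ (-a) < r ^ a * t ^ (-a)}.indicator (H x) t ∂posVolume =
          ∫⁻ t in Set.Iio s, H x t ∂posVolume := by
        rw [← lintegral_indicator measurableSet_Iio]
        refine setLIntegral_congr_fun measurableSet_Ioi fun t ht => ?_
        by_cases hts : t < s
        · rw [Set.indicator_of_mem (Set.mem_Iio.2 hts)]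
          exact Set.indicator_of_mem (s := {t : ℝ | r ^ a * s ^ (-a) < r ^ a * t ^ (-a)})
            ((limit_time_lt_iff ha hr hs ht).2 hts) _
        · rw [Set.indicator_of_notMem (s := Set.Iio s) (by simpa using hts)]
          exact Set.indicator_of_notMem (s := {t : ℝ | r ^ a * s ^ (-a) < r ^ a * t ^ (-a)})
            (fun h => hts ((limit_time_lt_iff ha hr hs ht).1 h)) _
      have h3 : ENNReal.ofReal (Real.exp (-(r ^ a * s ^ (-a)))) *
          ENNReal.ofReal (Real.exp (r ^ a * s ^ (-a))) = 1 := by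
        rw [← ENNReal.ofReal_mul (Real.exp_pos _).le, ← Real.exp_add, neg_add_cancel,
          Real.exp_zero, ENNReal.ofReal_one]
      rw [h2]
      unfold limitDensity
      rw [mul_assoc, mul_assoc, ← mul_assoc (ENNReal.ofReal (Real.exp (-(r ^ a * s ^ (-a))))), h3,
        one_mul]
    rw [setLIntegral_congr_fun measurableSet_Ioi h1, lintegral_const_mul]
    · rw [lintegral_mul_lintegral_Iio posVolume
        (f := fun s => ENNReal.ofReal ((∑ i, x i) * Real.exp (-((∑ i, x i) * s))))
        (by fun_prop) (hHm x)]
      congr 1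
      refine setLIntegral_congr_fun measurableSet_Ioi fun s hs => ?_
      rw [lintegral_Ioi_exp_neg_mul hS (le_of_lt hs), mul_comm]
    · exact Measurable.mul (by fun_prop) (measurable_lintegral_Iio _ (hHm x))

end LimitLaw

theorem tendsto_descFactorial_mul (k : ℕ) :
    Tendsto (fun n : ℕ => (n.descFactorial k : ℝ≥0∞) * ENNReal.ofReal (n : ℝ)⁻¹ ^ k) atTop
      (𝓝 1) := by
  have h1 : Tendsto (fun n : ℕ => (n.descFactorial k : ℝ) / (n : ℝ) ^ k) atTop (𝓝 1) := by
    refine (Asymptotics.isEquivalent_iff_tendsto_one ?_).1 (isEquivalent_descFactorial k)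
    filter_upwards [eventually_gt_atTop 0] with n hn
    positivity
  have h2 := ENNReal.tendsto_ofReal h1
  rw [ENNReal.ofReal_one] at h2
  refine h2.congr' ?_
  filter_upwards with n
  rw [← ENNReal.ofReal_pow (by positivity), div_eq_mul_inv, ENNReal.ofReal_mul (by positivity),
    ENNReal.ofReal_natCast, inv_pow]

theorem tendsto_biasWeight {k : ℕ} {x : ℕ → Fin k → ℝ} {y : Fin k → ℝ} (hy : ∀ i, 0 < y i)
    (hx : ∀ i, Tendsto (fun n => x n i) atTop (𝓝 (y i))) :
    Tendsto (fun n => biasWeight 0 (x n)) atTop (𝓝 (biasWeight 0 y)) := by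
  refine ENNReal.tendsto_finsetProd_of_ne_top _ (fun i _ => ?_) fun i _ => ENNReal.ofReal_ne_top
  refine ENNReal.tendsto_ofReal ((hx i).div ((tendsto_finsetSum _ fun j _ => hx j).const_add 0) ?_)
  have : 0 < ∑ j ∈ Finset.Iic i, y j := Finset.sum_pos (fun j _ => hy j) ⟨i, by simp⟩
  linarith

theorem revSeq_of_lt {n : ℕ} (x : Fin n → ℝ) {k : ℕ} (h : k < n) :
    revSeq x k = x (Fin.rev ⟨k, h⟩) := by
  rw [revSeq, dif_pos h]

theorem IsSizeBiasedPermutation.measure_last_picks_of_le {k n : ℕ} (hk : 0 < k) (hkn : k ≤ n)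
    {Ω : Type*} [MeasurableSpace Ω] {P : Measure Ω} [IsProbabilityMeasure P] {X : Fin n → Ω → ℝ}
    {σ : Ω → Equiv.Perm (Fin n)} (h : IsSizeBiasedPermutation P X σ)
    (hX : ∀ i, Measurable (X i)) {F : Measure ℝ} [IsProbabilityMeasure F]
    (hF : F (Set.Iic 0) = 0) (hXF : ∀ i, HasLaw (X i) F P) (hind : iIndepFun X P)
    {c : ℝ} (hc : 0 < c) {O : Set (Fin k → ℝ)} (hO : MeasurableSet O) (M : ℝ) :
    P {ω | (fun i : Fin k => c * revSeq (fun j => X (σ ω j) ω) i) ∈ O ∧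
        ∀ j, k ≤ j → j < n → M < c * revSeq (fun j => X (σ ω j) ω) j} =
      n.descFactorial k * ∫⁻ y in O, biasWeight 0 y *
        (∫⁻ t, ENNReal.ofReal ((∑ i, y i) * Real.exp (-((∑ i, y i) * t))) *
          hitMass ((F.map fun x => c * x).restrict (Set.Ioi M)) t ^ (n - k) ∂posVolume)
        ∂(Measure.pi fun _ => F.map fun x => c * x) := by
  obtain ⟨m, rfl⟩ := Nat.exists_eq_add_of_le hkn
  rw [Nat.add_sub_cancel_left, ← h.measure_last_picks hk hX hF hXF hind hc hO M]
  congr 1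
  ext ω
  refine and_congr ?_ ?_
  · have : (fun i : Fin k => c * revSeq (fun j => X (σ ω j) ω) i) =
        fun i => c * X (σ ω (Fin.rev (Fin.castAdd m i))) ω := by
      funext i
      rw [revSeq_of_lt _ (show (i : ℕ) < k + m by omega)]
      rfl
    rw [this]
  · constructor
    · intro hj j
      have := hj (k + j) (by omega) (by omega)
      rwa [revSeq_of_lt _ (show k + (j : ℕ) < k + m by omega)] at this
    · intro hj j hkj hjn
      rw [revSeq_of_lt _ hjn]
      have := hj ⟨j - k, by omega⟩
      have e : Fin.natAdd k (⟨j - k, by omega⟩ : Fin m) = ⟨j, hjn⟩ := by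
        ext
        simp
        omega
      rwa [e] at this

section LimitLaw

variable {a r : ℝ}

/-- Fatou's lemma for the joint law of the last picks and of the others exceeding `M`. -/
theorem le_liminf_measure_last_picks {F : Measure ℝ} [IsProbabilityMeasure F]
    (hF : F (Set.Iic 0) = 0) (ha : 0 < a) (hr : 0 < r)
    (hF0 : (fun x : ℝ => cdf F x) ~[𝓝[>] 0] fun x : ℝ => limitConst a r * x ^ a)
    {Ω : ℕ → Type*} [∀ n, MeasurableSpace (Ω n)] (P : (n : ℕ) → Measure (Ω n))
    [∀ n, IsProbabilityMeasure (P n)] (X : (n : ℕ) → Fin n → Ω n → ℝ)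
    (hX : ∀ n i, Measurable (X n i)) (hind : ∀ n, iIndepFun (X n) (P n))
    (hXF : ∀ n i, HasLaw (X n i) F (P n)) (σ : (n : ℕ) → Ω n → Equiv.Perm (Fin n))
    (hσ : ∀ n, IsSizeBiasedPermutation (P n) (X n) (σ n)) (k : ℕ) {O : Set (Fin (k + 1) → ℝ)}
    (hO : IsOpen O) {M : ℝ} (hM : 0 < M) :
    ∫⁻ z : Fin (k + 1) → ℝ × ℝ, O.indicator (fun _ => ENNReal.ofReal
        (Real.exp (-(r * (∑ i, (z i).1) ^ (-(1 / a)) * M * (limitConst a r * M ^ a)))))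
        (limitPicks a r z) ∂(Measure.pi fun _ => expGamma a) ≤
      liminf (fun n => P n {ω | (fun i : Fin (k + 1) =>
          (n : ℝ) ^ (1 / a) * revSeq (fun j => X n (σ n ω j) ω) i) ∈ O ∧
        ∀ j, k + 1 ≤ j → j < n → M < (n : ℝ) ^ (1 / a) * revSeq (fun j => X n (σ n ω j) ω) j})
        atTop := by
  set A := limitConst a r with hA
  have hG : 0 < Real.Gamma (a + 1) := Real.Gamma_pos_of_pos (by linarith)
  have hApos : 0 < A := by positivity
  have hAG : A * Real.Gamma (a + 1) = r ^ a := div_mul_cancel₀ _ hG.ne'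
  obtain ⟨Q, hQ⟩ := exists_isQuantile F
  set Fn : ℕ → Measure ℝ := fun n => F.map fun x => (n : ℝ) ^ (1 / a) * x with hFn
  have hprob : ∀ n, IsProbabilityMeasure (Fn n) := fun n =>
    Measure.isProbabilityMeasure_map (by fun_prop)
  set q : ℝ → ℝ := limitQuantile a A
  set qn : ℕ → ℝ → ℝ := fun n v => (n : ℝ) ^ (1 / a) * Q (v / n) with hqn
  have hqnm : ∀ n, Measurable (qn n) := fun n =>
    (hQ.measurable.comp (measurable_id.div_const _)).const_mul _
  have hqnk : ∀ n, Measurable fun (v : Fin (k + 1) → ℝ) i => qn n (v i) := fun n =>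
    measurable_pi_iff.2 fun i => (hqnm n).comp (measurable_pi_apply i)
  set h : ℕ → ℝ → ℝ≥0∞ := fun n t => hitMass ((Fn n).restrict (Set.Ioi M)) t ^ (n - (k + 1))
  have hhm : ∀ n, Measurable (h n) := fun n => (measurable_hitMass _).pow_const _
  -- the integrand, before the passage to the limit
  set f : ℕ → (Fin (k + 1) → ℝ) × ℝ → ℝ≥0∞ := fun n p =>
    ((n.descFactorial (k + 1) : ℝ≥0∞) * ENNReal.ofReal (n : ℝ)⁻¹ ^ (k + 1)) *
      (Set.pi Set.univ fun _ => Set.Iio (n : ℝ)).indicator (fun v =>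
        O.indicator (fun y => biasWeight 0 y *
          ENNReal.ofReal ((∑ i, y i) * Real.exp (-((∑ i, y i) * p.2)))) fun i => qn n (v i)) p.1 *
        h n p.2 with hf
  have hbm : Measurable fun p : (Fin (k + 1) → ℝ) × ℝ =>
      O.indicator (fun y => biasWeight 0 y *
        ENNReal.ofReal ((∑ i, y i) * Real.exp (-((∑ i, y i) * p.2)))) p.1 := by
    have : Measurable ((Prod.fst ⁻¹' O).indicator fun p : (Fin (k + 1) → ℝ) × ℝ =>
        biasWeight 0 p.1 *
          ENNReal.ofReal ((∑ i, p.1 i) * Real.exp (-((∑ i, p.1 i) * p.2)))) :=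
      Measurable.indicator (by fun_prop) (measurable_fst hO.measurableSet)
    exact this
  have hI : ∀ n : ℕ, MeasurableSet (Set.pi Set.univ fun _ : Fin (k + 1) => Set.Iio (n : ℝ)) :=
    fun n => MeasurableSet.univ_pi fun _ => measurableSet_Iio
  have hfm : ∀ n, Measurable (f n) := by
    intro n
    refine Measurable.mul (Measurable.const_mul ?_ _) ((hhm n).comp measurable_snd)
    have h1 : Measurable fun p : (Fin (k + 1) → ℝ) × ℝ =>
        ((fun i => qn n (p.1 i) : Fin (k + 1) → ℝ), p.2) :=
      ((hqnk n).comp measurable_fst).prodMk measurable_snd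
    have h2 : Measurable ((Prod.fst ⁻¹' Set.pi Set.univ fun _ => Set.Iio (n : ℝ)).indicator
        fun p : (Fin (k + 1) → ℝ) × ℝ => O.indicator (fun y => biasWeight 0 y *
          ENNReal.ofReal ((∑ i, y i) * Real.exp (-((∑ i, y i) * p.2)))) fun i => qn n (p.1 i)) :=
      Measurable.indicator (hbm.comp h1) (measurable_fst (hI n))
    exact h2
  have hprelim : ∀ᶠ n : ℕ in atTop, ∫⁻ p, f n p
      ∂((Measure.pi fun _ : Fin (k + 1) => posVolume).prod posVolume) =
      P n {ω | (fun i : Fin (k + 1) =>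
          (n : ℝ) ^ (1 / a) * revSeq (fun j => X n (σ n ω j) ω) i) ∈ O ∧
        ∀ j, k + 1 ≤ j → j < n →
          M < (n : ℝ) ^ (1 / a) * revSeq (fun j => X n (σ n ω j) ω) j} := by
    filter_upwards [eventually_ge_atTop (k + 1)] with n hn
    have hn' : (0 : ℝ) < n := Nat.cast_pos.2 (by omega)
    rw [(hσ n).measure_last_picks_of_le k.succ_pos hn (hX n) hF (hXF n) (hind n)
      (by positivity) hO.measurableSet M, ← lintegral_indicator hO.measurableSet,
      lintegral_prod _ (hfm n).aemeasurable]
    set g : (Fin (k + 1) → ℝ) → ℝ≥0∞ := fun y => ∫⁻ t, O.indicator (fun y => biasWeight 0 y *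
      ENNReal.ofReal ((∑ i, y i) * Real.exp (-((∑ i, y i) * t)))) y * h n t ∂posVolume with hg
    have hgm : Measurable g := by
      refine Measurable.lintegral_prod_right' (f := fun p : (Fin (k + 1) → ℝ) × ℝ =>
        O.indicator (fun y => biasWeight 0 y *
          ENNReal.ofReal ((∑ i, y i) * Real.exp (-((∑ i, y i) * p.2)))) p.1 * h n p.2) ?_
      exact hbm.mul ((hhm n).comp measurable_snd)
    have hge : ∀ y, O.indicator (fun y => biasWeight 0 y *
        (∫⁻ t, ENNReal.ofReal ((∑ i, y i) * Real.exp (-((∑ i, y i) * t))) *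
          hitMass ((Fn n).restrict (Set.Ioi M)) t ^ (n - (k + 1)) ∂posVolume)) y = g y := by
      intro y
      by_cases hy : y ∈ O
      · simp only [hg, Set.indicator_of_mem hy]
        have hm : Measurable fun t => ENNReal.ofReal ((∑ i, y i) * Real.exp (-((∑ i, y i) * t))) *
            hitMass ((Fn n).restrict (Set.Ioi M)) t ^ (n - (k + 1)) :=
          Measurable.mul (by fun_prop) (hhm n)
        rw [← lintegral_const_mul _ hm]
        exact lintegral_congr fun t => (mul_assoc _ _ _).symm
      · simp [hg, hy]
    have hgi : Measurable ((Set.pi Set.univ fun _ : Fin (k + 1) => Set.Iio (n : ℝ)).indicator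
        fun v => g fun i => (n : ℝ) ^ (1 / a) * Q (v i / n)) :=
      Measurable.indicator (hgm.comp (hqnk n)) (hI n)
    rw [lintegral_congr hge, hQ.lintegral_pi _ hn' _ hgm, ← lintegral_indicator (hI n),
      ← mul_assoc, ← lintegral_const_mul _ hgi]
    refine lintegral_congr fun v => ?_
    by_cases hv : v ∈ Set.pi Set.univ fun _ : Fin (k + 1) => Set.Iio (n : ℝ)
    · simp only [hf, Set.indicator_of_mem hv]
      rw [hg, ← lintegral_const_mul]
      · exact lintegral_congr fun t => mul_assoc _ _ _
      · exact (hbm.comp (measurable_const.prodMk measurable_id)).mul (hhm n)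
    · simp [hf, hv]
  set B : ℝ → ℝ≥0∞ := fun t => ENNReal.ofReal (Real.exp (-(t * M * (A * M ^ a)))) with hB
  have hlim : ∫⁻ z : Fin (k + 1) → ℝ × ℝ, O.indicator (fun _ => B (r * (∑ i, (z i).1) ^ (-(1 / a))))
        (limitPicks a r z) ∂(Measure.pi fun _ => expGamma a) =
      ∫⁻ p : (Fin (k + 1) → ℝ) × ℝ, O.indicator (fun y => limitDensity a r y p.2 * B p.2)
        (fun i => q (p.1 i)) ∂((Measure.pi fun _ : Fin (k + 1) => posVolume).prod posVolume) := by
    have hBm : Measurable B := by fun_prop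
    have hΨ : Measurable (Function.uncurry fun (T : ℝ) (x : Fin (k + 1) → ℝ) =>
        O.indicator (fun _ => B (r * T ^ (-(1 / a)))) x) := by
      have : Measurable ((Prod.snd ⁻¹' O).indicator fun p : ℝ × (Fin (k + 1) → ℝ) =>
          B (r * p.1 ^ (-(1 / a)))) :=
        Measurable.indicator (by fun_prop) (measurable_snd hO.measurableSet)
      exact this
    rw [lintegral_limitPicks ha hr k hΨ, lintegral_prod]
    change ∫⁻ v, ∫⁻ s, limitDensity a r (fun i => q (v i)) s * O.indicator
      (fun _ => B (r * (r ^ a * s ^ (-a)) ^ (-(1 / a)))) (fun i => q (v i)) ∂posVolume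
      ∂(Measure.pi fun _ => posVolume) = _
    · refine lintegral_congr fun v => setLIntegral_congr_fun measurableSet_Ioi fun s hs => ?_
      have hs : 0 < s := hs
      by_cases hv : (fun i => q (v i)) ∈ O
      · have h1 : r * (r ^ a * s ^ (-a)) ^ (-(1 / a)) = s := by
          rw [Real.rpow_neg (by positivity), rpow_limit_time ha hr hs]
          field_simp
        simp only [Set.indicator_of_mem hv, h1]
      · simp only [Set.indicator_of_notMem hv, mul_zero]
    · have hqk : Measurable fun p : (Fin (k + 1) → ℝ) × ℝ =>
          ((fun i => q (p.1 i) : Fin (k + 1) → ℝ), p.2) := by fun_prop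
      have h1 : Measurable ((Prod.fst ⁻¹' O).indicator fun p : (Fin (k + 1) → ℝ) × ℝ =>
          limitDensity a r p.1 p.2 * B p.2) :=
        Measurable.indicator ((measurable_limitDensity measurable_fst measurable_snd).mul
          (by fun_prop)) (measurable_fst hO.measurableSet)
      exact (h1.comp hqk).aemeasurable
  refine hlim.le.trans ?_
  rw [← liminf_congr hprelim]
  refine le_trans (lintegral_mono_ae ?_) (lintegral_liminf_le hfm)
  have hae : ∀ᵐ p ∂((Measure.pi fun _ : Fin (k + 1) => posVolume).prod posVolume),
      (∀ i, 0 < p.1 i) ∧ 0 < p.2 :=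
    (Measure.quasiMeasurePreserving_fst.ae (ae_pi_posVolume (k + 1))).and
      (Measure.quasiMeasurePreserving_snd.ae ae_posVolume)
  filter_upwards [hae] with p hp
  obtain ⟨hv, ht⟩ := hp
  set x : Fin (k + 1) → ℝ := fun i => q (p.1 i) with hx
  have hxpos : ∀ i, 0 < x i := fun i => limitQuantile_pos hApos (hv i)
  have hxlim : ∀ i, Tendsto (fun n => qn n (p.1 i)) atTop (𝓝 (x i)) := fun i =>
    hQ.tendsto ha hApos hF0 (hv i)
  by_cases hxO : x ∈ O
  · rw [Set.indicator_of_mem hxO]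
    have hO' : ∀ᶠ n in atTop, (fun i => qn n (p.1 i)) ∈ O :=
      (tendsto_pi_nhds.2 hxlim).eventually (hO.mem_nhds hxO)
    have hI' : ∀ᶠ n : ℕ in atTop, p.1 ∈ Set.pi Set.univ fun _ : Fin (k + 1) => Set.Iio (n : ℝ) := by
      have : ∀ i, ∀ᶠ n : ℕ in atTop, p.1 i < n := fun i =>
        tendsto_natCast_atTop_atTop.eventually (eventually_gt_atTop _)
      filter_upwards [eventually_all.2 this] with n hn i _ using hn i
    have hu : Tendsto (fun n : ℕ => ((n.descFactorial (k + 1) : ℝ≥0∞) *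
        ENNReal.ofReal (n : ℝ)⁻¹ ^ (k + 1)) * (biasWeight 0 (fun i => qn n (p.1 i)) *
          ENNReal.ofReal ((∑ i, qn n (p.1 i)) * Real.exp (-((∑ i, qn n (p.1 i)) * p.2))))) atTop
        (𝓝 (1 * (biasWeight 0 x * ENNReal.ofReal ((∑ i, x i) * Real.exp (-((∑ i, x i) * p.2)))))) := by
      have hS : Tendsto (fun n => ∑ i, qn n (p.1 i)) atTop (𝓝 (∑ i, x i)) :=
        tendsto_finsetSum _ fun i _ => hxlim i
      have hbtop : biasWeight 0 x ≠ ∞ := ENNReal.prod_ne_top fun i _ => ENNReal.ofReal_ne_top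
      refine ENNReal.Tendsto.mul (tendsto_descFactorial_mul (k + 1))
        (Or.inr (ENNReal.mul_ne_top hbtop ENNReal.ofReal_ne_top))
        (ENNReal.Tendsto.mul (tendsto_biasWeight hxpos hxlim) (Or.inr ENNReal.ofReal_ne_top)
          (ENNReal.tendsto_ofReal (hS.mul (hS.mul_const p.2).neg.rexp)) (Or.inr hbtop))
        (Or.inr ENNReal.one_ne_top)
    have hh := le_liminf_hitMass_pow ha hApos hF hF0 hM ht (k + 1)
    calc limitDensity a r x p.2 * B p.2 = (1 * (biasWeight 0 x *
          ENNReal.ofReal ((∑ i, x i) * Real.exp (-((∑ i, x i) * p.2))))) *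
          ENNReal.ofReal (Real.exp (-(A * Real.Gamma (a + 1) * p.2 ^ (-a) +
            p.2 * M * (A * M ^ a)))) := by
          rw [hAG, neg_add, Real.exp_add, ENNReal.ofReal_mul (Real.exp_pos _).le]
          simp only [limitDensity, hB]
          ring
      _ ≤ _ := mul_le_mul' hu.liminf_eq.ge hh
      _ ≤ _ := ENNReal.le_liminf_mul
      _ ≤ _ := by
        refine (liminf_congr ?_).le
        filter_upwards [hO', hI'] with n h1 h2
        simp only [hf, Set.indicator_of_mem h2, Set.indicator_of_mem h1]
        rfl
  · rw [Set.indicator_of_notMem hxO]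
    exact zero_le

end LimitLaw

/-! ### The limiting sequence of picks -/

/-- Independent i.i.d. sequences of standard exponential and of `gamma(a + 1, 1)` variables. -/
structure IsExpGammaSeq {Ω : Type*} [MeasurableSpace Ω] (P : Measure Ω) (a : ℝ)
    (e g : ℕ → Ω → ℝ) : Prop where
  measurable_exp : ∀ k, Measurable (e k)
  measurable_gamma : ∀ k, Measurable (g k)
  law_exp : ∀ k, HasLaw (e k) (expMeasure 1) P
  law_gamma : ∀ k, HasLaw (g k) (gammaMeasure (a + 1) 1) P
  indep_exp : iIndepFun e P
  indep_gamma : iIndepFun g P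
  indep : IndepFun (fun ω k => e k ω) (fun ω k => g k ω) P

theorem sum_Iic_fin_eq_sum_range {k : ℕ} (e : ℕ → ℝ) (i : Fin k) :
    ∑ j ∈ Finset.Iic i, e j = ∑ j ∈ Finset.range (i + 1), e j := by
  refine Finset.sum_bij (fun j _ => (j : ℕ)) (fun j hj => ?_) (fun _ _ _ _ h => Fin.ext h)
    (fun j hj => ?_) fun _ _ => rfl
  · have : j ≤ i := Finset.mem_Iic.1 hj
    have : (j : ℕ) ≤ i := this
    exact Finset.mem_range.2 (by omega)
  · have := Finset.mem_range.1 hj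
    exact ⟨⟨j, by omega⟩, Finset.mem_Iic.2 (Fin.le_def.2 (by simp; omega)), rfl⟩

theorem limitPicks_eq_limitPick (a r : ℝ) {k : ℕ} (e g : ℕ → ℝ) (i : Fin k) :
    limitPicks a r (fun i : Fin k => (e i, g i)) i = limitPick a r e g i := by
  rw [limitPicks, limitPick, sum_Iic_fin_eq_sum_range]

theorem measurable_limitPick {β : Type*} [MeasurableSpace β] (a r : ℝ) {e g : ℕ → β → ℝ}
    (he : ∀ k, Measurable (e k)) (hg : ∀ k, Measurable (g k)) (k : ℕ) :
    Measurable fun b => limitPick a r (fun i => e i b) (fun i => g i b) k := by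
  unfold limitPick
  fun_prop

theorem expMeasure_Iic_zero : expMeasure 1 (Set.Iic 0) = 0 := by
  have h := lintegral_expMeasure_add (f := (Set.Iic 0).indicator 1)
    (measurable_one.indicator measurableSet_Iic) 0
  simp only [zero_add] at h
  rw [lintegral_indicator_one measurableSet_Iic] at h
  rw [h, setLIntegral_congr_fun (g := fun _ => 0) measurableSet_Ioi fun x hx => ?_]
  · simp
  · have hx : 0 < x := hx
    simp [hx]

theorem gammaMeasure_Iic_le {a : ℝ} (ha : 0 < a) (x : ℝ) :
    gammaMeasure (a + 1) 1 (Set.Iic x) ≤ ENNReal.ofReal (x ^ (a + 1) / Real.Gamma (a + 1)) := by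
  have hG : 0 < Real.Gamma (a + 1) := Real.Gamma_pos_of_pos (by linarith)
  rw [← lintegral_indicator_one measurableSet_Iic, lintegral_gammaMeasure (a + 1)
    (measurable_one.indicator measurableSet_Iic)]
  calc _ ≤ ∫⁻ y in Set.Ioi 0, (Set.Ioc 0 x).indicator
        (fun _ => ENNReal.ofReal (x ^ a / Real.Gamma (a + 1))) y := by
        refine setLIntegral_mono' measurableSet_Ioi fun y hy => ?_
        have hy : 0 < y := hy
        by_cases hyx : y ≤ x
        · rw [Set.indicator_of_mem (show y ∈ Set.Iic x from hyx), Pi.one_apply, mul_one,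
            Set.indicator_of_mem (show y ∈ Set.Ioc 0 x from ⟨hy, hyx⟩)]
          refine ENNReal.ofReal_le_ofReal ?_
          have h1 : y ^ (a + 1 - 1) ≤ x ^ a := by
            rw [add_sub_cancel_right]
            exact Real.rpow_le_rpow hy.le hyx ha.le
          have h2 : Real.exp (-y) ≤ 1 := Real.exp_le_one_iff.2 (by linarith)
          gcongr
          calc _ ≤ x ^ a * 1 := mul_le_mul h1 h2 (Real.exp_pos _).le
                (Real.rpow_nonneg (hy.le.trans hyx) _)
            _ = _ := mul_one _
        · rw [Set.indicator_of_notMem (show y ∉ Set.Iic x from hyx), mul_zero]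
          exact zero_le
    _ ≤ ∫⁻ y, (Set.Ioc 0 x).indicator
        (fun _ => ENNReal.ofReal (x ^ a / Real.Gamma (a + 1))) y :=
        lintegral_mono' Measure.restrict_le_self le_rfl
    _ ≤ _ := by
        rw [lintegral_indicator_const measurableSet_Ioc, Real.volume_Ioc, sub_zero]
        rcases le_or_gt x 0 with h | h
        · rw [ENNReal.ofReal_of_nonpos h, mul_zero]
          exact zero_le
        · rw [← ENNReal.ofReal_mul (by positivity), Real.rpow_add_one h.ne']
          exact ENNReal.ofReal_le_ofReal (by rw [div_mul_eq_mul_div])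

theorem limitQuantile_injOn {a A : ℝ} (ha : 0 < a) (hA : 0 < A) :
    Set.InjOn (limitQuantile a A) (Set.Ici 0) := by
  intro v hv w hw h
  have hv : 0 ≤ v := hv
  have hw : 0 ≤ w := hw
  have := (Real.rpow_left_inj (by positivity) (by positivity) (by positivity)).1 h
  exact (div_left_inj' hA.ne').1 this

theorem ae_injective_pi_posVolume (k : ℕ) :
    ∀ᵐ v ∂(Measure.pi fun _ : Fin k => posVolume), ∀ i j, i ≠ j → v i ≠ v j := by
  have hle : (Measure.pi fun _ : Fin k => posVolume) ≪ volume := by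
    have : (Measure.pi fun _ : Fin k => posVolume) =
        volume.restrict (Set.pi Set.univ fun _ => Set.Ioi 0) :=
      (Measure.restrict_pi_pi (fun _ : Fin k => (volume : Measure ℝ)) _).symm
    rw [this]
    exact Measure.restrict_le_self.absolutelyContinuous
  refine hle.ae_le ?_
  refine ae_all_iff.2 fun i => ae_all_iff.2 fun j => ?_
  by_cases hij : i = j
  · simp [hij]
  have hne : LinearMap.ker (LinearMap.proj (R := ℝ) (φ := fun _ : Fin k => ℝ) i - LinearMap.proj j) ≠
      ⊤ := by
    intro htop
    have : (Pi.single i 1 : Fin k → ℝ) ∈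
        LinearMap.ker (LinearMap.proj (R := ℝ) (φ := fun _ : Fin k => ℝ) i - LinearMap.proj j) := by
      rw [htop]
      trivial
    simp [Ne.symm hij] at this
  have h0 := Measure.addHaar_submodule volume _ hne
  rw [ae_iff]
  refine measure_mono_null (fun v hv => ?_) h0
  have hv : ¬(i ≠ j → v i ≠ v j) := hv
  have : v i = v j := by
    by_contra hc
    exact hv fun _ => hc
  simp [this]

namespace IsExpGammaSeq

variable {Ω : Type*} [MeasurableSpace Ω] {P : Measure Ω} {a r : ℝ}
  {e g : ℕ → Ω → ℝ}

theorem measurable_pair (h : IsExpGammaSeq P a e g) (k : ℕ) :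
    Measurable fun ω (i : Fin k) => (e i ω, g i ω) :=
  measurable_pi_iff.2 fun i => (h.measurable_exp i).prodMk (h.measurable_gamma i)

theorem ae_pos_exp (h : IsExpGammaSeq P a e g) : ∀ᵐ ω ∂P, ∀ k, 0 < e k ω := by
  refine ae_all_iff.2 fun k => ?_
  have h1 := (h.law_exp k).measure_eq (p := fun x => x ≤ 0) measurableSet_Iic
  rw [ae_iff]
  simp only [not_lt]
  rw [h1]
  exact expMeasure_Iic_zero

variable [IsProbabilityMeasure P]

theorem map_exp_eq (h : IsExpGammaSeq P a e g) (k : ℕ) :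
    P.map (fun ω (i : Fin k) => e i ω) = Measure.pi fun _ => expMeasure 1 := by
  rw [(iIndepFun_iff_map_fun_eq_pi_map fun i : Fin k => (h.measurable_exp i).aemeasurable).1
    (h.indep_exp.precomp Fin.val_injective)]
  congr
  funext i
  exact (h.law_exp i).map_eq

theorem map_eq (ha : 0 < a) (h : IsExpGammaSeq P a e g) (k : ℕ) :
    P.map (fun ω (i : Fin k) => (e i ω, g i ω)) = Measure.pi fun _ => expGamma a := by
  have := isProbabilityMeasure_gammaMeasure (show 0 < a + 1 by linarith) one_pos
  have := isProbabilityMeasure_expMeasure one_pos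
  have hme : Measurable fun ω (i : Fin k) => e i ω := measurable_pi_iff.2 fun i => h.measurable_exp i
  have hmg : Measurable fun ω (i : Fin k) => g i ω :=
    measurable_pi_iff.2 fun i => h.measurable_gamma i
  have hg : P.map (fun ω (i : Fin k) => g i ω) = Measure.pi fun _ => gammaMeasure (a + 1) 1 := by
    rw [(iIndepFun_iff_map_fun_eq_pi_map fun i : Fin k => (h.measurable_gamma i).aemeasurable).1
      (h.indep_gamma.precomp Fin.val_injective)]
    congr
    funext i
    exact (h.law_gamma i).map_eq
  have hind : IndepFun (fun ω (i : Fin k) => e i ω) (fun ω (i : Fin k) => g i ω) P :=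
    h.indep.comp (φ := fun (x : ℕ → ℝ) (i : Fin k) => x i)
      (ψ := fun (x : ℕ → ℝ) (i : Fin k) => x i) (by fun_prop) (by fun_prop)
  have hprod := (indepFun_iff_map_prod_eq_prod_map_map hme.aemeasurable hmg.aemeasurable).1 hind
  rw [h.map_exp_eq, hg] at hprod
  have hmp := (measurePreserving_arrowProdEquivProdArrow ℝ ℝ (Fin k) (fun _ => expMeasure 1)
    (fun _ => gammaMeasure (a + 1) 1)).symm
  rw [← hmp.map_eq, ← hprod, Measure.map_map hmp.measurable (hme.prodMk hmg)]
  rfl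

theorem lintegral_comp (ha : 0 < a) (h : IsExpGammaSeq P a e g) (k : ℕ)
    {Ψ : ℝ → (Fin k → ℝ) → ℝ≥0∞} (hΨ : Measurable (Function.uncurry Ψ)) :
    ∫⁻ ω, Ψ (∑ i ∈ Finset.range k, e i ω)
        (fun i => limitPick a r (fun i => e i ω) (fun i => g i ω) i) ∂P =
      ∫⁻ z, Ψ (∑ i, (z i).1) (limitPicks a r z) ∂(Measure.pi fun _ => expGamma a) := by
  have hs : Measurable fun z : Fin k → ℝ × ℝ => ∑ i, (z i).1 := by fun_prop
  have hm : Measurable fun z : Fin k → ℝ × ℝ => Ψ (∑ i, (z i).1) (limitPicks a r z) :=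
    hΨ.comp (Measurable.prodMk hs (measurable_limitPicks a r))
  rw [← h.map_eq ha k, lintegral_map hm (h.measurable_pair k)]
  refine lintegral_congr fun ω => ?_
  congr 1
  · exact Finset.sum_range _
  · funext i
    exact (limitPicks_eq_limitPick a r _ _ i).symm

theorem ae_injOn_and_pos (ha : 0 < a) (hr : 0 < r) (h : IsExpGammaSeq P a e g) (k : ℕ) :
    ∀ᵐ ω ∂P, (∀ i : Fin (k + 1), 0 < limitPick a r (fun i => e i ω) (fun i => g i ω) i) ∧
      ∀ i j : Fin (k + 1), i ≠ j → limitPick a r (fun i => e i ω) (fun i => g i ω) i ≠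
        limitPick a r (fun i => e i ω) (fun i => g i ω) j := by
  have hG : 0 < Real.Gamma (a + 1) := Real.Gamma_pos_of_pos (by linarith)
  have hA : 0 < limitConst a r := by positivity
  set B : Set (Fin (k + 1) → ℝ) := {x | (∀ i, 0 < x i) ∧ ∀ i j, i ≠ j → x i ≠ x j} with hB
  have hBm : MeasurableSet B := by
    have : B = (⋂ i, {x | 0 < x i}) ∩ ⋂ i, ⋂ j, ⋂ _ : i ≠ j, {x | x i = x j}ᶜ := by
      ext x
      simp [hB]
    rw [this]
    refine (MeasurableSet.iInter fun i => measurableSet_lt measurable_const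
      (measurable_pi_apply i)).inter (MeasurableSet.iInter fun i => MeasurableSet.iInter fun j =>
        MeasurableSet.iInter fun _ => (measurableSet_eq_fun (measurable_pi_apply i)
          (measurable_pi_apply j)).compl)
  have hdiag := ae_injective_pi_posVolume (k + 1)
  have hΨ : Measurable (Function.uncurry fun (_ : ℝ) (x : Fin (k + 1) → ℝ) =>
      Bᶜ.indicator (1 : (Fin (k + 1) → ℝ) → ℝ≥0∞) x) :=
    (measurable_one.indicator hBm.compl).comp measurable_snd
  have h1 := h.lintegral_comp (r := r) ha (k + 1) hΨ
  rw [lintegral_limitPicks ha hr k hΨ] at h1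
  have h2 : ∫⁻ ω, Bᶜ.indicator (1 : (Fin (k + 1) → ℝ) → ℝ≥0∞)
      (fun i => limitPick a r (fun i => e i ω) (fun i => g i ω) i) ∂P = 0 := by
    rw [h1, lintegral_congr_ae (g := fun _ => 0)]
    · simp
    filter_upwards [hdiag, ae_pi_posVolume (k + 1)] with v hv hpos
    have hmem : (fun i => limitQuantile a (limitConst a r) (v i)) ∈ B := by
      refine ⟨fun i => limitQuantile_pos hA (hpos i), fun i j hij heq => ?_⟩
      exact hv i j hij (limitQuantile_injOn ha hA (hpos i).le (hpos j).le heq)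
    simp [Set.indicator_of_notMem, hmem]
  have hξm : Measurable fun ω (i : Fin (k + 1)) =>
      limitPick a r (fun i => e i ω) (fun i => g i ω) i :=
    measurable_pi_iff.2 fun i => measurable_limitPick a r h.measurable_exp h.measurable_gamma i
  have h3 := (lintegral_eq_zero_iff ((measurable_one.indicator hBm.compl).comp hξm)).1 h2
  filter_upwards [h3] with ω hω
  by_contra hc
  have : (fun i : Fin (k + 1) => limitPick a r (fun i => e i ω) (fun i => g i ω) i) ∈ Bᶜ := hc
  simp [Set.indicator_of_mem this] at hω

theorem ae_injective_and_pos (ha : 0 < a) (hr : 0 < r) (h : IsExpGammaSeq P a e g) :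
    ∀ᵐ ω ∂P, (∀ i, 0 < limitPick a r (fun i => e i ω) (fun i => g i ω) i) ∧
      Function.Injective (limitPick a r (fun i => e i ω) (fun i => g i ω)) := by
  filter_upwards [ae_all_iff.2 (h.ae_injOn_and_pos ha hr)] with ω hω
  refine ⟨fun i => (hω i).1 (Fin.last i), fun i j hij => ?_⟩
  by_contra hne
  exact (hω (max i j)).2 ⟨i, by omega⟩ ⟨j, by omega⟩ (by simpa using hne) hij

/-- The times of the limit grow linearly. -/
theorem exists_ae_eventually_le_sum (h : IsExpGammaSeq P a e g) :
    ∃ c : ℝ, 0 < c ∧ ∀ᵐ ω ∂P, ∀ᶠ k : ℕ in atTop,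
      c * (k + 1 : ℕ) ≤ ∑ i ∈ Finset.range (k + 1), e i ω := by
  have hm : ∀ i, Measurable fun ω => min (e i ω) 1 := fun i =>
    (h.measurable_exp i).min measurable_const
  have hpos := h.ae_pos_exp
  have hint : Integrable (fun ω => min (e 0 ω) 1) P := by
    refine Integrable.of_bound (hm 0).aestronglyMeasurable 1 ?_
    filter_upwards [hpos] with ω hω
    rw [Real.norm_of_nonneg (le_min (hω 0).le zero_le_one)]
    exact min_le_right _ _
  have hmean : 0 < ∫ ω, min (e 0 ω) 1 ∂P := by
    have hsupp : ∀ᵐ ω ∂P, ω ∈ Function.support fun ω => min (e 0 ω) 1 := by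
      filter_upwards [hpos] with ω hω
      exact (lt_min (hω 0) one_pos).ne'
    rw [integral_pos_iff_support_of_nonneg_ae]
    · have h1 : Function.support (fun ω => min (e 0 ω) 1) =ᵐ[P] Set.univ :=
        eventuallyEq_univ.2 hsupp
      rw [measure_congr h1, measure_univ]
      exact one_pos
    · filter_upwards [hpos] with ω hω
      exact le_min (hω 0).le zero_le_one
    · exact hint
  have hlln := strong_law_ae_real (μ := P) (fun i ω => min (e i ω) 1) hint
    (fun i j hij => (h.indep_exp.indepFun hij).comp (φ := fun x => min x 1)
      (ψ := fun x => min x 1) (by fun_prop) (by fun_prop))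
    (fun i => by
      have : IdentDistrib (e i) (e 0) P P :=
        ⟨(h.measurable_exp i).aemeasurable, (h.measurable_exp 0).aemeasurable, by
          rw [(h.law_exp i).map_eq, (h.law_exp 0).map_eq]⟩
      exact this.comp (u := fun x => min x 1) (by fun_prop))
  set μ := ∫ ω, min (e 0 ω) 1 ∂P
  refine ⟨μ / 2, by positivity, ?_⟩
  filter_upwards [hlln, hpos] with ω hω hp
  have h1 := (hω.comp (tendsto_add_atTop_nat 1)).eventually (lt_mem_nhds (half_lt_self hmean))
  filter_upwards [h1] with k hk
  have hk' : (0 : ℝ) < ((k + 1 : ℕ) : ℝ) := by positivity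
  have := (lt_div_iff₀ hk').1 hk
  refine this.le.trans (Finset.sum_le_sum fun i _ => min_le_left _ _)

theorem ae_tendsto_sum (h : IsExpGammaSeq P a e g) :
    ∀ᵐ ω ∂P, Tendsto (fun k => ∑ i ∈ Finset.range (k + 1), e i ω) atTop atTop := by
  obtain ⟨c, hc, hae⟩ := h.exists_ae_eventually_le_sum
  filter_upwards [hae] with ω hω
  refine tendsto_atTop_mono' atTop hω ?_
  exact ((tendsto_natCast_atTop_atTop.comp (tendsto_add_atTop_nat 1)).const_mul_atTop hc)

theorem ae_tendsto_limitPick (ha : 0 < a) (hr : 0 < r) (h : IsExpGammaSeq P a e g) :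
    ∀ᵐ ω ∂P, Tendsto (limitPick a r (fun i => e i ω) (fun i => g i ω)) atTop atTop := by
  obtain ⟨c, hc, hae⟩ := h.exists_ae_eventually_le_sum
  have hG : 0 < Real.Gamma (a + 1) := Real.Gamma_pos_of_pos (by linarith)
  have hBC : ∀ M : ℕ, ∀ᵐ ω ∂P, ∀ᶠ k : ℕ in atTop,
      M * r / (c * (k + 1 : ℕ)) ^ (1 / a) < g k ω := by
    intro M
    have hsum : ∑' k : ℕ, P {ω | g k ω ≤ M * r / (c * (k + 1 : ℕ)) ^ (1 / a)} ≠ ∞ := by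
      set C : ℝ := (M * r) ^ (a + 1) * c ^ (-(1 / a * (a + 1))) / Real.Gamma (a + 1)
      have hle : ∀ k : ℕ, P {ω | g k ω ≤ M * r / (c * (k + 1 : ℕ)) ^ (1 / a)} ≤
          ENNReal.ofReal (C * ((k + 1 : ℕ) : ℝ) ^ (-(1 + 1 / a))) := by
        intro k
        have hk' : (0 : ℝ) < ((k + 1 : ℕ) : ℝ) := by positivity
        rw [(h.law_gamma k).measure_eq (p := fun x => x ≤ M * r / (c * (k + 1 : ℕ)) ^ (1 / a))
          measurableSet_Iic]
        refine (gammaMeasure_Iic_le ha _).trans (ENNReal.ofReal_le_ofReal (le_of_eq ?_))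
        rw [Real.div_rpow (by positivity) (by positivity), ← Real.rpow_mul (by positivity),
          Real.mul_rpow hc.le hk'.le, show -(1 + 1 / a) = -(1 / a * (a + 1)) by field_simp,
          Real.rpow_neg hk'.le]
        simp only [C]
        rw [Real.rpow_neg hc.le]
        field_simp
      have hs : Summable fun k : ℕ => C * ((k + 1 : ℕ) : ℝ) ^ (-(1 + 1 / a)) := by
        refine Summable.mul_left C ?_
        refine (summable_nat_add_iff (f := fun k : ℕ => (k : ℝ) ^ (-(1 + 1 / a))) 1).2 ?_
        rw [Real.summable_nat_rpow]
        have : 0 < 1 / a := by positivity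
        linarith
      exact ne_top_of_le_ne_top hs.tsum_ofReal_ne_top (ENNReal.tsum_le_tsum hle)
    filter_upwards [ae_eventually_notMem hsum] with ω hω
    filter_upwards [hω] with k hk
    exact not_le.1 hk
  filter_upwards [hae, ae_all_iff.2 hBC] with ω h1 h2
  refine tendsto_atTop.2 fun b => ?_
  obtain ⟨M, hM⟩ := exists_nat_ge b
  filter_upwards [h1, h2 M] with k hk1 hk2
  have hk' : (0 : ℝ) < c * ((k + 1 : ℕ) : ℝ) := by positivity
  rw [limitPick, le_div_iff₀ hr]
  have h3 : (c * ((k + 1 : ℕ) : ℝ)) ^ (1 / a) ≤ (∑ i ∈ Finset.range (k + 1), e i ω) ^ (1 / a) :=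
    Real.rpow_le_rpow hk'.le hk1 (by positivity)
  have h4 := (div_lt_iff₀ (by positivity)).1 hk2
  have h5 : 0 ≤ g k ω := le_trans (by positivity) hk2.le
  calc b * r ≤ M * r := by gcongr
    _ ≤ g k ω * (c * ((k + 1 : ℕ) : ℝ)) ^ (1 / a) := h4.le
    _ ≤ g k ω * (∑ i ∈ Finset.range (k + 1), e i ω) ^ (1 / a) := by gcongr
    _ = _ := mul_comm _ _

end IsExpGammaSeq

/-! ### Order statistics and ranks of real sequences -/

open scoped Classical in
theorem card_filter_castLE {K n : ℕ} (hKn : K ≤ n) {p : Fin n → Prop}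
    (h : ∀ j : Fin n, K ≤ j → ¬p j) :
    (Finset.univ.filter p).card =
      (Finset.univ.filter fun i : Fin K => p (Fin.castLE hKn i)).card := by
  symm
  refine Finset.card_bij (fun i _ => Fin.castLE hKn i) (fun i hi => by simpa using hi)
    (fun i _ j _ hij => Fin.castLE_injective hKn hij) fun j hj => ?_
  have hj : p j := by simpa using hj
  have hjK : (j : ℕ) < K := not_le.1 fun hc => h j hc hj
  exact ⟨⟨j, hjK⟩, by simpa using hj, rfl⟩

open scoped Classical in
theorem encard_eq_card_filter {K : ℕ} {p : ℕ → Prop} (h : ∀ j, K ≤ j → ¬p j) :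
    {i | p i}.encard = (Finset.univ.filter fun i : Fin K => p i).card := by
  have h1 : {i | p i} = ((Finset.univ.filter fun i : Fin K => p i).map Fin.valEmbedding : Set ℕ) := by
    ext j
    simp only [Finset.coe_map, Finset.coe_filter, Finset.mem_univ, true_and, Set.mem_image]
    constructor
    · intro hj
      have hj : p j := hj
      exact ⟨⟨j, not_le.1 fun hc => h j hc hj⟩, hj, rfl⟩
    · rintro ⟨i, hi, rfl⟩
      exact hi
  rw [h1, Set.encard_coe_eq_coe_finsetCard, Finset.card_map]

section FinOrderStat

variable {n : ℕ} (x : Fin n → ℝ) {k : ℕ}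

theorem finOrderStat_of_lt (h : k < n) : finOrderStat x k = x (Tuple.sort x ⟨k, h⟩) := by
  rw [finOrderStat, dif_pos h]

open scoped Classical in
theorem card_comp_perm (π : Equiv.Perm (Fin n)) (p : Fin n → Prop) :
    (Finset.univ.filter fun i => p (π i)).card = (Finset.univ.filter p).card :=
  Finset.card_bij (fun i _ => π i) (fun i hi => by simpa using hi)
    (fun i _ j _ hij => π.injective hij)
    fun j hj => ⟨π.symm j, by simpa using hj, by simp⟩

open scoped Classical in
theorem finOrderStat_le_iff (h : k < n) {t : ℝ} :
    finOrderStat x k ≤ t ↔ k < (Finset.univ.filter fun i => x i ≤ t).card := by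
  rw [finOrderStat_of_lt x h, ← card_comp_perm (Tuple.sort x) fun i => x i ≤ t]
  have hm : Monotone fun i => x (Tuple.sort x i) := Tuple.monotone_sort x
  constructor
  · intro hle
    have : Finset.Iic (⟨k, h⟩ : Fin n) ⊆ Finset.univ.filter fun i => x (Tuple.sort x i) ≤ t := by
      intro i hi
      simpa using (hm (Finset.mem_Iic.1 hi)).trans hle
    have := Finset.card_le_card this
    rw [Fin.card_Iic] at this
    exact this
  · intro hlt
    by_contra hc
    have : (Finset.univ.filter fun i => x (Tuple.sort x i) ≤ t) ⊆ Finset.Iio (⟨k, h⟩ : Fin n) := by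
      intro i hi
      have hi : x (Tuple.sort x i) ≤ t := by simpa using hi
      rw [Finset.mem_Iio]
      by_contra hki
      exact hc ((hm (not_lt.1 hki)).trans hi)
    have := Finset.card_le_card this
    rw [Fin.card_Iio] at this
    exact absurd hlt (not_lt.2 this)

open scoped Classical in
theorem finOrderStat_lt_iff (h : k < n) {t : ℝ} :
    finOrderStat x k < t ↔ k < (Finset.univ.filter fun i => x i < t).card := by
  rw [finOrderStat_of_lt x h, ← card_comp_perm (Tuple.sort x) fun i => x i < t]
  have hm : Monotone fun i => x (Tuple.sort x i) := Tuple.monotone_sort x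
  constructor
  · intro hle
    have : Finset.Iic (⟨k, h⟩ : Fin n) ⊆ Finset.univ.filter fun i => x (Tuple.sort x i) < t := by
      intro i hi
      simpa using (hm (Finset.mem_Iic.1 hi)).trans_lt hle
    have := Finset.card_le_card this
    rw [Fin.card_Iic] at this
    exact this
  · intro hlt
    by_contra hc
    have : (Finset.univ.filter fun i => x (Tuple.sort x i) < t) ⊆ Finset.Iio (⟨k, h⟩ : Fin n) := by
      intro i hi
      have hi : x (Tuple.sort x i) < t := by simpa using hi
      rw [Finset.mem_Iio]
      by_contra hki
      exact hc ((hm (not_lt.1 hki)).trans_lt hi)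
    have := Finset.card_le_card this
    rw [Fin.card_Iio] at this
    exact absurd hlt (not_lt.2 this)

open scoped Classical in
theorem finOrderStat_eq_iff (h : k < n) {v : ℝ} :
    finOrderStat x k = v ↔ (Finset.univ.filter fun i => x i < v).card ≤ k ∧
      k < (Finset.univ.filter fun i => x i ≤ v).card := by
  rw [← finOrderStat_le_iff x h, ← not_lt, ← finOrderStat_lt_iff x h, not_lt, and_comm]
  exact le_antisymm_iff

theorem finOrderStat_comp_perm (π : Equiv.Perm (Fin n)) (k : ℕ) :
    finOrderStat (fun i => x (π i)) k = finOrderStat x k := by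
  classical
  by_cases h : k < n
  · rw [finOrderStat_eq_iff _ h, card_comp_perm π fun i => x i < finOrderStat x k,
      card_comp_perm π fun i => x i ≤ finOrderStat x k]
    exact (finOrderStat_eq_iff x h).1 rfl
  · simp [finOrderStat, h]

theorem finOrderStat_const_mul {c : ℝ} (hc : 0 < c) (k : ℕ) :
    finOrderStat (fun i => c * x i) k = c * finOrderStat x k := by
  classical
  by_cases h : k < n
  · rw [finOrderStat_eq_iff _ h]
    simp only [mul_lt_mul_iff_right₀ hc, mul_le_mul_iff_right₀ hc]
    exact (finOrderStat_eq_iff x h).1 rfl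
  · simp [finOrderStat, h]

theorem measurable_finOrderStat (n k : ℕ) :
    Measurable fun x : Fin n → ℝ => finOrderStat x k := by
  classical
  by_cases h : k < n
  · refine measurable_of_Iic fun t => ?_
    have : (fun x : Fin n → ℝ => finOrderStat x k) ⁻¹' Set.Iic t =
        ⋃ (S : Finset (Fin n)) (_ : k < S.card), ⋂ i ∈ S, {x | x i ≤ t} := by
      ext x
      simp only [Set.mem_preimage, Set.mem_Iic, finOrderStat_le_iff x h, Set.mem_iUnion,
        Set.mem_iInter]
      constructor
      · exact fun hk => ⟨_, hk, fun i hi => (Finset.mem_filter.1 hi).2⟩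
      · rintro ⟨S, hS, hx⟩
        exact hS.trans_le (Finset.card_le_card fun i hi => by simpa using hx i hi)
    rw [this]
    exact MeasurableSet.iUnion fun S => MeasurableSet.iUnion fun _ =>
      Finset.measurableSet_biInter _ fun i _ =>
        measurableSet_le (measurable_pi_apply i) measurable_const
  · simp [finOrderStat, h]

end FinOrderStat

open scoped Classical in
/-- The order statistic, the term and the rank of the term at position `k` of a finite sequence. -/
noncomputable def finTriple {n : ℕ} (x : Fin n → ℝ) (k : ℕ) : ℝ × ℝ × ℕ :=
  if h : k < n then
    (finOrderStat x k, x ⟨k, h⟩, (Finset.univ.filter fun i => x i < x ⟨k, h⟩).card)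
  else 0

open scoped Classical in
theorem finTriple_of_lt {n : ℕ} (x : Fin n → ℝ) {k : ℕ} (h : k < n) : finTriple x k =
    (finOrderStat x k, x ⟨k, h⟩, (Finset.univ.filter fun i => x i < x ⟨k, h⟩).card) := by
  rw [finTriple, dif_pos h]

theorem measurable_finTriple (n k : ℕ) : Measurable fun x : Fin n → ℝ => finTriple x k := by
  classical
  by_cases h : k < n
  · simp only [finTriple_of_lt _ h]
    refine (measurable_finOrderStat n k).prodMk ((measurable_pi_apply _).prodMk ?_)
    simp only [Finset.card_filter]
    exact Finset.measurable_fun_sum _ fun i _ => Measurable.ite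
      (measurableSet_lt (measurable_pi_apply i) (measurable_pi_apply _))
      measurable_const measurable_const
  · simp [finTriple, h]

/-- Near a sequence of distinct terms, the data depend continuously on the sequence. -/
theorem exists_isOpen_finTriple_continuousOn {n : ℕ} {x : Fin n → ℝ} (hx : Function.Injective x) :
    ∃ U : Set (Fin n → ℝ), IsOpen U ∧ x ∈ U ∧ (∀ y ∈ U, Function.Injective y) ∧
      ∀ k, ContinuousOn (fun y => finTriple y k) U := by
  classical
  set U : Set (Fin n → ℝ) := ⋂ (i) (j) (_ : x i < x j), {y | y i < y j} with hU
  have hmem : ∀ y, y ∈ U ↔ ∀ i j, x i < x j → y i < y j := fun y => by simp [hU]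
  have hiff : ∀ y ∈ U, ∀ i j, y i < y j ↔ x i < x j := by
    intro y hy i j
    refine ⟨fun hlt => ?_, (hmem y).1 hy i j⟩
    by_contra hc
    rcases (not_lt.1 hc).lt_or_eq with h | h
    · exact absurd hlt (not_lt.2 ((hmem y).1 hy _ _ h).le)
    · rw [hx h] at hlt
      exact lt_irrefl _ hlt
  have hinj : ∀ y ∈ U, Function.Injective y := by
    intro y hy i j hij
    by_contra hne
    rcases lt_or_gt_of_ne (fun he => hne (hx he)) with h | h
    · exact ((hmem y).1 hy _ _ h).ne hij
    · exact ((hmem y).1 hy _ _ h).ne' hij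
  refine ⟨U, ?_, (hmem x).2 fun i j h => h, hinj, fun k => ?_⟩
  · refine isOpen_iInter_of_finite fun i => isOpen_iInter_of_finite fun j =>
      isOpen_iInter_of_finite fun _ => isOpen_lt (continuous_apply i) (continuous_apply j)
  by_cases h : k < n
  · refine ContinuousOn.congr (f := fun y => (y (Tuple.sort x ⟨k, h⟩), y ⟨k, h⟩,
      (Finset.univ.filter fun i => x i < x ⟨k, h⟩).card)) (by fun_prop) fun y hy => ?_
    simp only [finTriple_of_lt _ h, hiff y hy]
    rw [finOrderStat_of_lt y h]
    have hmono : Monotone (y ∘ Tuple.sort x) := by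
      intro i j hij
      by_contra hc
      have h1 := (hiff y hy _ _).1 (not_le.1 hc)
      exact absurd h1 (not_lt.2 (Tuple.monotone_sort x hij))
    have := congrFun (Tuple.comp_sort_eq_comp_iff_monotone.2 hmono) ⟨k, h⟩
    simp only [Function.comp_apply] at this
    rw [this]
  · simp only [finTriple, h, dite_false]
    exact continuousOn_const

/-- The sequences of distinct terms whose data at `I` are below the level `M` and lie in `G`. -/
def tripleSet (I : Finset ℕ) (G : Set (I → ℝ × ℝ × ℕ)) (M : ℝ) (n : ℕ) : Set (Fin n → ℝ) :=
  {x | Function.Injective x ∧ (∀ k : I, (k : ℕ) < n ∧ (finTriple x k).1 < M ∧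
    (finTriple x k).2.1 < M) ∧ (fun k : I => finTriple x k) ∈ G}

theorem isOpen_tripleSet (I : Finset ℕ) {G : Set (I → ℝ × ℝ × ℕ)} (hG : IsOpen G) (M : ℝ)
    (n : ℕ) : IsOpen (tripleSet I G M n) := by
  refine isOpen_iff_mem_nhds.2 fun x hx => ?_
  obtain ⟨hxinj, hxM, hxG⟩ := hx
  obtain ⟨U, hU, hxU, hinj, hc⟩ := exists_isOpen_finTriple_continuousOn hxinj
  have hcx : ∀ k, ContinuousAt (fun y => finTriple y k) x := fun k =>
    (hc k).continuousAt (hU.mem_nhds hxU)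
  have h1 : ∀ᶠ y in 𝓝 x, ∀ k : I, (finTriple y k).1 < M := by
    refine eventually_all.2 fun k => (hcx k).fst.eventually (gt_mem_nhds (hxM k).2.1)
  have h2 : ∀ᶠ y in 𝓝 x, ∀ k : I, (finTriple y k).2.1 < M := by
    refine eventually_all.2 fun k => (hcx k).snd.fst.eventually (gt_mem_nhds (hxM k).2.2)
  have h3 : ∀ᶠ y in 𝓝 x, (fun k : I => finTriple y k) ∈ G := by
    have : ContinuousAt (fun y (k : I) => finTriple y k) x :=
      continuousAt_pi.2 fun k => hcx k
    exact this.eventually (hG.mem_nhds hxG)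
  filter_upwards [hU.mem_nhds hxU, h1, h2, h3] with y hy hy1 hy2 hy3
  exact ⟨hinj y hy, fun k => ⟨(hxM k).1, hy1 k, hy2 k⟩, hy3⟩

/-- The data of a sequence are those of an initial segment, if all later terms are large. -/
theorem finTriple_castLE {K n : ℕ} (hKn : K ≤ n) {y : Fin n → ℝ} {M : ℝ}
    (hM : ∀ j : Fin n, K ≤ j → M < y j) {k : ℕ} (hk : k < K)
    (h1 : (finTriple (fun i : Fin K => y (Fin.castLE hKn i)) k).1 < M)
    (h2 : (finTriple (fun i : Fin K => y (Fin.castLE hKn i)) k).2.1 < M) :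
    finTriple y k = finTriple (fun i : Fin K => y (Fin.castLE hKn i)) k := by
  classical
  set x : Fin K → ℝ := fun i => y (Fin.castLE hKn i) with hx
  rw [finTriple_of_lt _ hk] at h1 h2 ⊢
  rw [finTriple_of_lt _ (hk.trans_le hKn)]
  have h2 : y ⟨k, hk.trans_le hKn⟩ < M := h2
  have h1 : finOrderStat x k < M := h1
  have hlt : ∀ v < M, (Finset.univ.filter fun i => y i < v).card =
      (Finset.univ.filter fun i => x i < v).card := fun v hv =>
    card_filter_castLE hKn fun j hj => not_lt.2 (hv.trans (hM j hj)).le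
  have hle : ∀ v < M, (Finset.univ.filter fun i => y i ≤ v).card =
      (Finset.univ.filter fun i => x i ≤ v).card := fun v hv =>
    card_filter_castLE hKn fun j hj => not_le.2 (hv.trans (hM j hj))
  refine Prod.ext ?_ (Prod.ext rfl (hlt _ h2))
  change finOrderStat y k = finOrderStat x k
  rw [finOrderStat_eq_iff y (hk.trans_le hKn), hlt _ h1, hle _ h1]
  exact (finOrderStat_eq_iff x hk).1 rfl

/-- A term that differs from the others determines its rank. -/
theorem eq_card_of_finOrderStat_eq {n : ℕ} {y : Fin n → ℝ} {k : Fin n} {j : ℕ} (hj : j < n)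
    (hk : ∀ i, y i = y k → i = k) (h : y k = finOrderStat y j) :
    j = (Finset.univ.filter fun i => y i < y k).card := by
  classical
  have h1 := (finOrderStat_eq_iff y hj).1 h.symm
  have h2 : (Finset.univ.filter fun i => y i ≤ y k) =
      insert k (Finset.univ.filter fun i => y i < y k) := by
    ext i
    simp only [Finset.mem_filter, Finset.mem_univ, true_and, Finset.mem_insert]
    refine ⟨fun hi => hi.lt_or_eq.symm.imp_left (hk i), ?_⟩
    rintro (rfl | hi)
    · exact le_rfl
    · exact hi.le
  rw [h2, Finset.card_insert_of_notMem (by simp)] at h1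
  convert (show j = (Finset.univ.filter fun i => y i < y k).card by omega)

/-- The rank, counted from `0`, of the term `x k` of an infinite sequence. -/
noncomputable def seqRank (x : ℕ → ℝ) (k : ℕ) : ℕ := {i | x i < x k}.ncard

section SeqOrderStat

variable {x : ℕ → ℝ}

theorem finite_setOf_le (ht : Tendsto x atTop atTop) (t : ℝ) : {i | x i ≤ t}.Finite := by
  have h := ht.eventually (eventually_gt_atTop t)
  rw [← Nat.cofinite_eq_atTop] at h
  simpa using eventually_cofinite.1 h

theorem finite_setOf_lt (ht : Tendsto x atTop atTop) (t : ℝ) : {i | x i < t}.Finite :=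
  (finite_setOf_le ht t).subset fun i hi => le_of_lt (show x i < t from hi)

theorem seqRank_lt_iff (ht : Tendsto x atTop atTop) {i j : ℕ} :
    seqRank x i < seqRank x j ↔ x i < x j := by
  constructor
  · intro h
    by_contra hc
    refine absurd h (not_lt.2 (Set.ncard_le_ncard (fun l hl => ?_) (finite_setOf_lt ht _)))
    exact lt_of_lt_of_le (show x l < x j from hl) (not_lt.1 hc)
  · intro h
    refine Set.ncard_lt_ncard ⟨fun l hl => (show x l < x i from hl).trans h, fun hc => ?_⟩
      (finite_setOf_lt ht _)
    exact lt_irrefl _ (show x i < x i from hc h)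

theorem seqRank_injective (hx : Function.Injective x) (ht : Tendsto x atTop atTop) :
    Function.Injective (seqRank x) := by
  intro i j hij
  refine hx (le_antisymm ?_ ?_)
  · exact not_lt.1 fun h => ((seqRank_lt_iff ht).2 h).ne' hij
  · exact not_lt.1 fun h => ((seqRank_lt_iff ht).2 h).ne hij

theorem ncard_setOf_le (hx : Function.Injective x) (ht : Tendsto x atTop atTop) (k : ℕ) :
    {i | x i ≤ x k}.ncard = seqRank x k + 1 := by
  have : {i | x i ≤ x k} = insert k {i | x i < x k} := by
    ext i
    constructor
    · intro hi
      rcases (show x i ≤ x k from hi).lt_or_eq with h | h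
      · exact Or.inr h
      · exact Or.inl (hx h)
    · rintro (rfl | hi)
      · exact le_refl (x i)
      · exact le_of_lt (show x i < x k from hi)
  have hfin := finite_setOf_lt ht (x k)
  have hk : k ∉ {i | x i < x k} := fun h => lt_irrefl _ (show x k < x k from h)
  rw [this, Set.ncard_insert_of_notMem hk hfin, seqRank]

theorem seqRank_surjective (hx : Function.Injective x) (ht : Tendsto x atTop atTop) :
    Function.Surjective (seqRank x) := by
  have hdesc : ∀ n, n + 1 ∈ Set.range (seqRank x) → n ∈ Set.range (seqRank x) := by
    rintro n ⟨k, hk⟩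
    have hne : {i | x i < x k}.Nonempty := by
      rw [← Set.ncard_pos (finite_setOf_lt ht _)]
      exact lt_of_lt_of_eq n.succ_pos hk.symm
    obtain ⟨i, hi, hmax⟩ := (finite_setOf_lt ht (x k)).exists_maximalFor x _ hne
    have hi : x i < x k := hi
    refine ⟨i, ?_⟩
    have h1 : {l | x l ≤ x i} = {l | x l < x k} := by
      ext l
      refine ⟨fun hl => (show x l ≤ x i from hl).trans_lt hi, fun hl => ?_⟩
      rcases le_total (x i) (x l) with h | h
      · exact hmax hl h
      · exact h
    have h2 := ncard_setOf_le hx ht i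
    rw [h1] at h2
    have h3 : {l | x l < x k}.ncard = n + 1 := hk
    omega
  have hall : ∀ d n, n + d ∈ Set.range (seqRank x) → n ∈ Set.range (seqRank x) := by
    intro d
    induction d with
    | zero => exact fun n h => h
    | succ d ih => exact fun n h => ih n (hdesc _ h)
  intro n
  obtain ⟨m, hm, hnm⟩ := (Set.infinite_range_of_injective (seqRank_injective hx ht)).exists_gt n
  refine hall (m - n) n ?_
  rwa [Nat.add_sub_cancel' hnm.le]

theorem seqOrderStat_seqRank (hx : Function.Injective x) (ht : Tendsto x atTop atTop) (k : ℕ) :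
    seqOrderStat x (seqRank x k) = x k := by
  have : {t : ℝ | ((seqRank x k : ℕ) + 1 : ℕ∞) ≤ {i : ℕ | x i ≤ t}.encard} = Set.Ici (x k) := by
    ext t
    rw [Set.mem_Ici]
    have hfin := finite_setOf_le ht t
    rw [show (t ∈ {t : ℝ | ((seqRank x k : ℕ) + 1 : ℕ∞) ≤ {i : ℕ | x i ≤ t}.encard}) ↔
      ((seqRank x k : ℕ) + 1 : ℕ∞) ≤ {i : ℕ | x i ≤ t}.encard from Iff.rfl,
      ← hfin.cast_ncard_eq]
    norm_cast
    constructor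
    · intro h
      by_contra hc
      have : {i | x i ≤ t}.ncard ≤ seqRank x k :=
        Set.ncard_le_ncard (fun i hi => (show x i ≤ t from hi).trans_lt (not_le.1 hc))
          (finite_setOf_lt ht _)
      omega
    · intro h
      rw [← ncard_setOf_le hx ht k]
      exact Set.ncard_le_ncard (fun i hi => (show x i ≤ x k from hi).trans h) hfin
  rw [seqOrderStat, this, csInf_Ici]

theorem strictMono_seqOrderStat (hx : Function.Injective x) (ht : Tendsto x atTop atTop) :
    StrictMono (seqOrderStat x) := by
  intro i j hij
  obtain ⟨k, rfl⟩ := seqRank_surjective hx ht i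
  obtain ⟨l, rfl⟩ := seqRank_surjective hx ht j
  rw [seqOrderStat_seqRank hx ht, seqOrderStat_seqRank hx ht]
  exact (seqRank_lt_iff ht).1 hij

theorem eventually_finTriple_eq (hx : Function.Injective x) (ht : Tendsto x atTop atTop) (k : ℕ) :
    ∀ᶠ K : ℕ in atTop, finTriple (fun i : Fin K => x i) k = (seqOrderStat x k, x k, seqRank x k) := by
  classical
  obtain ⟨l, hl⟩ := seqRank_surjective hx ht k
  have h1 : ∀ t, ∀ᶠ K : ℕ in atTop, ∀ j, K ≤ j → ¬x j ≤ t := by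
    intro t
    obtain ⟨N, hN⟩ := eventually_atTop.1 (ht.eventually (eventually_gt_atTop t))
    filter_upwards [eventually_ge_atTop N] with K hK j hj
    exact not_le.2 (hN j (hK.trans hj))
  have hlt : ∀ t K, (∀ j, K ≤ j → ¬x j ≤ t) →
      (Finset.univ.filter fun i : Fin K => x i < t).card = {i | x i < t}.ncard := by
    intro t K h
    have := encard_eq_card_filter (p := fun i => x i < t) fun j hj hc => h j hj (le_of_lt hc)
    rw [← (finite_setOf_lt ht t).cast_ncard_eq] at this
    exact_mod_cast this.symm
  have hle : ∀ t K, (∀ j, K ≤ j → ¬x j ≤ t) →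
      (Finset.univ.filter fun i : Fin K => x i ≤ t).card = {i | x i ≤ t}.ncard := by
    intro t K h
    have := encard_eq_card_filter (p := fun i => x i ≤ t) h
    rw [← (finite_setOf_le ht t).cast_ncard_eq] at this
    exact_mod_cast this.symm
  filter_upwards [eventually_gt_atTop k, h1 (x k), h1 (x l)] with K hk hK1 hK2
  rw [finTriple_of_lt _ hk]
  refine Prod.ext ?_ (Prod.ext rfl (hlt _ _ hK1))
  change finOrderStat (fun i : Fin K => x i) k = seqOrderStat x k
  rw [← hl, seqOrderStat_seqRank hx ht, hl, finOrderStat_eq_iff _ hk, hlt _ _ hK2, hle _ _ hK2,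
    ncard_setOf_le hx ht, ← hl]
  exact ⟨le_rfl, Nat.lt_succ_self _⟩

open scoped Classical in
/-- The ranks as a permutation, whenever they form one. -/
noncomputable def rankPerm (x : ℕ → ℝ) : Equiv.Perm ℕ :=
  if h : Function.Bijective (seqRank x) then Equiv.ofBijective _ h else 1

theorem rankPerm_apply (hx : Function.Injective x) (ht : Tendsto x atTop atTop) (k : ℕ) :
    rankPerm x k = seqRank x k := by
  rw [rankPerm, dif_pos ⟨seqRank_injective hx ht, seqRank_surjective hx ht⟩]
  rfl

end SeqOrderStat

/-! ### Joint convergence of picks, order statistics and ranks -/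

theorem mem_of_mem_tripleSet {n K : ℕ} (hKn : K ≤ n) {c : ℝ} (hc : 0 < c) (x : Fin n → ℝ)
    (π J : Equiv.Perm (Fin n))
    (hJ : ∀ k : Fin n, revSeq (fun i => x (π i)) k = finOrderStat x (J k))
    {I : Finset ℕ} {G : Set (I → ℝ × ℝ × ℕ)} {M : ℝ}
    (h1 : (fun i : Fin K => c * revSeq (fun i => x (π i)) i) ∈ tripleSet I G M K)
    (h2 : ∀ j, K ≤ j → j < n → M < c * revSeq (fun i => x (π i)) j) :
    (fun k : I => (c * finOrderStat x k, c * revSeq (fun i => x (π i)) k, permSeq J k)) ∈ G := by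
  classical
  have hrev : ∀ j : Fin n, revSeq (fun i => x (π i)) j = x (π (Fin.rev j)) := fun j =>
    revSeq_of_lt _ j.2
  set y : Fin n → ℝ := fun j => c * x (π (Fin.rev j)) with hy
  have hyx : (fun i : Fin K => c * revSeq (fun i => x (π i)) i) =
      fun i => y (Fin.castLE hKn i) := by
    funext i
    exact congrArg (c * ·) (hrev (Fin.castLE hKn i))
  rw [hyx] at h1
  obtain ⟨hinj, hlt, hG⟩ := h1
  have hM : ∀ j : Fin n, K ≤ j → M < y j := by
    intro j hj
    rw [hy]
    beta_reduce
    rw [← hrev]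
    exact h2 j hj j.2
  have hord : ∀ k, finOrderStat y k = c * finOrderStat x k := by
    intro k
    rw [hy, finOrderStat_const_mul (fun j => x (π (Fin.rev j))) hc,
      ← finOrderStat_comp_perm x (Fin.revPerm.trans π)]
    rfl
  convert hG using 1
  funext k
  obtain ⟨hk, hk1, hk2⟩ := hlt k
  have hkn : (k : ℕ) < n := hk.trans_le hKn
  rw [← finTriple_castLE hKn hM hk hk1 hk2, finTriple_of_lt _ hkn]
  rw [finTriple_of_lt _ hk] at hk2
  have hk2 : y ⟨k, hkn⟩ < M := hk2
  have hr : revSeq (fun i => x (π i)) k = x (π (Fin.rev ⟨k, hkn⟩)) := hrev ⟨k, hkn⟩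
  refine Prod.ext (hord k).symm (Prod.ext (by rw [hr]) ?_)
  change permSeq J k = _
  rw [permSeq, dif_pos hkn]
  refine eq_card_of_finOrderStat_eq (J ⟨k, hkn⟩).2 (fun i hi => ?_) ?_
  · have hiK : (i : ℕ) < K := by
      by_contra hc'
      have := hM i (not_lt.1 hc')
      rw [hi] at this
      exact lt_asymm this hk2
    have := @hinj ⟨i, hiK⟩ ⟨k, hk⟩ hi
    ext
    simpa using congrArg Fin.val this
  · rw [hord, ← hJ ⟨k, hkn⟩, hr]

section Limit

variable {a r : ℝ}

theorem IsExpGammaSeq.aemeasurable_triple (ha : 0 < a) (hr : 0 < r) {Ω' : Type*}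
    [MeasurableSpace Ω'] {P' : Measure Ω'} [IsProbabilityMeasure P'] {e g : ℕ → Ω' → ℝ}
    (h : IsExpGammaSeq P' a e g) (k : ℕ) :
    AEMeasurable (fun ω =>
      (seqOrderStat (limitPick a r (fun i => e i ω) (fun i => g i ω)) k,
        limitPick a r (fun i => e i ω) (fun i => g i ω) k,
        rankPerm (limitPick a r (fun i => e i ω) (fun i => g i ω)) k)) P' := by
  refine aemeasurable_of_tendsto_metrizable_ae atTop (f := fun (K : ℕ) ω =>
    finTriple (fun i : Fin K => limitPick a r (fun i => e i ω) (fun i => g i ω) i) k)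
    (fun K => ?_) ?_
  · exact ((measurable_finTriple K k).comp (measurable_pi_iff.2 fun i =>
      measurable_limitPick a r h.measurable_exp h.measurable_gamma i)).aemeasurable
  · filter_upwards [h.ae_injective_and_pos ha hr, h.ae_tendsto_limitPick ha hr] with ω h1 h2
    rw [rankPerm_apply h1.2 h2]
    exact tendsto_const_nhds.congr' (EventuallyEq.symm (eventually_finTriple_eq h1.2 h2 k))

theorem le_liminf_measure_triple {F : Measure ℝ} [IsProbabilityMeasure F]
    (hF : F (Set.Iic 0) = 0) (ha : 0 < a) (hr : 0 < r)
    (hF0 : (fun x : ℝ => cdf F x) ~[𝓝[>] 0] fun x : ℝ => limitConst a r * x ^ a)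
    {Ω : ℕ → Type*} [∀ n, MeasurableSpace (Ω n)] (P : (n : ℕ) → Measure (Ω n))
    [∀ n, IsProbabilityMeasure (P n)] (X : (n : ℕ) → Fin n → Ω n → ℝ)
    (hX : ∀ n i, Measurable (X n i)) (hind : ∀ n, iIndepFun (X n) (P n))
    (hXF : ∀ n i, HasLaw (X n i) F (P n)) (σ : (n : ℕ) → Ω n → Equiv.Perm (Fin n))
    (hσ : ∀ n, IsSizeBiasedPermutation (P n) (X n) (σ n))
    {Ω' : Type*} [MeasurableSpace Ω'] {P' : Measure Ω'} [IsProbabilityMeasure P']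
    {e g : ℕ → Ω' → ℝ} (h : IsExpGammaSeq P' a e g)
    (Jn : (n : ℕ) → Ω n → Equiv.Perm (Fin n))
    (hJn : ∀ n, ∀ᵐ ω ∂P n, ∀ k : Fin n,
      revSeq (fun i => X n (σ n ω i) ω) k = finOrderStat (fun i => X n i ω) (Jn n ω k))
    (I : Finset ℕ) {G : Set (I → ℝ × ℝ × ℕ)} (hG : IsOpen G) :
    P' {ω | (fun k : I => (seqOrderStat (limitPick a r (fun i => e i ω) (fun i => g i ω)) k,
        limitPick a r (fun i => e i ω) (fun i => g i ω) k,
        rankPerm (limitPick a r (fun i => e i ω) (fun i => g i ω)) k)) ∈ G} ≤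
      liminf (fun n => P n {ω | (fun k : I => ((n : ℝ) ^ (1 / a) * finOrderStat (fun i => X n i ω) k,
        (n : ℝ) ^ (1 / a) * revSeq (fun i => X n (σ n ω i) ω) k, permSeq (Jn n ω) k)) ∈ G})
        atTop := by
  set L := liminf (fun n => P n {ω | (fun k : I =>
    ((n : ℝ) ^ (1 / a) * finOrderStat (fun i => X n i ω) k,
      (n : ℝ) ^ (1 / a) * revSeq (fun i => X n (σ n ω i) ω) k, permSeq (Jn n ω) k)) ∈ G}) atTop
  set ξ : Ω' → ℕ → ℝ := fun ω => limitPick a r (fun i => e i ω) (fun i => g i ω) with hξ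
  have hξm : ∀ k, Measurable fun ω => ξ ω k := fun k =>
    measurable_limitPick a r h.measurable_exp h.measurable_gamma k
  set w : ℝ → ℝ → ℝ≥0∞ := fun M T => ENNReal.ofReal
    (Real.exp (-(r * T ^ (-(1 / a)) * M * (limitConst a r * M ^ a)))) with hw
  set f : ℝ → ℕ → Ω' → ℝ≥0∞ := fun M k ω => (tripleSet I G M (k + 1)).indicator
    (fun _ => w M (∑ i ∈ Finset.range (k + 1), e i ω)) fun i : Fin (k + 1) => ξ ω i with hf
  have hΨ : ∀ M k, Measurable (Function.uncurry fun (T : ℝ) (x : Fin (k + 1) → ℝ) =>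
      (tripleSet I G M (k + 1)).indicator (fun _ => w M T) x) := by
    intro M k
    have : Measurable ((Prod.snd ⁻¹' tripleSet I G M (k + 1)).indicator
        fun p : ℝ × (Fin (k + 1) → ℝ) => w M p.1) :=
      Measurable.indicator (by fun_prop) (measurable_snd (isOpen_tripleSet I hG M _).measurableSet)
    exact this
  have hTm : ∀ k, Measurable fun ω => ∑ i ∈ Finset.range (k + 1), e i ω := fun k =>
    Finset.measurable_fun_sum _ fun i _ => h.measurable_exp i
  have hfm : ∀ M k, Measurable (f M k) := by
    intro M k
    have h1 : Measurable fun ω => (∑ i ∈ Finset.range (k + 1), e i ω,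
        (fun i => ξ ω i : Fin (k + 1) → ℝ)) :=
      (hTm k).prodMk (measurable_pi_iff.2 fun i => hξm i)
    exact (hΨ M k).comp h1
  have hfL : ∀ M, 0 < M → ∀ k, ∫⁻ ω, f M k ω ∂P' ≤ L := by
    intro M hM k
    have h1 := h.lintegral_comp (r := r) ha (k + 1) (hΨ M k)
    have h2 := le_liminf_measure_last_picks hF ha hr hF0 P X hX hind hXF σ hσ k
      (isOpen_tripleSet I hG M (k + 1)) hM
    refine (h1.trans_le h2).trans (liminf_le_liminf ?_)
    filter_upwards [eventually_ge_atTop (k + 1)] with n hn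
    refine measure_mono_ae ?_
    filter_upwards [hJn n] with ω hω hmem
    have hn' : (0 : ℝ) < n := Nat.cast_pos.2 (by omega)
    exact mem_of_mem_tripleSet hn (by positivity) (fun i => X n i ω) (σ n ω) (Jn n ω) hω
      hmem.1 hmem.2
  set D : Ω' → I → ℝ × ℝ × ℕ := fun ω k => (seqOrderStat (ξ ω) k, ξ ω k, rankPerm (ξ ω) k) with hD
  have hDm : AEMeasurable D P' := aemeasurable_pi_iff.2 fun k => h.aemeasurable_triple ha hr k
  set E : ℝ → Set (I → ℝ × ℝ × ℕ) := fun M => G ∩ ⋂ k, {d | (d k).1 < M ∧ (d k).2.1 < M} with hE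
  have hEo : ∀ M, IsOpen (E M) := by
    refine fun M => hG.inter (isOpen_iInter_of_finite fun k => ?_)
    have h1 : IsOpen {d : I → ℝ × ℝ × ℕ | (d k).1 < M} := isOpen_lt (by fun_prop) continuous_const
    have h2 : IsOpen {d : I → ℝ × ℝ × ℕ | (d k).2.1 < M} :=
      isOpen_lt (by fun_prop) continuous_const
    exact h1.inter h2
  have hEL : ∀ M, 0 < M → P' (D ⁻¹' E M) ≤ L := by
    intro M hM
    have hnull : NullMeasurableSet (D ⁻¹' E M) P' :=
      hDm.nullMeasurableSet_preimage (hEo M).measurableSet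
    rw [← lintegral_indicator_one₀ hnull]
    calc _ ≤ ∫⁻ ω, liminf (fun k => f M k ω) atTop ∂P' := by
          refine lintegral_mono_ae ?_
          filter_upwards [h.ae_injective_and_pos ha hr, h.ae_tendsto_limitPick ha hr,
            h.ae_tendsto_sum] with ω h1 h2 h3
          refine Set.indicator_apply_le' (fun hω => ?_) fun _ => zero_le
          have hω : D ω ∈ G ∧ ∀ k, (D ω k).1 < M ∧ (D ω k).2.1 < M := by
            simpa [hE] using hω
          have hev : ∀ᶠ k : ℕ in atTop, ∀ i : I,
              finTriple (fun i : Fin (k + 1) => ξ ω i) i = D ω i := by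
            refine eventually_all.2 fun i => ?_
            have := (tendsto_add_atTop_nat 1).eventually (eventually_finTriple_eq h1.2 h2 i)
            filter_upwards [this] with k hk
            rw [hk, hD]
            simp only [rankPerm_apply h1.2 h2, hξ]
          have hlt : ∀ᶠ k : ℕ in atTop, ∀ i : I, (i : ℕ) < k + 1 :=
            eventually_all.2 fun i => (eventually_ge_atTop (i : ℕ)).mono fun k hk => by omega
          have hmem : ∀ᶠ k : ℕ in atTop,
              (fun i : Fin (k + 1) => ξ ω i) ∈ tripleSet I G M (k + 1) := by
            filter_upwards [hev, hlt] with k hk1 hk2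
            refine ⟨fun i j hij => Fin.ext (h1.2 hij), fun i => ⟨hk2 i, ?_⟩, ?_⟩
            · rw [hk1 i]
              exact hω.2 i
            · simp only [hk1]
              exact hω.1
          have hwlim : Tendsto (fun k => w M (∑ i ∈ Finset.range (k + 1), e i ω)) atTop (𝓝 1) := by
            have h4 : Tendsto (fun k => (∑ i ∈ Finset.range (k + 1), e i ω) ^ (-(1 / a))) atTop
                (𝓝 0) := (tendsto_rpow_neg_atTop (by positivity)).comp h3
            have h5 := ENNReal.tendsto_ofReal (((((h4.const_mul r).mul_const M).mul_const
              (limitConst a r * M ^ a)).neg).rexp)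
            simpa [hw] using h5
          have : Tendsto (fun k => f M k ω) atTop (𝓝 1) := by
            refine hwlim.congr' ?_
            filter_upwards [hmem] with k hk
            simp only [hf, Set.indicator_of_mem hk]
          rw [this.liminf_eq, Pi.one_apply]
      _ ≤ liminf (fun k => ∫⁻ ω, f M k ω ∂P') atTop := lintegral_liminf_le (hfm M)
      _ ≤ liminf (fun _ : ℕ => L) atTop := liminf_le_liminf (Eventually.of_forall (hfL M hM))
      _ = L := liminf_const _
  have hsub : {ω | D ω ∈ G} ⊆ ⋃ M : ℕ, D ⁻¹' E (M + 1) := by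
    intro ω hω
    have h1 : ∀ k : I, ∃ M : ℕ, ∀ N ≥ M, (D ω k).1 < N + 1 ∧ (D ω k).2.1 < N + 1 := by
      intro k
      obtain ⟨M, hM⟩ := exists_nat_gt (max (D ω k).1 (D ω k).2.1)
      refine ⟨M, fun N hN => ?_⟩
      have hN' : (M : ℝ) ≤ N := Nat.cast_le.2 hN
      constructor
      · linarith [le_max_left (D ω k).1 (D ω k).2.1]
      · linarith [le_max_right (D ω k).1 (D ω k).2.1]
    choose N hN using h1
    refine Set.mem_iUnion.2 ⟨Finset.univ.sup N, hω, Set.mem_iInter.2 fun k => ?_⟩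
    exact hN k _ (Finset.le_sup (Finset.mem_univ k))
  have hmono : Monotone fun M : ℕ => D ⁻¹' E (M + 1) := by
    intro M N hMN ω hω
    have hMN' : (M : ℝ) ≤ N := Nat.cast_le.2 hMN
    refine ⟨hω.1, Set.mem_iInter.2 fun k => ?_⟩
    have := Set.mem_iInter.1 hω.2 k
    exact ⟨this.1.trans_le (by linarith), this.2.trans_le (by linarith)⟩
  calc _ ≤ P' (⋃ M : ℕ, D ⁻¹' E (M + 1)) := measure_mono hsub
    _ = ⨆ M : ℕ, P' (D ⁻¹' E (M + 1)) := hmono.measure_iUnion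
    _ ≤ L := iSup_le fun M => hEL _ (by positivity)

end Limit

theorem tendstoFDD_of_le_liminf {E : Type*} [PseudoEMetricSpace E] [SecondCountableTopology E]
    [MeasurableSpace E] [BorelSpace E] {Ω : ℕ → Type*} [∀ n, MeasurableSpace (Ω n)]
    {Ω' : Type*} [MeasurableSpace Ω'] {Y : (n : ℕ) → ℕ → Ω n → E} {Z : ℕ → Ω' → E}
    {P : (n : ℕ) → Measure (Ω n)} [∀ n, IsProbabilityMeasure (P n)]
    {P' : Measure Ω'} [IsProbabilityMeasure P'] (hY : ∀ n k, Measurable (Y n k))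
    (hZ : ∀ k, AEMeasurable (Z k) P')
    (h : ∀ (I : Finset ℕ) (G : Set (I → E)), IsOpen G →
      P' {ω | (fun k : I => Z k ω) ∈ G} ≤
        liminf (fun n => P n {ω | (fun k : I => Y n k ω) ∈ G}) atTop) :
    TendstoFDD Y Z P P' := by
  intro I
  have hYI : ∀ n, Measurable fun ω (k : I) => Y n k ω := fun n =>
    measurable_pi_iff.2 fun k => hY n k
  have hZI : AEMeasurable (fun ω (k : I) => Z k ω) P' := aemeasurable_pi_iff.2 fun k => hZ k
  refine ⟨fun n => (hYI n).aemeasurable, hZI, ?_⟩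
  refine tendsto_of_forall_isOpen_le_liminf_nat' fun G hG => ?_
  have h1 : ∀ n, (P n).map (fun ω (k : I) => Y n k ω) G = P n {ω | (fun k : I => Y n k ω) ∈ G} :=
    fun n => Measure.map_apply (hYI n) hG.measurableSet
  have h2 : P'.map (fun ω (k : I) => Z k ω) G = P' {ω | (fun k : I => Z k ω) ∈ G} :=
    Measure.map_apply_of_aemeasurable hZI hG.measurableSet
  simp only [ProbabilityMeasure.coe_mk, h1, h2]
  exact h I G hG

theorem measurable_apply_of_countable {ι Ω β : Type*} [Countable ι] [MeasurableSpace ι]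
    [MeasurableSingletonClass ι] [MeasurableSpace Ω] [MeasurableSpace β] {f : Ω → ι}
    (hf : Measurable f) {X : ι → Ω → β} (hX : ∀ i, Measurable (X i)) :
    Measurable fun ω => X (f ω) ω :=
  (measurable_from_prod_countable_right (f := fun p : ι × Ω => X p.1 p.2) hX).comp
    (hf.prodMk measurable_id)

theorem measurable_revSeq_comp {n : ℕ} {Ω : Type*} [MeasurableSpace Ω] {X : Fin n → Ω → ℝ}
    (hX : ∀ i, Measurable (X i)) {σ : Ω → Equiv.Perm (Fin n)}
    (hσ : ∀ j, Measurable fun ω => σ ω j) (k : ℕ) :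
    Measurable fun ω => revSeq (fun i => X (σ ω i) ω) k := by
  by_cases h : k < n
  · simp only [revSeq_of_lt _ h]
    exact measurable_apply_of_countable (hσ _) hX
  · simp [revSeq, h]

theorem measurable_permSeq {n : ℕ} {Ω : Type*} [MeasurableSpace Ω] {J : Ω → Equiv.Perm (Fin n)}
    (hJ : ∀ k, Measurable fun ω => J ω k) (k : ℕ) : Measurable fun ω => permSeq (J ω) k := by
  by_cases h : k < n
  · simp only [permSeq, h, dite_true]
    exact (Measurable.of_discrete (f := fun j : Fin n => (j : ℕ))).comp (hJ _)
  · simp [permSeq, h]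

theorem exists_perm_revSeq_eq {n : ℕ} (x : Fin n → ℝ) (π : Equiv.Perm (Fin n)) :
    ∃ J : Equiv.Perm (Fin n), ∀ k : Fin n, revSeq (fun i => x (π i)) k = finOrderStat x (J k) := by
  refine ⟨(Fin.revPerm.trans π).trans (Tuple.sort x).symm, fun k => ?_⟩
  rw [revSeq_of_lt _ k.2, finOrderStat_of_lt x (Fin.is_lt _)]
  simp

/-- Any continuous function of the order statistics, the picks and their ranks converges. -/
theorem tendstoFDD_comp_triple {a r : ℝ} {F : Measure ℝ} [IsProbabilityMeasure F]
    (hF : F (Set.Iic 0) = 0) (ha : 0 < a) (hr : 0 < r)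
    (hF0 : (fun x : ℝ => cdf F x) ~[𝓝[>] 0] fun x : ℝ => limitConst a r * x ^ a)
    {Ω : ℕ → Type*} [∀ n, MeasurableSpace (Ω n)] (P : (n : ℕ) → Measure (Ω n))
    [∀ n, IsProbabilityMeasure (P n)] (X : (n : ℕ) → Fin n → Ω n → ℝ)
    (hX : ∀ n i, Measurable (X n i)) (hind : ∀ n, iIndepFun (X n) (P n))
    (hXF : ∀ n i, HasLaw (X n i) F (P n)) (σ : (n : ℕ) → Ω n → Equiv.Perm (Fin n))
    (hσ : ∀ n, IsSizeBiasedPermutation (P n) (X n) (σ n))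
    {Ω' : Type*} [MeasurableSpace Ω'] {P' : Measure Ω'} [IsProbabilityMeasure P']
    {e g : ℕ → Ω' → ℝ} (h : IsExpGammaSeq P' a e g)
    (Jn : (n : ℕ) → Ω n → Equiv.Perm (Fin n))
    (hJn : ∀ n, ∀ᵐ ω ∂P n, ∀ k : Fin n,
      revSeq (fun i => X n (σ n ω i) ω) k = finOrderStat (fun i => X n i ω) (Jn n ω k))
    {E : Type*} [PseudoEMetricSpace E] [SecondCountableTopology E] [MeasurableSpace E]
    [BorelSpace E] {φ : ℝ × ℝ × ℕ → E} (hφ : Continuous φ)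
    (hm : ∀ (n : ℕ) k, Measurable fun ω => φ ((n : ℝ) ^ (1 / a) * finOrderStat (fun i => X n i ω) k,
      (n : ℝ) ^ (1 / a) * revSeq (fun i => X n (σ n ω i) ω) k, permSeq (Jn n ω) k)) :
    TendstoFDD (fun n k ω => φ ((n : ℝ) ^ (1 / a) * finOrderStat (fun i => X n i ω) k,
        (n : ℝ) ^ (1 / a) * revSeq (fun i => X n (σ n ω i) ω) k, permSeq (Jn n ω) k))
      (fun k ω => φ (seqOrderStat (limitPick a r (fun i => e i ω) (fun i => g i ω)) k,
        limitPick a r (fun i => e i ω) (fun i => g i ω) k,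
        rankPerm (limitPick a r (fun i => e i ω) (fun i => g i ω)) k)) P P' := by
  refine tendstoFDD_of_le_liminf hm
    (fun k => hφ.measurable.comp_aemeasurable (h.aemeasurable_triple ha hr k)) fun I G hG => ?_
  have hG' : IsOpen ((fun (d : I → ℝ × ℝ × ℕ) k => φ (d k)) ⁻¹' G) :=
    hG.preimage (continuous_pi fun k => hφ.comp (continuous_apply k))
  exact le_liminf_measure_triple hF ha hr hF0 P X hX hind hXF σ hσ h Jn hJn I hG'

/-! ### Convergence of the order statistics -/

theorem measurableSet_strictMono (n : ℕ) : MeasurableSet {v : Fin n → ℝ | StrictMono v} := by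
  have : {v : Fin n → ℝ | StrictMono v} = ⋂ (i) (j) (_ : i < j), {v | v i < v j} := by
    ext v
    simp [StrictMono]
  rw [this]
  exact MeasurableSet.iInter fun i => MeasurableSet.iInter fun j => MeasurableSet.iInter fun _ =>
    measurableSet_lt (measurable_pi_apply i) (measurable_pi_apply j)

theorem factorial_mul_setLIntegral_strictMono {n : ℕ} {g : (Fin n → ℝ) → ℝ≥0∞}
    (hg : Measurable g) (hsymm : ∀ (π : Equiv.Perm (Fin n)) v, g (v ∘ π) = g v) :
    n.factorial * ∫⁻ v in {v | StrictMono v}, g v ∂(Measure.pi fun _ => posVolume) =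
      ∫⁻ v, g v ∂(Measure.pi fun _ => posVolume) := by
  have hgi : Measurable ({v : Fin n → ℝ | StrictMono v}.indicator g) :=
    hg.indicator (measurableSet_strictMono n)
  have hcomp : ∀ π : Equiv.Perm (Fin n), Measurable fun v : Fin n → ℝ => v ∘ π := fun π =>
    measurable_pi_iff.2 fun i => measurable_pi_apply (π i)
  have h1 : ∫⁻ v, g v ∂(Measure.pi fun _ => posVolume) =
      ∫⁻ v, ∑ π : Equiv.Perm (Fin n), {v : Fin n → ℝ | StrictMono v}.indicator g (v ∘ π)
        ∂(Measure.pi fun _ => posVolume) := by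
    refine lintegral_congr_ae ?_
    filter_upwards [ae_injective_pi_posVolume n] with v hv
    have hinj : Function.Injective v := fun i j hij => by
      by_contra hne
      exact hv i j hne hij
    have hmono : StrictMono (v ∘ Tuple.sort v) :=
      (Tuple.monotone_sort v).strictMono_of_injective (hinj.comp (Tuple.sort v).injective)
    rw [Finset.sum_eq_single (Tuple.sort v), Set.indicator_of_mem hmono, hsymm]
    · intro π _ hπ
      refine Set.indicator_of_notMem (fun hmem => hπ ?_) _
      have hmem : StrictMono (v ∘ π) := hmem
      have := Tuple.comp_sort_eq_comp_iff_monotone.2 hmem.monotone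
      ext i
      exact congrArg Fin.val (hinj (congrFun this i))
    · simp
  have hgπ : ∀ π : Equiv.Perm (Fin n), Measurable fun v : Fin n → ℝ =>
      {v : Fin n → ℝ | StrictMono v}.indicator g (v ∘ π) := fun π => hgi.comp (hcomp π)
  rw [h1, lintegral_finsetSum _ fun π _ => hgπ π]
  simp_rw [lintegral_pi_perm posVolume _ hgi]
  rw [lintegral_indicator (measurableSet_strictMono n), Finset.sum_const, Finset.card_univ,
    Fintype.card_perm, Fintype.card_fin, nsmul_eq_mul]

theorem factorial_mul_measure_strictMono_Ioo {l : ℕ} {s b : ℝ} (hs : 0 ≤ s) :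
    l.factorial * (Measure.pi fun _ : Fin l => posVolume)
      ({w | StrictMono w} ∩ Set.pi Set.univ fun _ => Set.Ioo s b) = ENNReal.ofReal (b - s) ^ l := by
  have hB : MeasurableSet (Set.pi Set.univ fun _ : Fin l => Set.Ioo s b) :=
    MeasurableSet.univ_pi fun _ => measurableSet_Ioo
  have h := factorial_mul_setLIntegral_strictMono
    (g := (Set.pi Set.univ fun _ : Fin l => Set.Ioo s b).indicator 1)
    (measurable_one.indicator hB) fun π v => by
      have : v ∘ π ∈ (Set.pi Set.univ fun _ : Fin l => Set.Ioo s b) ↔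
          v ∈ (Set.pi Set.univ fun _ : Fin l => Set.Ioo s b) := by
        simp only [Set.mem_univ_pi, Function.comp_apply]
        exact ⟨fun h i => by simpa using h (π.symm i), fun h i => h (π i)⟩
      by_cases hv : v ∈ (Set.pi Set.univ fun _ : Fin l => Set.Ioo s b)
      · rw [Set.indicator_of_mem hv, Set.indicator_of_mem (this.2 hv)]
        rfl
      · rw [Set.indicator_of_notMem hv, Set.indicator_of_notMem fun hc => hv (this.1 hc)]
  rw [lintegral_indicator_one hB, lintegral_indicator_one hB, Measure.restrict_apply hB,
    Measure.pi_pi, Set.inter_comm] at h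
  have hsub : Set.Ioo s b ⊆ Set.Ioi 0 := fun x hx => hs.trans_lt hx.1
  rw [h, Finset.prod_const, Finset.card_univ, Fintype.card_fin, Measure.restrict_apply
    measurableSet_Ioo, Set.inter_eq_left.2 hsub, Real.volume_Ioo]

theorem strictMono_append {m l : ℕ} {v : Fin m → ℝ} {w : Fin l → ℝ} (hv : StrictMono v)
    (hw : StrictMono w) (hvw : ∀ i j, v i < w j) : StrictMono (Fin.append v w) := by
  intro i j
  refine Fin.addCases (fun i => ?_) (fun i => ?_) i <;>
    refine Fin.addCases (fun j => ?_) (fun j => ?_) j <;> intro hij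
  · simpa using hv (show i < j from hij)
  · simpa using hvw i j
  · have : m + (i : ℕ) < j := hij
    omega
  · have : m + (i : ℕ) < m + j := hij
    simpa using hw (show i < j from by rw [Fin.lt_def]; omega)

theorem strictMono_snoc_iff {k : ℕ} {v : Fin k → ℝ} {y : ℝ} :
    StrictMono (Fin.snoc v y : Fin (k + 1) → ℝ) ↔ StrictMono v ∧ ∀ i, v i < y := by
  constructor
  · intro h
    refine ⟨fun i j hij => ?_, fun i => ?_⟩
    · simpa using h (show i.castSucc < j.castSucc from hij)
    · simpa using h (Fin.castSucc_lt_last i)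
  · rintro ⟨hv, hy⟩ i j
    refine Fin.lastCases ?_ (fun i => ?_) i <;> refine Fin.lastCases ?_ (fun j => ?_) j <;>
      intro hij
    · exact absurd hij (lt_irrefl _)
    · exact absurd hij (not_lt.2 (Fin.le_last _))
    · simpa using hy i
    · simpa using hv (show i < j from hij)

/-- The last term of a finite sequence, and `0` if there is none. -/
def lastOrZero {k : ℕ} (v : Fin k → ℝ) : ℝ :=
  (Fin.cons 0 v : Fin (k + 1) → ℝ) (Fin.last k)

theorem lastOrZero_succ {k : ℕ} (v : Fin (k + 1) → ℝ) : lastOrZero v = v (Fin.last k) := by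
  rw [lastOrZero, ← Fin.succ_last, Fin.cons_succ]

@[fun_prop]
theorem measurable_lastOrZero {k : ℕ} : Measurable fun v : Fin k → ℝ => lastOrZero v := by
  cases k with
  | zero => exact measurable_const
  | succ k =>
    simp only [lastOrZero_succ]
    exact measurable_pi_apply _

theorem strictMono_snoc_iff_lastOrZero {k : ℕ} {v : Fin k → ℝ} {y : ℝ} (hy : 0 < y) :
    StrictMono (Fin.snoc v y : Fin (k + 1) → ℝ) ↔ StrictMono v ∧ lastOrZero v < y := by
  rw [strictMono_snoc_iff]
  refine and_congr_right fun hv => ?_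
  cases k with
  | zero => simpa [lastOrZero] using hy
  | succ k =>
    rw [lastOrZero_succ]
    exact ⟨fun h => h _, fun h i => (hv.monotone (Fin.le_last i)).trans_lt h⟩

theorem sum_Iic_snoc {k : ℕ} (t : Fin k → ℝ) (x : ℝ) :
    (fun i => ∑ j ∈ Finset.Iic i, (Fin.snoc t x : Fin (k + 1) → ℝ) j) =
      Fin.snoc (fun i => ∑ j ∈ Finset.Iic i, t j)
        (lastOrZero (fun i => ∑ j ∈ Finset.Iic i, t j) + x) := by
  have h := sum_Iic_append t (Fin.cons x Fin.elim0 : Fin 1 → ℝ)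
  rw [← Fin.snoc_eq_append] at h
  have hlast : lastOrZero (fun i => ∑ j ∈ Finset.Iic i, t j) = ∑ j, t j := by
    cases k with
    | zero => simp [lastOrZero]
    | succ k =>
      rw [lastOrZero_succ]
      congr 1
      ext j
      simpa using Fin.le_last j
  funext i
  refine Fin.lastCases ?_ (fun i => ?_) i
  · rw [Fin.snoc_last, hlast]
    have := h.2 0
    simp only [show (Finset.Iic (0 : Fin 1)) = {0} from rfl, Finset.sum_singleton,
      Fin.cons_zero] at this
    exact this
  · rw [Fin.snoc_castSucc]
    exact h.1 i

/-- The law of the partial sums of i.i.d. standard exponential variables. -/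
theorem lintegral_pi_expMeasure_sum_Iic (k : ℕ) {Φ : (Fin k → ℝ) → ℝ≥0∞} (hΦ : Measurable Φ) :
    ∫⁻ t, Φ (fun i => ∑ j ∈ Finset.Iic i, t j) ∂(Measure.pi fun _ => expMeasure 1) =
      ∫⁻ v in {v | StrictMono v}, ENNReal.ofReal (Real.exp (-lastOrZero v)) * Φ v
        ∂(Measure.pi fun _ => posVolume) := by
  have := isProbabilityMeasure_expMeasure one_pos
  induction k with
  | zero =>
    rw [← lintegral_indicator (measurableSet_strictMono 0), lintegral_pi_fin_zero,
      lintegral_pi_fin_zero, Set.indicator_of_mem (show StrictMono _ from fun i => i.elim0)]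
    simp only [lastOrZero, Fin.last_zero, Fin.cons_zero, neg_zero, Real.exp_zero,
      ENNReal.ofReal_one, one_mul]
    congr 1
    exact Subsingleton.elim _ _
  | succ k ih =>
    have hsum : Measurable fun (t : Fin (k + 1) → ℝ) i => ∑ j ∈ Finset.Iic i, t j := by fun_prop
    set Ψ : (Fin k → ℝ) → ℝ≥0∞ := fun u =>
      ∫⁻ x, Φ (Fin.snoc u (lastOrZero u + x)) ∂(expMeasure 1) with hΨ
    have hΨm : Measurable Ψ := by
      refine Measurable.lintegral_prod_right'
        (f := fun p : (Fin k → ℝ) × ℝ => Φ (Fin.snoc p.1 (lastOrZero p.1 + p.2))) ?_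
      have h1 : Measurable fun p : (Fin k → ℝ) × ℝ => (p.1, lastOrZero p.1 + p.2) := by fun_prop
      exact (hΦ.comp measurable_finSnoc).comp h1
    have hstep : ∀ u, Ψ u = ENNReal.ofReal (Real.exp (lastOrZero u)) *
        ∫⁻ y in Set.Ioi (lastOrZero u), ENNReal.ofReal (Real.exp (-y)) * Φ (Fin.snoc u y) := by
      intro u
      have h1 : Measurable fun y : ℝ => (u, y) := measurable_const.prodMk measurable_id
      exact lintegral_expMeasure_add ((hΦ.comp measurable_finSnoc).comp h1) (lastOrZero u)
    have hrm : Measurable ({v : Fin (k + 1) → ℝ | StrictMono v}.indicator fun v =>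
        ENNReal.ofReal (Real.exp (-lastOrZero v)) * Φ v) :=
      Measurable.indicator (by fun_prop) (measurableSet_strictMono _)
    have hΦs : Measurable fun t : Fin (k + 1) → ℝ => Φ fun i => ∑ j ∈ Finset.Iic i, t j :=
      hΦ.comp hsum
    rw [lintegral_pi_snoc _ hΦs]
    simp only [sum_Iic_snoc]
    rw [ih hΨm, ← lintegral_indicator (measurableSet_strictMono _),
      ← lintegral_indicator (measurableSet_strictMono _), lintegral_pi_snoc _ hrm]
    refine lintegral_congr_ae ?_
    filter_upwards [ae_pi_posVolume k] with v hv
    by_cases hmono : StrictMono v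
    · have hlast : 0 ≤ lastOrZero v := by
        cases k with
        | zero => exact le_rfl
        | succ k =>
          rw [lastOrZero_succ]
          exact (hv _).le
      rw [Set.indicator_of_mem hmono, hstep, ← mul_assoc, ← ENNReal.ofReal_mul (Real.exp_pos _).le,
        ← Real.exp_add, neg_add_cancel, Real.exp_zero, ENNReal.ofReal_one, one_mul,
        ← lintegral_indicator measurableSet_Ioi, ← lintegral_indicator measurableSet_Ioi]
      refine lintegral_congr fun y => ?_
      by_cases hy : 0 < y
      · rw [Set.indicator_of_mem (show y ∈ Set.Ioi (0 : ℝ) from hy)]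
        by_cases hly : lastOrZero v < y
        · rw [Set.indicator_of_mem (show y ∈ Set.Ioi (lastOrZero v) from hly),
            Set.indicator_of_mem (show StrictMono (Fin.snoc v y : Fin (k + 1) → ℝ) from
              (strictMono_snoc_iff_lastOrZero hy).2 ⟨hmono, hly⟩), lastOrZero_succ, Fin.snoc_last]
        · rw [Set.indicator_of_notMem (show y ∉ Set.Ioi (lastOrZero v) from hly),
            Set.indicator_of_notMem]
          exact fun hc => hly ((strictMono_snoc_iff_lastOrZero hy).1 hc).2
      · rw [Set.indicator_of_notMem (show y ∉ Set.Ioi (0 : ℝ) from hy), Set.indicator_of_notMem]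
        exact fun hc => hy (hlast.trans_lt hc)
    · rw [Set.indicator_of_notMem hmono]
      symm
      rw [lintegral_congr (g := fun _ => 0)]
      · simp
      · intro y
        exact Set.indicator_of_notMem (fun hc => hmono (strictMono_snoc_iff.1 hc).1) _

theorem finOrderStat_of_monotone {n : ℕ} {x : Fin n → ℝ} (hx : Monotone x) (i : Fin n) :
    finOrderStat x i = x i := by
  rw [finOrderStat_of_lt x i.2, Tuple.sort_eq_refl_iff_monotone.2 hx]
  rfl

theorem IsQuantile.monotoneOn {F : Measure ℝ} {Q : ℝ → ℝ} (hQ : IsQuantile F Q) :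
    MonotoneOn Q (Set.Ioo 0 1) := fun u hu w hw huw =>
  (hQ.le_iff u hu _).2 (huw.trans ((hQ.le_iff w hw _).1 le_rfl))

theorem ofReal_mul_factorial_eq {m l : ℕ} {n v : ℝ} (hn : 0 < n) {y : ℝ≥0∞}
    (hy : l.factorial * y = ENNReal.ofReal (n - v) ^ l) :
    ENNReal.ofReal n⁻¹ ^ (m + l) * ((m + l).factorial * y) =
      ((m + l).descFactorial m * ENNReal.ofReal n⁻¹ ^ m) * ENNReal.ofReal (1 - v / n) ^ l := by
  have h1 : (((m + l).factorial : ℕ) : ℝ≥0∞) = l.factorial * (m + l).descFactorial m := by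
    rw [← Nat.factorial_mul_descFactorial (Nat.le_add_right m l), Nat.add_sub_cancel_left]
    push_cast
    rfl
  have h2 : ENNReal.ofReal (1 - v / n) = ENNReal.ofReal n⁻¹ * ENNReal.ofReal (n - v) := by
    rw [← ENNReal.ofReal_mul (by positivity)]
    congr 1
    field_simp
  rw [h1, h2, mul_pow, ← hy, pow_add]
  ring

/-- A lower bound for the law of the smallest order statistics. -/
theorem le_measure_finOrderStat_mem {F : Measure ℝ} [IsProbabilityMeasure F] {Q : ℝ → ℝ}
    (hQ : IsQuantile F Q) {m l : ℕ} {Ω : Type*} [MeasurableSpace Ω] {P : Measure Ω}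
    [IsProbabilityMeasure P] {X : Fin (m + 1 + l) → Ω → ℝ} (hX : ∀ i, Measurable (X i))
    (hind : iIndepFun X P) (hXF : ∀ i, HasLaw (X i) F P) {c : ℝ} (hc : 0 < c)
    {G : Set (Fin (m + 1) → ℝ)} (hG : MeasurableSet G) :
    ∫⁻ v in {v : Fin (m + 1) → ℝ | StrictMono v},
        ((m + 1 + l).descFactorial (m + 1) * ENNReal.ofReal ((m + 1 + l : ℕ) : ℝ)⁻¹ ^ (m + 1)) *
          (Set.pi Set.univ fun _ => Set.Iio ((m + 1 + l : ℕ) : ℝ)).indicator (fun v =>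
            ENNReal.ofReal (1 - v (Fin.last m) / ((m + 1 + l : ℕ) : ℝ)) ^ l *
              G.indicator 1 fun i => c * Q (v i / ((m + 1 + l : ℕ) : ℝ))) v
        ∂(Measure.pi fun _ => posVolume) ≤
      P {ω | (fun i : Fin (m + 1) => c * finOrderStat (fun j => X j ω) i) ∈ G} := by
  have hn' : (0 : ℝ) < ((m + 1 + l : ℕ) : ℝ) := Nat.cast_pos.2 (by omega)
  have hlaw : P.map (fun ω i => c * X i ω) = Measure.pi fun _ => F.map fun x => c * x := by
    have hm : ∀ i, Measurable fun ω => c * X i ω := fun i => (hX i).const_mul c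
    have hi : iIndepFun (fun i ω => c * X i ω) P :=
      hind.comp (fun _ x => c * x) fun _ => by fun_prop
    rw [(iIndepFun_iff_map_fun_eq_pi_map fun i => (hm i).aemeasurable).1 hi]
    congr 1
    funext i
    rw [← (hXF i).map_eq, Measure.map_map (by fun_prop) (hX i)]
    rfl
  have hXm : Measurable fun ω i => c * X i ω := measurable_pi_iff.2 fun i => (hX i).const_mul c
  have hsm : Measurable fun (y : Fin (m + 1 + l) → ℝ) (i : Fin (m + 1)) => finOrderStat y i :=
    measurable_pi_iff.2 fun i => measurable_finOrderStat (m + 1 + l) i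
  set g : (Fin (m + 1 + l) → ℝ) → ℝ≥0∞ := fun y =>
    G.indicator 1 fun i : Fin (m + 1) => finOrderStat y i
    with hg
  have hgm : Measurable g := (measurable_one.indicator hG).comp hsm
  have hP : P {ω | (fun i : Fin (m + 1) => c * finOrderStat (fun j => X j ω) i) ∈ G} =
      ∫⁻ y, g y ∂(Measure.pi fun _ => F.map fun x => c * x) := by
    have hset : {ω | (fun i : Fin (m + 1) => c * finOrderStat (fun j => X j ω) i) ∈ G} =
        (fun ω j => c * X j ω) ⁻¹' ((fun (y : Fin (m + 1 + l) → ℝ) (i : Fin (m + 1)) =>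
          finOrderStat y i) ⁻¹' G) := by
      ext ω
      simp only [Set.mem_preimage, finOrderStat_const_mul _ hc]
      rfl
    rw [hset, ← Measure.map_apply hXm (hsm hG), hlaw, ← lintegral_indicator_one (hsm hG)]
    rfl
  set qn : ℝ → ℝ := fun v => c * Q (v / ((m + 1 + l : ℕ) : ℝ)) with hqn
  have hqnm : Measurable qn := (hQ.measurable.comp (measurable_id.div_const _)).const_mul _
  have hmono : ∀ v w : ℝ, 0 < v → v ≤ w → w < ((m + 1 + l : ℕ) : ℝ) → qn v ≤ qn w := by
    intro v w hv hvw hw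
    refine mul_le_mul_of_nonneg_left (hQ.monotoneOn ⟨by positivity, ?_⟩ ⟨?_, ?_⟩ ?_) hc.le
    · exact (div_lt_one hn').2 (hvw.trans_lt hw)
    · exact div_pos (hv.trans_le hvw) hn'
    · exact (div_lt_one hn').2 hw
    · gcongr
  set h : (Fin (m + 1 + l) → ℝ) → ℝ≥0∞ :=
    (Set.pi Set.univ fun _ => Set.Iio ((m + 1 + l : ℕ) : ℝ)).indicator fun v =>
    g fun i => qn (v i) with hh
  have hI : ∀ k, MeasurableSet (Set.pi Set.univ fun _ : Fin k => Set.Iio ((m + 1 + l : ℕ) : ℝ)) :=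
    fun k => MeasurableSet.univ_pi fun _ => measurableSet_Iio
  have hqm : Measurable fun (v : Fin (m + 1 + l) → ℝ) i => qn (v i) :=
    measurable_pi_iff.2 fun i => hqnm.comp (measurable_pi_apply i)
  have hhm : Measurable h := (hgm.comp hqm).indicator (hI (m + 1 + l))
  have hsymm : ∀ (π : Equiv.Perm (Fin (m + 1 + l))) v, h (v ∘ π) = h v := by
    intro π v
    have h1 : v ∘ π ∈ (Set.pi Set.univ fun _ : Fin (m + 1 + l) => Set.Iio ((m + 1 + l : ℕ) : ℝ)) ↔
        v ∈ (Set.pi Set.univ fun _ : Fin (m + 1 + l) => Set.Iio ((m + 1 + l : ℕ) : ℝ)) := by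
      simp only [Set.mem_univ_pi, Function.comp_apply]
      exact ⟨fun h i => by simpa using h (π.symm i), fun h i => h (π i)⟩
    by_cases hv : v ∈ (Set.pi Set.univ fun _ : Fin (m + 1 + l) => Set.Iio ((m + 1 + l : ℕ) : ℝ))
    · simp only [hh]
      rw [Set.indicator_of_mem hv, Set.indicator_of_mem (h1.2 hv)]
      simp only [hg, Function.comp_apply]
      congr 1
      funext i
      exact finOrderStat_comp_perm (fun j => qn (v j)) π i
    · simp only [hh]
      rw [Set.indicator_of_notMem hv, Set.indicator_of_notMem fun hc => hv (h1.1 hc)]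
  have hSh : Measurable ({v : Fin (m + 1 + l) → ℝ | StrictMono v}.indicator h) :=
    hhm.indicator (measurableSet_strictMono (m + 1 + l))
  have hE : ∫⁻ y, g y ∂(Measure.pi fun _ => F.map fun x => c * x) =
      ∫⁻ v : Fin (m + 1) → ℝ, ENNReal.ofReal ((m + 1 + l : ℕ) : ℝ)⁻¹ ^ (m + 1 + l) *
        ((m + 1 + l).factorial *
        ∫⁻ w : Fin l → ℝ, {v : Fin (m + 1 + l) → ℝ | StrictMono v}.indicator h (Fin.append v w)
          ∂(Measure.pi fun _ => posVolume)) ∂(Measure.pi fun _ => posVolume) := by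
    rw [lintegral_const_mul' _ _ (ENNReal.pow_ne_top ENNReal.ofReal_ne_top),
      lintegral_const_mul' _ _ (ENNReal.natCast_ne_top _), ← lintegral_pi_append _ hSh,
      lintegral_indicator (measurableSet_strictMono (m + 1 + l)),
      factorial_mul_setLIntegral_strictMono hhm hsymm, hQ.lintegral_pi c hn' (m + 1 + l) hgm,
      ← lintegral_indicator (hI (m + 1 + l))]
  rw [hP, hE, ← lintegral_indicator (measurableSet_strictMono _)]
  refine lintegral_mono_ae ?_
  filter_upwards [ae_pi_posVolume (m + 1)] with v hv
  refine Set.indicator_apply_le' (fun hmem => ?_) fun _ => zero_le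
  have hvm : StrictMono v := hmem
  by_cases hbox : v ∈ Set.pi Set.univ fun _ => Set.Iio ((m + 1 + l : ℕ) : ℝ)
  swap
  · rw [Set.indicator_of_notMem hbox, mul_zero]
    exact zero_le
  rw [Set.indicator_of_mem hbox, ← mul_assoc,
    ← ofReal_mul_factorial_eq hn' (factorial_mul_measure_strictMono_Ioo (hv (Fin.last m)).le),
    mul_assoc, mul_assoc]
  gcongr
  have hB : MeasurableSet ({w : Fin l → ℝ | StrictMono w} ∩
      Set.pi Set.univ fun _ => Set.Ioo (v (Fin.last m)) ((m + 1 + l : ℕ) : ℝ)) :=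
    (measurableSet_strictMono l).inter (MeasurableSet.univ_pi fun _ => measurableSet_Ioo)
  rw [mul_comm, ← lintegral_indicator_const hB]
  refine lintegral_mono fun w => Set.indicator_apply_le' (fun hw => ?_) fun _ => zero_le
  obtain ⟨hwm, hwI⟩ := hw
  have hwI : ∀ j, v (Fin.last m) < w j ∧ w j < ((m + 1 + l : ℕ) : ℝ) := fun j => hwI j trivial
  have happ : StrictMono (Fin.append v w) := strictMono_append hvm hwm fun i j =>
    (hvm.monotone (Fin.le_last i)).trans_lt (hwI j).1
  have hapos : ∀ i, 0 < Fin.append v w i := by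
    refine fun i => Fin.addCases (fun i => ?_) (fun j => ?_) i
    · simpa using hv i
    · simpa using (hv _).trans (hwI j).1
  have haI : ∀ i, Fin.append v w i < ((m + 1 + l : ℕ) : ℝ) := by
    refine fun i => Fin.addCases (fun i => ?_) (fun j => ?_) i
    · simpa using hbox i trivial
    · simpa using (hwI j).2
  have hm1 : Monotone fun i => qn (Fin.append v w i) := fun i j hij =>
    hmono _ _ (hapos i) (happ.monotone hij) (haI j)
  rw [Set.indicator_of_mem (show Fin.append v w ∈ {v : Fin (m + 1 + l) → ℝ | StrictMono v} from happ)]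
  simp only [hh]
  rw [Set.indicator_of_mem (show Fin.append v w ∈
      Set.pi Set.univ fun _ => Set.Iio ((m + 1 + l : ℕ) : ℝ) from
    fun i _ => haI i)]
  simp only [hg]
  refine le_of_eq ?_
  congr 1
  funext i
  have := finOrderStat_of_monotone hm1 (Fin.castAdd l i)
  rw [Fin.append_left] at this
  exact this.symm

theorem le_liminf_measure_finOrderStat {a A : ℝ} (ha : 0 < a) (hA : 0 < A) {F : Measure ℝ}
    [IsProbabilityMeasure F]
    (hF0 : (fun x : ℝ => cdf F x) ~[𝓝[>] 0] fun x : ℝ => A * x ^ a)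
    {Ω : ℕ → Type*} [∀ n, MeasurableSpace (Ω n)] (P : (n : ℕ) → Measure (Ω n))
    [∀ n, IsProbabilityMeasure (P n)] (X : (n : ℕ) → Fin n → Ω n → ℝ)
    (hX : ∀ n i, Measurable (X n i)) (hind : ∀ n, iIndepFun (X n) (P n))
    (hXF : ∀ n i, HasLaw (X n i) F (P n)) (m : ℕ) {G : Set (Fin (m + 1) → ℝ)} (hG : IsOpen G) :
    ∫⁻ t, G.indicator 1 (fun i => limitQuantile a A (∑ j ∈ Finset.Iic i, t j))
        ∂(Measure.pi fun _ : Fin (m + 1) => expMeasure 1) ≤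
      liminf (fun n => P n {ω | (fun i : Fin (m + 1) =>
        (n : ℝ) ^ (1 / a) * finOrderStat (fun j => X n j ω) i) ∈ G}) atTop := by
  obtain ⟨Q, hQ⟩ := exists_isQuantile F
  set qn : ℕ → ℝ → ℝ := fun n v => (n : ℝ) ^ (1 / a) * Q (v / n) with hqn
  have hqnm : ∀ n, Measurable (qn n) := fun n =>
    (hQ.measurable.comp (measurable_id.div_const _)).const_mul _
  have hqnk : ∀ n, Measurable fun (v : Fin (m + 1) → ℝ) i => qn n (v i) := fun n =>
    measurable_pi_iff.2 fun i => (hqnm n).comp (measurable_pi_apply i)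
  have hG1 : Measurable (G.indicator (1 : (Fin (m + 1) → ℝ) → ℝ≥0∞)) :=
    measurable_one.indicator hG.measurableSet
  set f : ℕ → (Fin (m + 1) → ℝ) → ℝ≥0∞ := fun n v =>
    (n.descFactorial (m + 1) * ENNReal.ofReal (n : ℝ)⁻¹ ^ (m + 1)) *
      (Set.pi Set.univ fun _ => Set.Iio (n : ℝ)).indicator (fun v =>
        ENNReal.ofReal (1 - v (Fin.last m) / n) ^ (n - (m + 1)) *
          G.indicator 1 fun i => qn n (v i)) v with hf
  have hfm : ∀ n, Measurable (f n) := by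
    intro n
    refine Measurable.const_mul (Measurable.indicator ?_
      (MeasurableSet.univ_pi fun _ => measurableSet_Iio)) _
    exact Measurable.mul (by fun_prop) (hG1.comp (hqnk n))
  have hle : ∀ᶠ n : ℕ in atTop, ∫⁻ v in {v : Fin (m + 1) → ℝ | StrictMono v}, f n v
      ∂(Measure.pi fun _ => posVolume) ≤ P n {ω | (fun i : Fin (m + 1) =>
        (n : ℝ) ^ (1 / a) * finOrderStat (fun j => X n j ω) i) ∈ G} := by
    filter_upwards [eventually_ge_atTop (m + 1)] with n hn
    obtain ⟨l, rfl⟩ := Nat.exists_eq_add_of_le hn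
    have hn' : (0 : ℝ) < ((m + 1 + l : ℕ) : ℝ) := Nat.cast_pos.2 (by omega)
    have := le_measure_finOrderStat_mem hQ (hX (m + 1 + l)) (hind _) (hXF _)
      (show 0 < ((m + 1 + l : ℕ) : ℝ) ^ (1 / a) by positivity) hG.measurableSet
    simp only [hf, Nat.add_sub_cancel_left]
    exact this
  have hqm : Measurable fun (v : Fin (m + 1) → ℝ) i => limitQuantile a A (v i) := by fun_prop
  have hΦ : Measurable fun v : Fin (m + 1) → ℝ =>
      G.indicator (1 : (Fin (m + 1) → ℝ) → ℝ≥0∞) fun i => limitQuantile a A (v i) := hG1.comp hqm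
  rw [lintegral_pi_expMeasure_sum_Iic (m + 1) hΦ]
  refine le_trans ?_ (liminf_le_liminf hle)
  refine le_trans (lintegral_mono_ae ?_) (lintegral_liminf_le hfm)
  refine ae_restrict_of_ae ?_
  filter_upwards [ae_pi_posVolume (m + 1)] with v hv
  have hlim : ∀ i, Tendsto (fun n => qn n (v i)) atTop (𝓝 (limitQuantile a A (v i))) := fun i =>
    hQ.tendsto ha hA hF0 (hv i)
  by_cases hvG : (fun i => limitQuantile a A (v i)) ∈ G
  · have hG' : ∀ᶠ n in atTop, (fun i => qn n (v i)) ∈ G :=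
      (tendsto_pi_nhds.2 hlim).eventually (hG.mem_nhds hvG)
    have hI : ∀ᶠ n : ℕ in atTop, v ∈ Set.pi Set.univ fun _ : Fin (m + 1) => Set.Iio (n : ℝ) := by
      have : ∀ i, ∀ᶠ n : ℕ in atTop, v i < n := fun i =>
        tendsto_natCast_atTop_atTop.eventually (eventually_gt_atTop _)
      filter_upwards [eventually_all.2 this] with n hn i _ using hn i
    have hpow : Tendsto (fun n : ℕ => (1 - v (Fin.last m) / n) ^ (n - (m + 1))) atTop
        (𝓝 (Real.exp (-v (Fin.last m)))) := by
      refine tendsto_one_sub_pow_sub (tendsto_const_nhds.congr' ?_) (m + 1)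
      filter_upwards [eventually_gt_atTop 0] with n hn
      have : (n : ℝ) ≠ 0 := Nat.cast_ne_zero.2 hn.ne'
      field_simp
    have h1 := ENNReal.Tendsto.mul (tendsto_descFactorial_mul (m + 1))
      (Or.inr ENNReal.ofReal_ne_top) (ENNReal.tendsto_ofReal hpow) (Or.inr ENNReal.one_ne_top)
    have h2 : Tendsto (fun n => f n v) atTop
        (𝓝 (1 * ENNReal.ofReal (Real.exp (-v (Fin.last m))))) := by
      refine h1.congr' ?_
      filter_upwards [hG', hI] with n hn1 hn2
      have h0 : 0 ≤ 1 - v (Fin.last m) / n := by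
        have h3 : v (Fin.last m) < n := hn2 _ trivial
        rw [sub_nonneg]
        exact (div_le_one ((hv _).trans h3)).2 h3.le
      simp only [hf, Set.indicator_of_mem hn2, Set.indicator_of_mem hn1, Pi.one_apply, mul_one,
        ENNReal.ofReal_pow h0]
    rw [h2.liminf_eq, Set.indicator_of_mem hvG, lastOrZero_succ, Pi.one_apply, mul_one, one_mul]
  · rw [Set.indicator_of_notMem hvG, mul_zero]
    exact zero_le

theorem tendstoFDD_finOrderStat {a A : ℝ} (ha : 0 < a) (hA : 0 < A) {F : Measure ℝ}
    [IsProbabilityMeasure F]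
    (hF0 : (fun x : ℝ => cdf F x) ~[𝓝[>] 0] fun x : ℝ => A * x ^ a)
    {Ω : ℕ → Type*} [∀ n, MeasurableSpace (Ω n)] (P : (n : ℕ) → Measure (Ω n))
    [∀ n, IsProbabilityMeasure (P n)] (X : (n : ℕ) → Fin n → Ω n → ℝ)
    (hX : ∀ n i, Measurable (X n i)) (hind : ∀ n, iIndepFun (X n) (P n))
    (hXF : ∀ n i, HasLaw (X n i) F (P n))
    {Ω' : Type*} [MeasurableSpace Ω'] {P' : Measure Ω'} [IsProbabilityMeasure P']
    {e g : ℕ → Ω' → ℝ} (h : IsExpGammaSeq P' a e g) :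
    TendstoFDD (fun n k ω => (n : ℝ) ^ (1 / a) * finOrderStat (fun i => X n i ω) k)
      (fun k ω => limitQuantile a A (∑ i ∈ Finset.range (k + 1), e i ω)) P P' := by
  have hTm : ∀ k, Measurable fun ω => ∑ i ∈ Finset.range (k + 1), e i ω := fun k =>
    Finset.measurable_fun_sum _ fun i _ => h.measurable_exp i
  refine tendstoFDD_of_le_liminf (fun n k => ((measurable_finOrderStat n k).comp
    (measurable_pi_iff.2 (hX n))).const_mul _)
    (fun k => ((measurable_limitQuantile a A).comp (hTm k)).aemeasurable) fun I G hG => ?_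
  set m := I.sup id
  have hI : ∀ k : I, (k : ℕ) < m + 1 := fun k => Nat.lt_succ_of_le (Finset.le_sup (f := id) k.2)
  set G' : Set (Fin (m + 1) → ℝ) := (fun (x : Fin (m + 1) → ℝ) (k : I) => x ⟨k, hI k⟩) ⁻¹' G
  have hG' : IsOpen G' := hG.preimage (by fun_prop)
  have h1 := le_liminf_measure_finOrderStat ha hA hF0 P X hX hind hXF m hG'
  refine le_trans (le_of_eq ?_) h1
  have hq : Measurable fun (t : Fin (m + 1) → ℝ) i =>
      limitQuantile a A (∑ j ∈ Finset.Iic i, t j) := by fun_prop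
  have hem : Measurable fun ω (i : Fin (m + 1)) => e i ω :=
    measurable_pi_iff.2 fun i => h.measurable_exp i
  have hset : {ω | (fun k : I => limitQuantile a A (∑ i ∈ Finset.range ((k : ℕ) + 1), e i ω)) ∈ G} =
      (fun ω (i : Fin (m + 1)) => e i ω) ⁻¹' ((fun (t : Fin (m + 1) → ℝ) i =>
        limitQuantile a A (∑ j ∈ Finset.Iic i, t j)) ⁻¹' G') := by
    ext ω
    have : ∀ k : I, ∑ j ∈ Finset.Iic (⟨k, hI k⟩ : Fin (m + 1)), e j ω =
        ∑ i ∈ Finset.range ((k : ℕ) + 1), e i ω := fun k =>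
      sum_Iic_fin_eq_sum_range (fun i => e i ω) ⟨k, hI k⟩
    simp only [G', Set.mem_preimage, this]
    rfl
  rw [hset, ← Measure.map_apply hem (hq hG'.measurableSet), h.map_exp_eq,
    ← lintegral_indicator_one (hq hG'.measurableSet)]
  rfl

/-- Measurable sequences with the same finite-dimensional laws have the same law. -/
theorem map_eq_of_forall_finset {Ω : Type*} [MeasurableSpace Ω] {P : Measure Ω}
    [IsProbabilityMeasure P] {Y Z : ℕ → Ω → ℝ} (hY : ∀ k, AEMeasurable (Y k) P)
    (hZ : ∀ k, AEMeasurable (Z k) P)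
    (h : ∀ I : Finset ℕ, P.map (fun ω (k : I) => Y k ω) = P.map fun ω (k : I) => Z k ω) :
    P.map (fun ω k => Y k ω) = P.map fun ω k => Z k ω := by
  have hYm : AEMeasurable (fun ω k => Y k ω) P := aemeasurable_pi_iff.2 hY
  have hZm : AEMeasurable (fun ω k => Z k ω) P := aemeasurable_pi_iff.2 hZ
  refine IsProjectiveLimit.unique (P := fun I : Finset ℕ => P.map fun ω (k : I) => Y k ω)
    (fun I => ?_) fun I => ?_
  · rw [AEMeasurable.map_map_of_aemeasurable (by fun_prop) hYm]
    rfl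
  · rw [AEMeasurable.map_map_of_aemeasurable (by fun_prop) hZm]
    exact (h I).symm

theorem mul_limitQuantile_rpow {a A v : ℝ} (ha : 0 < a) (hA : 0 < A) (hv : 0 ≤ v) :
    A * limitQuantile a A v ^ a = v := by
  rw [limitQuantile, ← Real.rpow_mul (by positivity), one_div_mul_cancel ha.ne', Real.rpow_one]
  field_simp

/-- The order statistics of the limit are those of a Poisson process. -/
theorem exists_exp_seqOrderStat {a r : ℝ} (ha : 0 < a) (hr : 0 < r)
    {Ω' : Type*} [MeasurableSpace Ω'] {P' : Measure Ω'} [IsProbabilityMeasure P']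
    {e' g : ℕ → Ω' → ℝ} (h : IsExpGammaSeq P' a e' g)
    (hlaw : P'.map (fun ω k =>
        seqOrderStat (limitPick a r (fun i => e' i ω) (fun i => g i ω)) k) =
      P'.map fun ω k => limitQuantile a (limitConst a r) (∑ i ∈ Finset.range (k + 1), e' i ω)) :
    ∃ e : ℕ → Ω' → ℝ, (∀ k, Measurable (e k)) ∧ (∀ k, HasLaw (e k) (expMeasure 1) P') ∧
      iIndepFun e P' ∧
      ∀ᵐ ω ∂P', ∀ k, seqOrderStat (limitPick a r (fun i => e' i ω) (fun i => g i ω)) k =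
        (∑ i ∈ Finset.range (k + 1), e i ω) ^ (1 / a) * Real.Gamma (a + 1) ^ (1 / a) / r := by
  have hG : 0 < Real.Gamma (a + 1) := Real.Gamma_pos_of_pos (by linarith)
  set A := limitConst a r with hA
  have hApos : 0 < A := by positivity
  set Y : Ω' → ℕ → ℝ := fun ω k =>
    seqOrderStat (limitPick a r (fun i => e' i ω) (fun i => g i ω)) k
  have hY : AEMeasurable Y P' := aemeasurable_pi_iff.2 fun k => (h.aemeasurable_triple ha hr k).fst
  set ψ : (ℕ → ℝ) → ℕ → ℝ := fun y k => A * y k ^ a - if k = 0 then 0 else A * y (k - 1) ^ a with hψ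
  have hψm : Measurable ψ := by
    refine measurable_pi_iff.2 fun k => ?_
    by_cases hk : k = 0
    · simp only [hψ, hk, if_true]
      fun_prop
    · simp only [hψ, hk, if_false]
      fun_prop
  have htele : ∀ y k, ∑ i ∈ Finset.range (k + 1), ψ y i = A * y k ^ a := by
    intro y k
    induction k with
    | zero => simp [hψ]
    | succ k ih =>
      rw [Finset.sum_range_succ, ih]
      simp [hψ]
  have hTm : ∀ k, Measurable fun ω => ∑ i ∈ Finset.range (k + 1), e' i ω := fun k =>
    Finset.measurable_fun_sum _ fun i _ => h.measurable_exp i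
  set Z : Ω' → ℕ → ℝ := fun ω k => limitQuantile a A (∑ i ∈ Finset.range (k + 1), e' i ω) with hZ
  have hZm : Measurable Z := measurable_pi_iff.2 fun k =>
    (measurable_limitQuantile a A).comp (hTm k)
  have hψZ : ∀ᵐ ω ∂P', ψ (Z ω) = fun k => e' k ω := by
    filter_upwards [h.ae_pos_exp] with ω hω
    have hT : ∀ k, 0 ≤ ∑ i ∈ Finset.range (k + 1), e' i ω := fun k =>
      Finset.sum_nonneg fun i _ => (hω i).le
    funext k
    cases k with
    | zero => simp [hψ, hZ, mul_limitQuantile_rpow ha hApos (hω 0).le]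
    | succ k =>
      simp only [hψ, hZ, Nat.add_sub_cancel, if_neg k.succ_ne_zero,
        mul_limitQuantile_rpow ha hApos (hT _)]
      rw [Finset.sum_range_succ, add_sub_cancel_left]
  have he'm : Measurable fun ω k => e' k ω := measurable_pi_iff.2 h.measurable_exp
  set e : ℕ → Ω' → ℝ := fun k ω => ψ (hY.mk Y ω) k with he
  have hem : Measurable fun ω k => e k ω := hψm.comp hY.measurable_mk
  have hlaw' : P'.map (fun ω k => e k ω) = P'.map fun ω k => e' k ω := by
    calc P'.map (fun ω k => e k ω) = (P'.map (hY.mk Y)).map ψ :=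
          (Measure.map_map hψm hY.measurable_mk).symm
      _ = (P'.map Y).map ψ := by rw [Measure.map_congr hY.ae_eq_mk]
      _ = (P'.map Z).map ψ := by rw [hlaw]
      _ = P'.map (fun ω => ψ (Z ω)) := Measure.map_map hψm hZm
      _ = _ := Measure.map_congr hψZ
  have hmarg : ∀ k, P'.map (e k) = P'.map (e' k) := by
    intro k
    have h1 := congrArg (Measure.map fun x : ℕ → ℝ => x k) hlaw'
    rwa [Measure.map_map (measurable_pi_apply k) hem,
      Measure.map_map (measurable_pi_apply k) he'm] at h1
  have hek : ∀ k, Measurable (e k) := fun k => measurable_pi_iff.1 hem k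
  refine ⟨e, hek, fun k => ⟨(hek k).aemeasurable, by rw [hmarg, (h.law_exp k).map_eq]⟩, ?_, ?_⟩
  · rw [iIndepFun_iff_map_fun_eq_infinitePi_map hek, hlaw']
    simp only [hmarg]
    exact (iIndepFun_iff_map_fun_eq_infinitePi_map h.measurable_exp).1 h.indep_exp
  · filter_upwards [hY.ae_eq_mk, h.ae_injective_and_pos ha hr, h.ae_tendsto_limitPick ha hr]
      with ω h1 h2 h3 k
    have hpos : 0 < Y ω k := by
      obtain ⟨j, hj⟩ := seqRank_surjective h2.2 h3 k
      simp only [Y, ← hj, seqOrderStat_seqRank h2.2 h3]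
      exact h2.1 j
    simp only [he, htele, ← h1]
    change Y ω k = _
    rw [Real.mul_rpow hApos.le (by positivity), ← Real.rpow_mul hpos.le, mul_one_div_cancel ha.ne',
      Real.rpow_one, hA, Real.div_rpow (by positivity) hG.le, ← Real.rpow_mul hr.le,
      mul_one_div_cancel ha.ne', Real.rpow_one]
    have : Real.Gamma (a + 1) ^ (1 / a) ≠ 0 := by positivity
    field_simp

theorem mainTheorem1
    -- the distribution `F` on `(0, ∞)` and its behaviour at `0`
    (F : Measure ℝ) [IsProbabilityMeasure F] (hF : F (Set.Iic 0) = 0)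
    (a r : ℝ) (ha : 0 < a) (hr : 0 < r)
    (hF0 : (fun x : ℝ => cdf F x) ~[𝓝[>] 0] fun x : ℝ => r ^ a * x ^ a / Real.Gamma (a + 1))
    -- for each `n`, an i.i.d. sample of size `n` from `F` and its size-biased permutation
    {Ω : ℕ → Type*} [∀ n, MeasurableSpace (Ω n)]
    (P : (n : ℕ) → Measure (Ω n)) [∀ n, IsProbabilityMeasure (P n)]
    (X : (n : ℕ) → Fin n → Ω n → ℝ)
    (hX_meas : ∀ n i, Measurable (X n i))
    (hX_indep : ∀ n, iIndepFun (X n) (P n))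
    (hX_law : ∀ n i, HasLaw (X n i) F (P n))
    (σ : (n : ℕ) → Ω n → Equiv.Perm (Fin n))
    (hσ : ∀ n, IsSizeBiasedPermutation (P n) (X n) (σ n))
    -- the exponential variables `e' k` and the gamma variables `γ k` of the limit
    {Ω' : Type*} [MeasurableSpace Ω'] (P' : Measure Ω') [IsProbabilityMeasure P']
    (e' γ : ℕ → Ω' → ℝ)
    (he_meas : ∀ k, Measurable (e' k)) (hγ_meas : ∀ k, Measurable (γ k))
    (he_law : ∀ k, HasLaw (e' k) (expMeasure 1) P')
    (hγ_law : ∀ k, HasLaw (γ k) (gammaMeasure (a + 1) 1) P')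
    (he_indep : iIndepFun e' P') (hγ_indep : iIndepFun γ P')
    (heγ_indep : IndepFun (fun ω k => e' k ω) (fun ω k => γ k ω) P') :
    let c : ℕ → ℝ := fun n => (n : ℝ) ^ (1 / a)
    -- rescaled last size-biased picks, rescaled smallest order statistics
    let pick : (n : ℕ) → ℕ → Ω n → ℝ := fun n k ω =>
      c n * revSeq (fun i => X n (σ n ω i) ω) k
    let ord : (n : ℕ) → ℕ → Ω n → ℝ := fun n k ω => c n * finOrderStat (fun i => X n i ω) k
    -- their limits
    let ξpick : ℕ → Ω' → ℝ := fun k ω => limitPick a r (fun i => e' i ω) (fun i => γ i ω) k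
    let ξord : ℕ → Ω' → ℝ := fun k ω => seqOrderStat (fun i => ξpick i ω) k
    -- (a)
    TendstoFDD pick ξpick P P' ∧
    -- (b)
    ((∀ᵐ ω ∂P', StrictMono fun k => ξord k ω) ∧
      (∃ e : ℕ → Ω' → ℝ, (∀ k, Measurable (e k)) ∧ (∀ k, HasLaw (e k) (expMeasure 1) P') ∧
        iIndepFun e P' ∧
        ∀ᵐ ω ∂P', ∀ k, ξord k ω =
          (∑ i ∈ Finset.range (k + 1), e i ω) ^ (1 / a) * Real.Gamma (a + 1) ^ (1 / a) / r) ∧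
      TendstoFDD (fun n k ω => (ord n k ω, pick n k ω)) (fun k ω => (ξord k ω, ξpick k ω)) P P') ∧
    -- (c)
    ∃ J : Ω' → Equiv.Perm ℕ, (∀ᵐ ω ∂P', ∀ k, ξpick k ω = ξord (J ω k) ω) ∧
      ∀ Jn : (n : ℕ) → Ω n → Equiv.Perm (Fin n),
        (∀ n k, Measurable fun ω => Jn n ω k) →
        (∀ n, ∀ᵐ ω ∂P n, ∀ k : Fin n,
          revSeq (fun i => X n (σ n ω i) ω) k = finOrderStat (fun i => X n i ω) (Jn n ω k)) →
        TendstoFDD (fun n k ω => permSeq (Jn n ω) k) (fun k ω => J ω k) P P' ∧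
        TendstoFDD (fun n k ω => (ord n k ω, pick n k ω, permSeq (Jn n ω) k))
          (fun k ω => (ξord k ω, ξpick k ω, J ω k)) P P' := by
  intro c pick ord ξpick ξord
  have hF0' : (fun x : ℝ => cdf F x) ~[𝓝[>] 0] fun x : ℝ => limitConst a r * x ^ a := by
    simpa only [limitConst, div_mul_eq_mul_div] using hF0
  have hlim : IsExpGammaSeq P' a e' γ :=
    ⟨he_meas, hγ_meas, he_law, hγ_law, he_indep, hγ_indep, heγ_indep⟩
  have hpick : ∀ n k, Measurable (pick n k) := fun n k =>
    (measurable_revSeq_comp (hX_meas n) (hσ n).measurable k).const_mul _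
  have hord : ∀ n k, Measurable (ord n k) := fun n k =>
    ((measurable_finOrderStat n k).comp (measurable_pi_iff.2 (hX_meas n))).const_mul _
  choose J₀ hJ₀ using fun n ω => exists_perm_revSeq_eq (fun i => X n i ω) (σ n ω)
  have hJ₀' : ∀ n, ∀ᵐ ω ∂P n, ∀ k : Fin n,
      revSeq (fun i => X n (σ n ω i) ω) k = finOrderStat (fun i => X n i ω) (J₀ n ω k) :=
    fun n => Eventually.of_forall (hJ₀ n)
  have hgood := (hlim.ae_injective_and_pos ha hr).and (hlim.ae_tendsto_limitPick ha hr)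
  have htriple : ∀ k, AEMeasurable (fun ω =>
      (ξord k ω, ξpick k ω, rankPerm (fun i => ξpick i ω) k)) P' :=
    hlim.aemeasurable_triple ha hr
  have hordlim : TendstoFDD ord ξord P P' :=
    tendstoFDD_comp_triple hF ha hr hF0' P X hX_meas hX_indep hX_law σ hσ hlim J₀ hJ₀'
      (φ := fun p => p.1) continuous_fst hord
  have hordlim' := tendstoFDD_finOrderStat ha
    (show 0 < limitConst a r from div_pos (by positivity) (Real.Gamma_pos_of_pos (by linarith)))
    hF0' P X hX_meas hX_indep hX_law hlim
  have hlaw : P'.map (fun ω k => ξord k ω) =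
      P'.map fun ω k => limitQuantile a (limitConst a r) (∑ i ∈ Finset.range (k + 1), e' i ω) :=
    map_eq_of_forall_finset (fun k => (htriple k).fst)
      (fun k => ((measurable_limitQuantile _ _).comp
        (Finset.measurable_fun_sum _ fun i _ => he_meas i)).aemeasurable)
      fun I => tendstoInDistribution_unique _ (hordlim I) (hordlim' I)
  refine ⟨?_, ⟨?_, exists_exp_seqOrderStat ha hr hlim hlaw, ?_⟩,
    fun ω => rankPerm fun i => ξpick i ω, ?_, fun Jn hJm hJn => ⟨?_, ?_⟩⟩
  · exact tendstoFDD_comp_triple hF ha hr hF0' P X hX_meas hX_indep hX_law σ hσ hlim J₀ hJ₀'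
      (φ := fun p => p.2.1) (by fun_prop) hpick
  · filter_upwards [hgood] with ω hω using strictMono_seqOrderStat hω.1.2 hω.2
  · exact tendstoFDD_comp_triple hF ha hr hF0' P X hX_meas hX_indep hX_law σ hσ hlim J₀ hJ₀'
      (φ := fun p => (p.1, p.2.1)) (by fun_prop) fun n k => (hord n k).prodMk (hpick n k)
  · filter_upwards [hgood] with ω hω k
    have h1 : rankPerm (fun i => ξpick i ω) k = seqRank (fun i => ξpick i ω) k :=
      rankPerm_apply hω.1.2 hω.2 k
    rw [h1]
    exact (seqOrderStat_seqRank hω.1.2 hω.2 k).symm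
  · exact tendstoFDD_comp_triple hF ha hr hF0' P X hX_meas hX_indep hX_law σ hσ hlim Jn hJn
      (φ := fun p => p.2.2) (by fun_prop) fun n k => measurable_permSeq (hJm n) k
  · exact tendstoFDD_comp_triple hF ha hr hF0' P X hX_meas hX_indep hX_law σ hσ hlim Jn hJn
      (φ := fun p => p) continuous_id fun n k =>
        (hord n k).prodMk ((hpick n k).prodMk (measurable_permSeq (hJm n) k))
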